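/- Work over $\mathbb C$. Let $V$ be a vector space of dimension $10$ with a non-degenerate quadratic form, $G=\mathrm{Spin}(V)=\mathrm{Spin}_{10}$, and let $X=OG_+(5,10)=\mathrm{Spin}_{10}/\mathrm P_5$ be the $G$-orbit of a maximal isotropic subspace $U_0\subset V$, i.e. one of the two families of $5$-dimensional isotropic subspaces $U\subset V$. Let $\mathcal U\subset V\otimes\mathcal O$ be the tautological subbundle of rank $5$. Let $S^+$, $S^-$ be the two half-spin representations, labelled so that the line $\{s : u\cdot s=0 \text{ for all } u\in U\}$ of pure spinors belonging to a point $[U]\in X$ lies in $S^+$; these lines form the line bundle $\mathcal O(-1)\subset S^+\otimes\mathcal O$, and $E(-n)=E\otimes\mathcal O(-1)^{\otimes n}$. Let $\mathcal U_{\omega_1+\omega_2}$ be the irreducible $G$-homogeneous vector bundle on $X$ with highest weight $\omega_1+\omega_2$, where the weights are normalized so that $\mathcal U^\vee=\mathcal U_{\omega_1}$ and $\wedge^2\mathcal U^\vee=\mathcal U_{\omega_2}$ (so $\mathcal U_{\omega_1+\omega_2}$ has rank $40$). Clifford multiplication gives an injective $G$-equivariant morphism $i:\mathcal U^\vee(-1)\to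 S^-\otimes\mathcal O$, $\ \bar v\otimes s\mapsto v\cdot s$, where $\bar v\in\mathcal U^\vee\cong (V\otimes\mathcal O)/\mathcal U$ is the class of $v\in V$. Let $\xi:S^-\otimes S^+\to\wedge^2V$ be the $G$-equivariant map which corresponds to the Clifford action $\wedge^2V\otimes S^-\to S^-$, $(u\wedge v)\otimes t\mapsto u\cdot v\cdot t-v\cdot u\cdot t$, under the $G$-equivariant identifications $(S^-)^\vee\cong S^+$ and $(\wedge^2V)^\vee\cong\wedge^2V$. Then there exist a $G$-equivariant vector bundle $R_5$ on $X$ which is a $G$-equivariant extension $$0\to\mathcal U^\vee(-2)\to R_5\to\mathcal U_{\omega_1+\omega_2}(-2)\to0,$$ and a $G$-equivariant exact complex of vector bundles $$0\to R_5\to\mathcal U^\vee(-1)\otimes S^+\to\wedge^2V\otimes\mathcal O\to\wedge^2\mathcal U^\vee\to0,$$ whose middle map is $\xi\circ(i\otimes\mathrm{id}_{S^+})$ and whose last map is the natural projection induced by $V\otimes\mathcal O\to\mathcal U^\vee$. -/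

import Mathlib

noncomputable section

namespace SpinorTenfold

open CliffordAlgebra Module
open scoped Matrix

/-! ### Polynomial and regular functions -/

/-- Polynomial functions on a complex vector space. -/
def polyFun (A : Type) [AddCommGroup A] [Module ℂ A] : Subalgebra ℂ (A → ℂ) :=
  Algebra.adjoin ℂ (Set.range fun φ : Dual ℂ A => (φ : A → ℂ))

/-- Regular functions on a set `Y` that is placed by `κ` as a locally closed subset of a complex
vector space `A`: the functions which are locally, in the Zariski topology, a quotient of two
polynomial functions. -/
def regularFun {Y A : Type} [AddCommGroup A] [Module ℂ A] (κ : Y → A) : Subalgebra ℂ (Y → ℂ) where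
  carrier := {f | ∀ y : Y, ∃ p ∈ polyFun A, ∃ q ∈ polyFun A, q (κ y) ≠ 0 ∧
    ∀ z : Y, q (κ z) ≠ 0 → f z = p (κ z) / q (κ z)}
  mul_mem' := by
    intro f g hf hg y
    obtain ⟨p, hp, q, hq, h0, h⟩ := hf y
    obtain ⟨p', hp', q', hq', h0', h'⟩ := hg y
    refine ⟨p * p', mul_mem hp hp', q * q', mul_mem hq hq', mul_ne_zero h0 h0', fun z hz => ?_⟩
    have hz1 : q (κ z) ≠ 0 := left_ne_zero_of_mul hz
    have hz2 : q' (κ z) ≠ 0 := right_ne_zero_of_mul hz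
    simp only [Pi.mul_apply, h z hz1, h' z hz2]
    field_simp
  add_mem' := by
    intro f g hf hg y
    obtain ⟨p, hp, q, hq, h0, h⟩ := hf y
    obtain ⟨p', hp', q', hq', h0', h'⟩ := hg y
    refine ⟨p * q' + p' * q, add_mem (mul_mem hp hq') (mul_mem hp' hq), q * q', mul_mem hq hq',
      mul_ne_zero h0 h0', fun z hz => ?_⟩
    have hz1 : q (κ z) ≠ 0 := left_ne_zero_of_mul hz
    have hz2 : q' (κ z) ≠ 0 := right_ne_zero_of_mul hz
    simp only [Pi.mul_apply, Pi.add_apply, h z hz1, h' z hz2]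
    field_simp
  algebraMap_mem' := by
    intro r y
    exact ⟨algebraMap ℂ _ r, Subalgebra.algebraMap_mem _ r, 1, one_mem _, by simp, by simp⟩

section Regular

variable {Y Y' A A' A'' : Type} [AddCommGroup A] [Module ℂ A] [AddCommGroup A'] [Module ℂ A']
  [AddCommGroup A''] [Module ℂ A'']

theorem dual_mem_polyFun (φ : Dual ℂ A) : (fun a => φ a) ∈ polyFun A :=
  Algebra.subset_adjoin ⟨φ, rfl⟩

/-- `polyFun` pulls back along a map all of whose linear coordinates are polynomial. -/
theorem polyFun_comp (F : A → A') (hF : ∀ φ : Dual ℂ A', (fun a => φ (F a)) ∈ polyFun A)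
    {p : A' → ℂ} (hp : p ∈ polyFun A') : (fun a => p (F a)) ∈ polyFun A := by
  induction hp using Algebra.adjoin_induction with
  | mem x hx => obtain ⟨φ, rfl⟩ := hx; exact hF φ
  | algebraMap r => exact Subalgebra.algebraMap_mem _ r
  | add x y _ _ hx hy => exact add_mem hx hy
  | mul x y _ _ hx hy => exact mul_mem hx hy

theorem polyFun_bilin [FiniteDimensional ℂ A] [FiniteDimensional ℂ A'] (B : A →ₗ[ℂ] A' →ₗ[ℂ] ℂ)
    (F : A'' →ₗ[ℂ] A) (F' : A'' →ₗ[ℂ] A') : (fun z => B (F z) (F' z)) ∈ polyFun A'' := by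
  have e : (fun z : A'' => B (F z) (F' z)) = ∑ j, ∑ i,
      algebraMap ℂ (A'' → ℂ) (B (finBasis ℂ A i) (finBasis ℂ A' j)) *
        ((fun z => ((finBasis ℂ A).coord i ∘ₗ F) z) *
          (fun z => ((finBasis ℂ A').coord j ∘ₗ F') z)) := by
    funext z
    conv_lhs => rw [← (finBasis ℂ A).sum_repr (F z), ← (finBasis ℂ A').sum_repr (F' z)]
    simp only [map_sum, LinearMap.sum_apply, map_smul, LinearMap.smul_apply, Finset.sum_apply,
      Pi.mul_apply, Pi.algebraMap_apply, Algebra.algebraMap_self, RingHom.id_apply, smul_eq_mul,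
      LinearMap.comp_apply, Basis.coord_apply]
    refine Finset.sum_congr rfl fun i _ => ?_
    rw [Finset.mul_sum]
    refine Finset.sum_congr rfl fun j _ => ?_
    ring
  rw [e]
  exact sum_mem fun i _ => sum_mem fun j _ => mul_mem (Subalgebra.algebraMap_mem _ _)
    (mul_mem (dual_mem_polyFun _) (dual_mem_polyFun _))

theorem regular_of_poly (κ : Y → A) {p : A → ℂ} (hp : p ∈ polyFun A) :
    (fun y => p (κ y)) ∈ regularFun κ :=
  fun _ => ⟨p, hp, 1, one_mem _, by simp, by simp⟩

theorem regular_comp (κ : Y → A) (κ' : Y' → A') (f : Y → Y') (F : A → A')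
    (hf : ∀ y, κ' (f y) = F (κ y)) (hF : ∀ φ : Dual ℂ A', (fun a => φ (F a)) ∈ polyFun A)
    {u : Y' → ℂ} (hu : u ∈ regularFun κ') : (fun y => u (f y)) ∈ regularFun κ := by
  intro y
  obtain ⟨p, hp, q, hq, h0, h⟩ := hu (f y)
  refine ⟨_, polyFun_comp F hF hp, _, polyFun_comp F hF hq, ?_, fun z hz => ?_⟩
  · simpa [← hf] using h0
  · simp only [← hf] at hz ⊢
    exact h _ hz

theorem regular_inv (κ : Y → A) {p : A → ℂ} (hp : p ∈ polyFun A) (h : ∀ y, p (κ y) ≠ 0) :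
    (fun y => (p (κ y))⁻¹) ∈ regularFun κ :=
  fun y => ⟨1, one_mem _, p, hp, h y, by simp⟩

theorem regular_det {ι : Type} [Fintype ι] [DecidableEq ι] (B : Subalgebra ℂ (Y → ℂ))
    (M : Y → Matrix ι ι ℂ) (hM : ∀ i j, (fun y => M y i j) ∈ B) :
    (fun y => (M y).det) ∈ B := by
  have e : (fun y => (M y).det) = (Matrix.of fun i j => fun y => M y i j).det := by
    funext y
    have := RingHom.map_det (Pi.evalRingHom (fun _ : Y => ℂ) y)
      (Matrix.of fun i j => fun y => M y i j)
    exact this.symm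
  rw [e, Matrix.det_apply]
  exact sum_mem fun σ _ => by
    rw [Units.smul_def, zsmul_eq_mul]
    exact mul_mem (intCast_mem _ _) (prod_mem fun i _ => hM _ _)

theorem poly_adjugate {ι : Type} [Fintype ι] [DecidableEq ι] (B : Subalgebra ℂ (Y → ℂ))
    (M : Y → Matrix ι ι ℂ) (hM : ∀ i j, (fun y => M y i j) ∈ B) (i j : ι) :
    (fun y => (M y).adjugate i j) ∈ B := by
  simp only [Matrix.adjugate_apply]
  refine regular_det B _ fun k l => ?_
  by_cases hk : k = j
  · subst hk
    simp only [Matrix.updateRow_self]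
    exact Subalgebra.algebraMap_mem B ((Pi.single i 1 : ι → ℂ) l)
  · simpa [Matrix.updateRow_ne hk] using hM k l

end Regular

/-! ### The group `Spin₁₀`, its vector representation and its spinor representations -/

/-- `W = ℂ⁵`. -/
abbrev W : Type := Fin 5 → ℂ

/-- The ten-dimensional space `V = Wᵛ ⊕ W`. -/
abbrev V : Type := Dual ℂ W × W

/-- The non-degenerate quadratic form `(f, w) ↦ f w` on `V`. -/
abbrev Q : QuadraticForm ℂ V := QuadraticForm.dualProd ℂ W

/-- The Clifford algebra of `V`, with relations `v ⬝ v = Q v`. -/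
abbrev Cl : Type := CliffordAlgebra Q

/-- The group `Spin₁₀ = Spin (V, Q)`. -/
abbrev Spin : Type := spinGroup Q

/-- The space of spinors `S = ⋀ W`. -/
abbrev S : Type := ExteriorAlgebra ℂ W

instance finiteDimensional_exteriorAlgebra (M : Type) [AddCommGroup M] [Module ℂ M]
    [FiniteDimensional ℂ M] : FiniteDimensional ℂ (ExteriorAlgebra ℂ M) :=
  Module.Finite.of_basis (finBasis ℂ M).ExteriorAlgebra

instance : FiniteDimensional ℂ Cl :=
  Module.Finite.equiv (equivExterior Q).symm

/-- The linear retraction of the inclusion of `V` in the Clifford algebra which is zero on the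
other homogeneous parts (in the identification of the Clifford algebra with `⋀ V`). -/
def vectorPart : Cl →ₗ[ℂ] V :=
  ExteriorAlgebra.ιInv ∘ₗ (equivExterior Q).toLinearMap

theorem vectorPart_ι (v : V) : vectorPart (ι Q v) = v := by
  have h : (equivExterior Q) (ι Q v) = ExteriorAlgebra.ι ℂ v :=
    changeForm_ι changeForm.associated_neg_proof v
  simp only [vectorPart, LinearMap.comp_apply, LinearEquiv.coe_coe, h]
  exact ExteriorAlgebra.ι_leftInverse v

theorem ι_vectorPart_conj (g : Spin) (v : V) :
    ι Q (vectorPart (g * ι Q v * star (g : Cl))) = g * ι Q v * star (g : Cl) := by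
  have h := spinGroup.conjAct_smul_ι_mem_range_ι (x := spinGroup.toUnits g) g.2 v
  rw [ConjAct.units_smul_def, ConjAct.ofConjAct_toConjAct] at h
  obtain ⟨w, hw⟩ := h
  have hw' : (g : Cl) * ι Q v * star (g : Cl) = ι Q w := hw.symm
  rw [hw', vectorPart_ι]

/-- The vector representation of `Spin₁₀` on `V`, by conjugation in the Clifford algebra:
`ι (g v) = g ι(v) g⁻¹`, where `g⁻¹ = star g`. -/
def vecRep : Representation ℂ Spin V where
  toFun g := vectorPart ∘ₗ LinearMap.mulRight ℂ (star (g : Cl)) ∘ₗ LinearMap.mulLeft ℂ (g : Cl) ∘ₗ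
    ι Q
  map_one' := by
    refine LinearMap.ext fun v => ?_
    simp [vectorPart_ι]
  map_mul' g h := by
    refine LinearMap.ext fun v => ?_
    simp only [LinearMap.comp_apply, LinearMap.mulRight_apply, LinearMap.mulLeft_apply,
      Module.End.mul_apply, ι_vectorPart_conj]
    congr 1
    simp [mul_assoc]

theorem ι_vecRep (g : Spin) (v : V) : ι Q (vecRep g v) = g * ι Q v * star (g : Cl) :=
  ι_vectorPart_conj g v

/-- The action `η : V ⊗ S → S`: a vector `w ∈ W` acts by exterior multiplication and a linear form
on `W` by contraction. -/
def cliffordAction : V →ₗ[ℂ] Module.End ℂ S where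
  toFun v := contractLeft v.1 + LinearMap.mulLeft ℂ (ExteriorAlgebra.ι ℂ v.2)
  map_add' u v := by
    refine LinearMap.ext fun s => ?_
    simp [add_mul]
    abel
  map_smul' c v := by
    refine LinearMap.ext fun s => ?_
    simp

theorem cliffordAction_sq (v : V) :
    cliffordAction v * cliffordAction v = algebraMap ℂ (Module.End ℂ S) (Q v) := by
  refine LinearMap.ext fun s => ?_
  have h1 : contractLeft v.1 (ExteriorAlgebra.ι ℂ v.2 * s) =
      v.1 v.2 • s - ExteriorAlgebra.ι ℂ v.2 * contractLeft v.1 s := contractLeft_ι_mul _ _ _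
  have h2 : contractLeft v.1 (contractLeft v.1 s) = 0 := contractLeft_contractLeft _ _
  have h3 : ExteriorAlgebra.ι ℂ v.2 * (ExteriorAlgebra.ι ℂ v.2 * s) = 0 := by
    rw [← mul_assoc, ExteriorAlgebra.ι_sq_zero, zero_mul]
  simp only [cliffordAction, LinearMap.coe_mk, AddHom.coe_mk, Module.End.mul_apply,
    LinearMap.add_apply, LinearMap.mulLeft_apply, mul_add, h1, h2, h3,
    QuadraticForm.dualProd_apply, Module.algebraMap_end_apply]
  abel

/-- The action of the Clifford algebra on spinors which extends `cliffordAction`. -/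
def cliffordRep : Cl →ₐ[ℂ] Module.End ℂ S :=
  CliffordAlgebra.lift Q ⟨cliffordAction, cliffordAction_sq⟩

/-- The representation of `Spin₁₀` on `S`. -/
def spinRep : Representation ℂ Spin S :=
  cliffordRep.toMonoidHom.comp (spinGroup Q).subtype

/-- The half-spin representations: `halfSpin 0` is `S⁺ = ⋀ᵉᵛ W`, and `halfSpin 1` is
`S⁻ = ⋀ᵒᵈᵈ W`. -/
def halfSpin (i : ZMod 2) : Submodule ℂ S :=
  CliffordAlgebra.evenOdd (0 : QuadraticForm ℂ W) i

/-- A representation on `A` is algebraic if its matrix coefficients are polynomial functions on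
the group. -/
def IsAlgebraic {A : Type} [AddCommGroup A] [Module ℂ A] (ρ : Representation ℂ Spin A) : Prop :=
  ∀ (φ : Dual ℂ A) (a : A), ∃ p ∈ polyFun Cl, ∀ g : Spin, φ (ρ g a) = p (g : Cl)

theorem isAlgebraic_vecRep : IsAlgebraic vecRep := fun φ v =>
  ⟨_, polyFun_bilin ((LinearMap.mul ℂ Cl).compr₂ (φ ∘ₗ vectorPart))
    (LinearMap.mulRight ℂ (ι Q v)) (reverse ∘ₗ involute.toLinearMap), fun _ => rfl⟩

theorem isAlgebraic_spinRep : IsAlgebraic spinRep := fun φ s =>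
  ⟨_, dual_mem_polyFun (φ ∘ₗ LinearMap.applyₗ s ∘ₗ cliffordRep.toLinearMap), fun _ => rfl⟩

theorem contractLeft_mem_halfSpin (d : Dual ℂ W) (i : ZMod 2) {s : S} (hs : s ∈ halfSpin i) :
    contractLeft d s ∈ halfSpin (i + 1) := by
  unfold halfSpin at hs ⊢
  have h01 : ∀ j : ZMod 2, j = 0 ∨ j = 1 := by decide
  have h11 : ∀ j : ZMod 2, 1 + (1 + (j + 1)) = j + 1 := by decide
  have key : ∀ (j k : ZMod 2) (m : W) (y : S), 1 + j = k →
      y ∈ evenOdd (0 : QuadraticForm ℂ W) j → ι (0 : QuadraticForm ℂ W) m * y ∈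
        evenOdd (0 : QuadraticForm ℂ W) k := by
    rintro j k m y rfl hy
    exact evenOdd_mul_le _ 1 j (Submodule.mul_mem_mul (ι_mem_evenOdd_one _ _) hy)
  induction s, hs using evenOdd_induction with
  | range_ι_pow v h =>
    obtain rfl | rfl := h01 i
    · obtain ⟨r, rfl⟩ := Submodule.mem_one.mp h
      simp
    · simp only [ZMod.val_one, pow_one] at h
      obtain ⟨w, rfl⟩ := h
      rw [contractLeft_ι]
      exact SetLike.algebraMap_mem_graded (evenOdd (0 : QuadraticForm ℂ W)) _
  | add x y _ _ hx hy => rw [map_add]; exact add_mem hx hy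
  | ι_mul_ι_mul m₁ m₂ x hx ih =>
    rw [mul_assoc, contractLeft_ι_mul, contractLeft_ι_mul, mul_sub, mul_smul_comm]
    exact sub_mem (Submodule.smul_mem _ _ (key i _ _ _ (add_comm _ _) hx))
      (sub_mem (Submodule.smul_mem _ _ (key i _ _ _ (add_comm _ _) hx))
        (key (1 + (i + 1)) _ _ _ (h11 i) (key (i + 1) _ _ _ rfl ih)))

theorem cliffordAction_mem_halfSpin (v : V) (i : ZMod 2) {s : S} (hs : s ∈ halfSpin i) :
    cliffordAction v s ∈ halfSpin (i + 1) := by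
  refine add_mem (contractLeft_mem_halfSpin v.1 i hs) ?_
  have h : ExteriorAlgebra.ι ℂ v.2 * s ∈ halfSpin (1 + i) :=
    evenOdd_mul_le _ 1 i (Submodule.mul_mem_mul (ι_mem_evenOdd_one _ _) hs)
  rwa [add_comm] at h

theorem cliffordRep_mem_halfSpin {x : Cl} (hx : x ∈ evenOdd Q 0) (i : ZMod 2) {s : S}
    (hs : s ∈ halfSpin i) : cliffordRep x s ∈ halfSpin i := by
  induction x, hx using even_induction with
  | algebraMap r => simpa using Submodule.smul_mem _ r hs
  | add x y _ _ hx hy => rw [map_add]; exact add_mem hx hy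
  | ι_mul_ι_mul m₁ m₂ x _ ih =>
    have h := cliffordAction_mem_halfSpin m₁ _ (cliffordAction_mem_halfSpin m₂ _ ih)
    rw [add_assoc, show (1 + 1 : ZMod 2) = 0 from rfl, add_zero] at h
    simpa [cliffordRep] using h

theorem spinRep_mem_halfSpin (g : Spin) (i : ZMod 2) {s : S} (hs : s ∈ halfSpin i) :
    spinRep g s ∈ halfSpin i :=
  cliffordRep_mem_halfSpin (spinGroup.mem_even g.2) i hs

/-! ### The spinor tenfold `X = OG₊(5,10) = Spin₁₀ / P₅` -/

/-- The maximal isotropic subspace `Wᵛ` of `V`. -/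
def U₀ : Submodule ℂ V := Submodule.prod ⊤ ⊥

/-- `X = OG₊(5,10)`: the `Spin₁₀`-orbit of the maximal isotropic subspace `U₀`, that is, one of the
two families of five-dimensional isotropic subspaces of `V`. -/
def X : Type := {U : Submodule ℂ V // ∃ g : Spin, U = U₀.map (vecRep g)}

/-- The subspace of `V` which is the point `x` of `X`; it is the fibre at `x` of the tautological
bundle. -/
def X.space (x : X) : Submodule ℂ V := x.1

instance : MulAction Spin X where
  smul g x := ⟨x.1.map (vecRep g), by
    obtain ⟨h, hh⟩ := x.2
    exact ⟨g * h, by rw [hh, map_mul, ← Submodule.map_comp]; rfl⟩⟩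
  one_smul x := Subtype.ext (by
    change x.1.map (vecRep 1) = x.1
    rw [map_one]; exact Submodule.map_id _)
  mul_smul g h x := Subtype.ext (by
    change x.1.map (vecRep (g * h)) = (x.1.map (vecRep h)).map (vecRep g)
    rw [map_mul, ← Submodule.map_comp]; rfl)

theorem X.space_smul (g : Spin) (x : X) : (g • x).space = x.space.map (vecRep g) := rfl

/-- The base point of `X`. -/
def x₀ : X := ⟨U₀, 1, by rw [map_one]; exact (Submodule.map_id _).symm⟩

theorem X.exists_smul (x : X) : ∃ g : Spin, g • x₀ = x := by
  obtain ⟨g, hg⟩ := x.2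
  exact ⟨g, Subtype.ext hg.symm⟩

/-- The Zariski topology of `X`, as the quotient of that of `Spin₁₀` by the orbit map
`g ↦ g • x₀`. -/
def IsZariskiOpen (D : Set X) : Prop :=
  ∀ g : Spin, g • x₀ ∈ D → ∃ q ∈ polyFun Cl, q (g : Cl) ≠ 0 ∧
    ∀ h : Spin, q (h : Cl) ≠ 0 → h • x₀ ∈ D

/-! ### Equivariant vector bundles on `X` -/

/-- A local frame of a family of vector spaces over `X`. -/
structure LocalFrame (F : X → Type) [∀ x, AddCommGroup (F x)] [∀ x, Module ℂ (F x)] where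
  /-- The domain of the frame. -/
  dom : Set X
  isOpen : IsZariskiOpen dom
  /-- The number of sections in the frame. -/
  rank : ℕ
  /-- The basis of the fibre at a point of the domain. -/
  basis : ∀ x ∈ dom, Basis (Fin rank) ℂ (F x)

/-- The matrix coefficients of a linear map between two fibres, in local frames. -/
def LocalFrame.coeff {F F' : X → Type} [∀ x, AddCommGroup (F x)] [∀ x, Module ℂ (F x)]
    [∀ x, AddCommGroup (F' x)] [∀ x, Module ℂ (F' x)] (e : LocalFrame F) (e' : LocalFrame F')
    {x y : X} (hx : x ∈ e.dom) (hy : y ∈ e'.dom) (L : F x →ₗ[ℂ] F' y)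
    (i : Fin e.rank) (j : Fin e'.rank) : ℂ :=
  (e'.basis y hy).repr (L (e.basis x hx i)) j

/-- A `Spin₁₀`-equivariant algebraic vector bundle on `X`: a family of vector spaces with a linear
action of the group that covers the action on `X`, and an atlas of local frames in which the action
`(g, v) ↦ g v` is given by regular functions on `Spin₁₀ × X` (with `g = 1`, the transition
functions are regular). Functions on open subsets of `X` and `Spin₁₀ × X` are regular if they
become so on pulling them back along the quotient maps from `Spin₁₀` and `Spin₁₀ × Spin₁₀`. -/
structure EquivariantBundle where
  /-- The fibres. -/
  Fiber : X → Type
  [acg : ∀ x, AddCommGroup (Fiber x)]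
  [mod : ∀ x, Module ℂ (Fiber x)]
  /-- The action of `g` from the fibre at `x` to the fibre at `y = g • x`. -/
  act : ∀ (g : Spin) {x y : X}, g • x = y → (Fiber x →ₗ[ℂ] Fiber y)
  act_one : ∀ (x : X) (v : Fiber x), act 1 (one_smul Spin x) v = v
  act_mul : ∀ (g h : Spin) {x y z : X} (hxy : h • x = y) (hyz : g • y = z) (hxz : (g * h) • x = z)
    (v : Fiber x), act (g * h) hxz v = act g hyz (act h hxy v)
  /-- The local frames which define the structure of a vector bundle. -/
  atlas : Set (LocalFrame Fiber)
  cover : ∀ x, ∃ e ∈ atlas, x ∈ e.dom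
  regular : ∀ e ∈ atlas, ∀ e' ∈ atlas, ∀ (i : Fin e.rank) (j : Fin e'.rank),
    (fun y : {p : Spin × Spin // p.2 • x₀ ∈ e.dom ∧ p.1 • p.2 • x₀ ∈ e'.dom} =>
      e.coeff e' y.2.1 y.2.2 (act y.1.1 rfl) i j) ∈
    regularFun fun y : {p : Spin × Spin // p.2 • x₀ ∈ e.dom ∧ p.1 • p.2 • x₀ ∈ e'.dom} =>
      ((y.1.1 : Cl), (y.1.2 : Cl))

attribute [instance] EquivariantBundle.acg EquivariantBundle.mod

namespace EquivariantBundle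

/-- Morphisms of equivariant vector bundles: families of linear maps which commute with the
action of the group and are given by regular functions in local frames. -/
structure Hom (E F : EquivariantBundle) where
  /-- The linear maps on the fibres. -/
  app : ∀ x : X, E.Fiber x →ₗ[ℂ] F.Fiber x
  equivariant : ∀ (g : Spin) {x y : X} (h : g • x = y) (v : E.Fiber x),
    app y (E.act g h v) = F.act g h (app x v)
  regular : ∀ e ∈ E.atlas, ∀ e' ∈ F.atlas, ∀ (i : Fin e.rank) (j : Fin e'.rank),
    (fun y : {g : Spin // g • x₀ ∈ e.dom ∧ g • x₀ ∈ e'.dom} =>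
      e.coeff e' y.2.1 y.2.2 (app _) i j) ∈
    regularFun fun y : {g : Spin // g • x₀ ∈ e.dom ∧ g • x₀ ∈ e'.dom} => (y.1 : Cl)

/-- The trivial bundle `A ⊗ 𝒪` of an algebraic representation `A` of `Spin₁₀`. -/
def trivial {A : Type} [AddCommGroup A] [Module ℂ A] [FiniteDimensional ℂ A]
    (ρ : Representation ℂ Spin A) (hρ : IsAlgebraic ρ) : EquivariantBundle where
  Fiber _ := A
  act g _ _ _ := ρ g
  act_one _ v := by simp
  act_mul g h _ _ _ _ _ _ v := by simp
  atlas := {{ dom := Set.univ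
              isOpen := fun _ _ => ⟨1, one_mem _, by simp, by simp⟩
              rank := finrank ℂ A
              basis := fun _ _ => finBasis ℂ A }}
  cover x := ⟨_, rfl, Set.mem_univ _⟩
  regular := by
    rintro e rfl e' rfl i j
    obtain ⟨p, hp, h⟩ := hρ ((finBasis ℂ A).coord j) (finBasis ℂ A i)
    have := polyFun_comp (fun a : Cl × Cl => a.1)
      (fun φ => dual_mem_polyFun (φ ∘ₗ LinearMap.fst ℂ Cl Cl)) hp
    convert regular_of_poly _ this using 1
    funext y
    exact h _

theorem coeff_congr (E : EquivariantBundle) (e e' : LocalFrame E.Fiber) {g g' : Spin}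
    {x y x' y' : X} (hg : g = g') (hxx : x = x') (hyy : y = y') (h : g • x = y) (h' : g' • x' = y')
    (hx : x ∈ e.dom) (hx' : x' ∈ e.dom) (hy : y ∈ e'.dom) (hy' : y' ∈ e'.dom) (i : Fin e.rank)
    (j : Fin e'.rank) :
    e.coeff e' hx hy (E.act g h) i j = e.coeff e' hx' hy' (E.act g' h') i j := by
  subst hg hxx hyy; rfl

/-- Regularity of the action, for varying group elements and points. -/
theorem regular_act (E : EquivariantBundle) {e e' : LocalFrame E.Fiber} (he : e ∈ E.atlas)
    (he' : e' ∈ E.atlas) {Y A : Type} [AddCommGroup A] [Module ℂ A] (κ : Y → A)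
    (g k : Y → Spin) (F : A → Cl × Cl) (hF : ∀ φ : Dual ℂ (Cl × Cl), (fun a => φ (F a)) ∈ polyFun A)
    (hgk : ∀ y, ((g y : Cl), (k y : Cl)) = F (κ y)) (x z : Y → X) (hx : ∀ y, k y • x₀ = x y)
    (hz : ∀ y, g y • x y = z y) (hxe : ∀ y, x y ∈ e.dom) (hze : ∀ y, z y ∈ e'.dom)
    (i : Fin e.rank) (j : Fin e'.rank) :
    (fun y => e.coeff e' (hxe y) (hze y) (E.act (g y) (hz y)) i j) ∈ regularFun κ := by
  have := regular_comp κ _ (fun y : Y => (⟨(g y, k y), by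
    have h1 := hxe y; have h2 := hze y
    rw [← hz, ← hx] at h2; rw [← hx] at h1
    exact ⟨h1, h2⟩⟩ : {p : Spin × Spin // p.2 • x₀ ∈ e.dom ∧ p.1 • p.2 • x₀ ∈ e'.dom})) F hgk hF
    (E.regular e he e' he' i j)
  convert this using 1
  funext y
  exact E.coeff_congr e e' rfl (hx y).symm (by simp only [← hz, ← hx]) _ _ _ _ _ _ _ _

/-- The dual bundle. -/
def dual (E : EquivariantBundle) : EquivariantBundle where
  Fiber x := Dual ℂ (E.Fiber x)
  act g x y h := (E.act g⁻¹ (by rw [← h, inv_smul_smul])).dualMap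
  act_one x f := by
    refine LinearMap.ext fun v => ?_
    simp only [LinearMap.dualMap_apply, inv_one, E.act_one]
  act_mul g h x y z hxy hyz hxz f := by
    refine LinearMap.ext fun v => ?_
    simp only [LinearMap.dualMap_apply, mul_inv_rev]
    rw [E.act_mul]
  atlas := (fun e => { e with basis := fun x hx => (e.basis x hx).dualBasis }) '' E.atlas
  cover x := by
    obtain ⟨e, he, hx⟩ := E.cover x
    exact ⟨_, ⟨e, he, rfl⟩, hx⟩
  regular := by
    rintro _ ⟨e, he, rfl⟩ _ ⟨e', he', rfl⟩ i j
    have := E.regular_act he' he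
      (fun y : {p : Spin × Spin // p.2 • x₀ ∈ e.dom ∧ p.1 • p.2 • x₀ ∈ e'.dom} =>
        ((y.1.1 : Cl), (y.1.2 : Cl))) (fun y => y.1.1⁻¹) (fun y => y.1.1 * y.1.2)
      (fun a => (star a.1, a.1 * a.2)) (fun φ => by
        have h1 := dual_mem_polyFun (φ ∘ₗ LinearMap.inl ℂ Cl Cl ∘ₗ reverse ∘ₗ
          involute.toLinearMap ∘ₗ LinearMap.fst ℂ Cl Cl)
        have h2 := polyFun_bilin ((LinearMap.mul ℂ Cl).compr₂ (φ ∘ₗ LinearMap.inr ℂ Cl Cl))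
          (LinearMap.fst ℂ Cl Cl) (LinearMap.snd ℂ Cl Cl)
        convert add_mem h1 h2 using 1
        funext a
        simp [star_def, ← map_add]) (fun y => rfl) (fun y => y.1.1 • y.1.2 • x₀)
      (fun y => y.1.2 • x₀) (fun y => mul_smul _ _ _) (fun y => inv_smul_smul _ _)
      (fun y => y.2.2) (fun y => y.2.1) j i
    convert this using 1
    funext y
    simp [LocalFrame.coeff]

/-- The tensor product of two bundles. -/
def tensor (E F : EquivariantBundle) : EquivariantBundle where
  Fiber x := TensorProduct ℂ (E.Fiber x) (F.Fiber x)
  act g x y h := TensorProduct.map (E.act g h) (F.act g h)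
  act_one x v := by
    induction v with
    | zero => simp
    | tmul a b => simp [E.act_one, F.act_one]
    | add a b ha hb => rw [map_add, ha, hb]
  act_mul g h x y z hxy hyz hxz v := by
    induction v with
    | zero => simp
    | tmul a b =>
      simp only [TensorProduct.map_tmul]
      rw [E.act_mul g h hxy hyz, F.act_mul g h hxy hyz]
    | add a b ha hb => simp only [map_add, ha, hb]
  atlas := {d | ∃ e ∈ E.atlas, ∃ f ∈ F.atlas, d =
    { dom := e.dom ∩ f.dom
      isOpen := fun g hg => by
        obtain ⟨q, hq, h0, h⟩ := e.isOpen g hg.1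
        obtain ⟨q', hq', h0', h'⟩ := f.isOpen g hg.2
        exact ⟨q * q', mul_mem hq hq', mul_ne_zero h0 h0', fun k hk =>
          ⟨h k (left_ne_zero_of_mul hk), h' k (right_ne_zero_of_mul hk)⟩⟩
      rank := e.rank * f.rank
      basis := fun x hx =>
        ((e.basis x hx.1).tensorProduct (f.basis x hx.2)).reindex finProdFinEquiv }}
  cover x := by
    obtain ⟨e, he, hx⟩ := E.cover x
    obtain ⟨f, hf, hx'⟩ := F.cover x
    exact ⟨_, ⟨e, he, f, hf, rfl⟩, hx, hx'⟩
  regular := by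
    rintro _ ⟨e, he, f, hf, rfl⟩ _ ⟨e', he', f', hf', rfl⟩ i j
    have h1 := E.regular_act he he'
      (fun y : {p : Spin × Spin // p.2 • x₀ ∈ e.dom ∩ f.dom ∧ p.1 • p.2 • x₀ ∈ e'.dom ∩ f'.dom} =>
        ((y.1.1 : Cl), (y.1.2 : Cl))) (fun y => y.1.1) (fun y => y.1.2) id dual_mem_polyFun
      (fun _ => rfl) _ _ (fun y => rfl) (fun y => rfl) (fun y => y.2.1.1) (fun y => y.2.2.1)
      (finProdFinEquiv.symm i).1 (finProdFinEquiv.symm j).1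
    have h2 := F.regular_act hf hf'
      (fun y : {p : Spin × Spin // p.2 • x₀ ∈ e.dom ∩ f.dom ∧ p.1 • p.2 • x₀ ∈ e'.dom ∩ f'.dom} =>
        ((y.1.1 : Cl), (y.1.2 : Cl))) (fun y => y.1.1) (fun y => y.1.2) id dual_mem_polyFun
      (fun _ => rfl) _ _ (fun y => rfl) (fun y => rfl) (fun y => y.2.1.2) (fun y => y.2.2.2)
      (finProdFinEquiv.symm i).2 (finProdFinEquiv.symm j).2
    convert mul_mem h1 h2 using 1
    funext y
    simp [LocalFrame.coeff, Basis.tensorProduct_apply']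
    exact mul_comm _ _

/-- The exterior powers of a bundle. -/
def extPow (E : EquivariantBundle) (n : ℕ) : EquivariantBundle where
  Fiber x := ⋀[ℂ]^n (E.Fiber x)
  act g x y h := exteriorPower.map n (E.act g h)
  act_one x v := by
    have : E.act 1 (one_smul Spin x) = LinearMap.id := LinearMap.ext (E.act_one x)
    rw [this, exteriorPower.map_id]; rfl
  act_mul g h x y z hxy hyz hxz v := by
    have : E.act (g * h) hxz = E.act g hyz ∘ₗ E.act h hxy :=
      LinearMap.ext (E.act_mul g h hxy hyz hxz)
    rw [this, exteriorPower.map_comp]; rfl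
  atlas := (fun e =>
    { dom := e.dom
      isOpen := e.isOpen
      rank := Nat.card (Set.powersetCard (Fin e.rank) n)
      basis := fun x hx => ((e.basis x hx).exteriorPower n).reindex (Finite.equivFin _) }) '' E.atlas
  cover x := by
    obtain ⟨e, he, hx⟩ := E.cover x
    exact ⟨_, ⟨e, he, rfl⟩, hx⟩
  regular := by
    rintro _ ⟨e, he, rfl⟩ _ ⟨e', he', rfl⟩ i j
    have := regular_det _ (fun (y : {p : Spin × Spin // p.2 • x₀ ∈ e.dom ∧
        p.1 • p.2 • x₀ ∈ e'.dom}) => Matrix.of fun a b : Fin n =>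
          e.coeff e' y.2.1 y.2.2 (E.act y.1.1 rfl)
            (Set.powersetCard.ofFinEmbEquiv.symm ((Finite.equivFin _).symm i) a)
            (Set.powersetCard.ofFinEmbEquiv.symm ((Finite.equivFin _).symm j) b))
      fun a b => E.regular e he e' he' _ _
    convert this using 1
    funext y
    simp only [LocalFrame.coeff, Basis.repr_reindex_apply, Basis.reindex_apply,
      exteriorPower.basis_apply, exteriorPower.basis_repr_apply, exteriorPower.ιMulti_family,
      exteriorPower.map_apply_ιMulti, exteriorPower.ιMultiDual_apply_ιMulti]
    rfl

/-- A linear projection to the fibre at the base point. -/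
def retr {A : Type} [AddCommGroup A] [Module ℂ A] (N : X → Submodule ℂ A) : A →ₗ[ℂ] N x₀ :=
  Classical.choose ((N x₀).subtype.exists_leftInverse_of_injective (N x₀).ker_subtype)

theorem retr_apply {A : Type} [AddCommGroup A] [Module ℂ A] (N : X → Submodule ℂ A)
    (v : N x₀) : retr N (v : A) = v :=
  LinearMap.congr_fun
    (Classical.choose_spec ((N x₀).subtype.exists_leftInverse_of_injective (N x₀).ker_subtype)) v

/-- The comparison of the fibre at `x` with the fibre at the base point, through translation by
`h⁻¹` and projection. -/
def compare {A : Type} [AddCommGroup A] [Module ℂ A] (ρ : Representation ℂ Spin A) (N : X → Submodule ℂ A)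
    (h : Spin) (x : X) : N x →ₗ[ℂ] N x₀ :=
  retr N ∘ₗ ρ h⁻¹ ∘ₗ (N x).subtype

/-- The matrix of the comparison map at `g • x₀`, in the trivialization by `g`. -/
def compareMatrix {A : Type} [AddCommGroup A] [Module ℂ A]
    [FiniteDimensional ℂ A] (ρ : Representation ℂ Spin A) (N : X → Submodule ℂ A) (h g : Spin) :
    Matrix (Fin (finrank ℂ (N x₀))) (Fin (finrank ℂ (N x₀))) ℂ :=
  LinearMap.toMatrix (finBasis ℂ (N x₀)) (finBasis ℂ (N x₀))
    (retr N ∘ₗ ρ h⁻¹ ∘ₗ ρ g ∘ₗ (N x₀).subtype)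

theorem compareMatrix_poly {A : Type} [AddCommGroup A] [Module ℂ A]
    [FiniteDimensional ℂ A] (ρ : Representation ℂ Spin A) (hρ : IsAlgebraic ρ) (N : X → Submodule ℂ A)
    (h : Spin) :
    ∃ P : Cl → Matrix (Fin (finrank ℂ (N x₀))) (Fin (finrank ℂ (N x₀))) ℂ,
      (∀ i j, (fun c => P c i j) ∈ polyFun Cl) ∧ ∀ g : Spin, compareMatrix ρ N h g = P (g : Cl) := by
  choose p hp hpe using fun i j : Fin (finrank ℂ (N x₀)) =>
    hρ ((finBasis ℂ (N x₀)).coord i ∘ₗ retr N ∘ₗ ρ h⁻¹) (finBasis ℂ (N x₀) j : A)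
  refine ⟨fun c => Matrix.of fun i j => p i j c, fun i j => hp i j, fun g => ?_⟩
  ext i j
  rw [compareMatrix, LinearMap.toMatrix_apply]
  exact hpe i j g

theorem compareMatrix_mulVec {A : Type} [AddCommGroup A] [Module ℂ A]
    [FiniteDimensional ℂ A] (ρ : Representation ℂ Spin A) (N : X → Submodule ℂ A) (h g : Spin) {x : X} (v : N x) (u : N x₀)
    (huv : ρ g u = (v : A)) :
    compareMatrix ρ N h g *ᵥ (finBasis ℂ (N x₀)).repr u =
      (finBasis ℂ (N x₀)).repr (compare ρ N h x v) := by
  rw [compareMatrix, LinearMap.toMatrix_mulVec_repr]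
  simp [compare, huv]

theorem exists_translate {A : Type} [AddCommGroup A] [Module ℂ A]
    (ρ : Representation ℂ Spin A) (N : X → Submodule ℂ A)
    (hN : ∀ (g : Spin) (x : X), ∀ a ∈ N x, ρ g a ∈ N (g • x))
    (g : Spin) {x : X} (hx : g • x₀ = x) (v : N x) :
    ∃ u : N x₀, ρ g u = (v : A) := by
  have h := hN g⁻¹ x v v.2
  have e : g⁻¹ • x = x₀ := by rw [← hx, inv_smul_smul]
  rw [e] at h
  exact ⟨⟨_, h⟩, by simp⟩

theorem bijective_compare_iff {A : Type} [AddCommGroup A] [Module ℂ A]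
    [FiniteDimensional ℂ A] (ρ : Representation ℂ Spin A) (N : X → Submodule ℂ A)
    (hN : ∀ (g : Spin) (x : X), ∀ a ∈ N x, ρ g a ∈ N (g • x))
    (h g : Spin) :
    Function.Bijective (compare ρ N h (g • x₀)) ↔ (compareMatrix ρ N h g).det ≠ 0 := by
  have hτ : Function.Bijective ((ρ g).restrict (hN g x₀)) := by
    constructor
    · intro a b hab
      have := congrArg Subtype.val hab
      exact Subtype.ext ((Representation.apply_bijective ρ g).1 this)
    · intro v
      obtain ⟨u, hu⟩ := exists_translate ρ N hN g rfl v
      exact ⟨u, Subtype.ext hu⟩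
  have e : retr N ∘ₗ ρ h⁻¹ ∘ₗ ρ g ∘ₗ (N x₀).subtype =
      compare ρ N h (g • x₀) ∘ₗ (ρ g).restrict (hN g x₀) := rfl
  rw [compareMatrix, LinearMap.det_toMatrix, e, ← isUnit_iff_ne_zero,
    ← LinearMap.isUnit_iff_isUnit_det, Module.End.isUnit_iff, LinearMap.coe_comp]
  exact (Function.Bijective.of_comp_iff _ hτ).symm

theorem repr_compare {A : Type} [AddCommGroup A] [Module ℂ A]
    [FiniteDimensional ℂ A] (ρ : Representation ℂ Spin A) (N : X → Submodule ℂ A)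
    (hN : ∀ (g : Spin) (x : X), ∀ a ∈ N x, ρ g a ∈ N (g • x))
    (h h' g k : Spin) {x y : X} (hk : k • x₀ = x)
    (hdet : (compareMatrix ρ N h k).det ≠ 0) (v : N x) (w : N y) (hw : ρ g v = (w : A))
    (i j : Fin (finrank ℂ (N x₀))) (hv : compare ρ N h x v = finBasis ℂ (N x₀) i) :
    (finBasis ℂ (N x₀)).repr (compare ρ N h' y w) j =
      ∑ l, compareMatrix ρ N h' (g * k) j l *
        ((compareMatrix ρ N h k).det⁻¹ * (compareMatrix ρ N h k).adjugate l i) := by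
  obtain ⟨u, hu⟩ := exists_translate ρ N hN k hk v
  have h1 := compareMatrix_mulVec ρ N h k v u hu
  have h2 := compareMatrix_mulVec ρ N h' (g * k) w u (by simp [hu, hw])
  rw [hv, Basis.repr_self, Finsupp.single_eq_pi_single] at h1
  have h3 : (finBasis ℂ (N x₀)).repr u = (compareMatrix ρ N h k)⁻¹ *ᵥ Pi.single i (1 : ℂ) := by
    rw [← h1, Matrix.mulVec_mulVec, Matrix.nonsing_inv_mul _ (isUnit_iff_ne_zero.2 hdet),
      Matrix.one_mulVec]
  rw [← h2, h3, Matrix.mulVec_mulVec, Matrix.mulVec_single_one, Matrix.col_apply, Matrix.mul_apply]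
  simp [Matrix.inv_def]

/-- The local frame of a family of subspaces which is defined by the comparison map. -/
def subFrame {A : Type} [AddCommGroup A] [Module ℂ A] [FiniteDimensional ℂ A]
    (ρ : Representation ℂ Spin A) (hρ : IsAlgebraic ρ) (N : X → Submodule ℂ A)
    (hN : ∀ (g : Spin) (x : X), ∀ a ∈ N x, ρ g a ∈ N (g • x))
    (h : Spin) : LocalFrame (fun x => N x) where
  dom := {x | Function.Bijective (compare ρ N h x)}
  isOpen g hg := by
    obtain ⟨P, hP, hPe⟩ := compareMatrix_poly ρ hρ N h
    simp only [Set.mem_ofPred_eq, bijective_compare_iff ρ N hN, hPe] at hg ⊢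
    exact ⟨fun c => (P c).det, regular_det _ P hP, hg, fun _ h => h⟩
  rank := finrank ℂ (N x₀)
  basis x hx := (finBasis ℂ (N x₀)).map (LinearEquiv.ofBijective _ hx).symm

/-- The subbundle of the trivial bundle `A ⊗ 𝒪` with given fibres `N x`, which have to be permuted
by the group. -/
def subbundle {A : Type} [AddCommGroup A] [Module ℂ A] [FiniteDimensional ℂ A]
    (ρ : Representation ℂ Spin A) (hρ : IsAlgebraic ρ) (N : X → Submodule ℂ A)
    (hN : ∀ (g : Spin) (x : X), ∀ a ∈ N x, ρ g a ∈ N (g • x)) : EquivariantBundle where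
  Fiber x := N x
  act g x y h := (ρ g).restrict (fun a ha => by rw [← h]; exact hN g x a ha)
  act_one x v := by
    apply Subtype.ext
    simp
  act_mul g h x y z hxy hyz hxz v := by
    apply Subtype.ext
    simp
  atlas := Set.range (subFrame ρ hρ N hN)
  cover x := by
    obtain ⟨g, rfl⟩ := x.exists_smul
    refine ⟨_, ⟨g, rfl⟩, (bijective_compare_iff ρ N hN g g).2 ?_⟩
    have : retr N ∘ₗ ρ g⁻¹ ∘ₗ ρ g ∘ₗ (N x₀).subtype = LinearMap.id :=
      LinearMap.ext fun v => by simp [retr_apply]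
    rw [compareMatrix, this]
    simp
  regular := by
    rintro _ ⟨h, rfl⟩ _ ⟨h', rfl⟩ i j
    obtain ⟨P, hP, hPe⟩ := compareMatrix_poly ρ hρ N h
    obtain ⟨P', hP', hPe'⟩ := compareMatrix_poly ρ hρ N h'
    have hmul : ∀ φ : Dual ℂ Cl, (fun a : Cl × Cl => φ (a.1 * a.2)) ∈ polyFun (Cl × Cl) := fun φ =>
      polyFun_bilin ((LinearMap.mul ℂ Cl).compr₂ φ) (LinearMap.fst ℂ Cl Cl) (LinearMap.snd ℂ Cl Cl)
    have hsnd : ∀ φ : Dual ℂ Cl, (fun a : Cl × Cl => φ a.2) ∈ polyFun (Cl × Cl) := fun φ =>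
      dual_mem_polyFun (φ ∘ₗ LinearMap.snd ℂ Cl Cl)
    have hdet : (fun a : Cl × Cl => (P a.2).det) ∈ polyFun (Cl × Cl) :=
      polyFun_comp (fun a : Cl × Cl => a.2) hsnd (regular_det _ P hP)
    set Y := {p : Spin × Spin // p.2 • x₀ ∈ (subFrame ρ hρ N hN h).dom ∧
      p.1 • p.2 • x₀ ∈ (subFrame ρ hρ N hN h').dom} with hY
    have hne : ∀ y : Y, (P (y.1.2 : Cl)).det ≠ 0 := fun y => by
      rw [← hPe]; exact (bijective_compare_iff ρ N hN h _).1 y.2.1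
    have hinv := regular_inv (fun y : Y => ((y.1.1 : Cl), (y.1.2 : Cl))) hdet hne
    have hreg : (fun y : Y => ∑ l, P' (y.1.1 * y.1.2) j l *
        (((P (y.1.2 : Cl)).det)⁻¹ * (P (y.1.2 : Cl)).adjugate l i)) ∈
        regularFun fun y : Y => ((y.1.1 : Cl), (y.1.2 : Cl)) := by
      have e : (fun y : Y => ∑ l, P' (y.1.1 * y.1.2) j l *
          (((P (y.1.2 : Cl)).det)⁻¹ * (P (y.1.2 : Cl)).adjugate l i)) =
          ∑ l, (fun y : Y => P' (y.1.1 * y.1.2) j l) * ((fun y : Y => ((P (y.1.2 : Cl)).det)⁻¹) *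
            fun y : Y => (P (y.1.2 : Cl)).adjugate l i) := by
        funext y
        simp [Finset.sum_apply]
      rw [e]
      exact sum_mem fun l _ => mul_mem (regular_of_poly _ (polyFun_comp _ hmul (hP' j l)))
        (mul_mem hinv (regular_of_poly _ (polyFun_comp _ hsnd (poly_adjugate _ P hP l i))))
    convert hreg using 1
    funext y
    have hv1 : compare ρ N h _ ((subFrame ρ hρ N hN h).basis _ y.2.1 i) = finBasis ℂ (N x₀) i :=
      LinearEquiv.apply_symm_apply (LinearEquiv.ofBijective _ y.2.1) _
    have key := repr_compare ρ N hN h h' y.1.1 y.1.2 rfl (by rw [hPe]; exact hne y) _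
      (((ρ y.1.1).restrict (hN y.1.1 (y.1.2 • x₀)))
        ((subFrame ρ hρ N hN h).basis _ y.2.1 i)) rfl i j hv1
    simp only [hPe, hPe'] at key
    exact key

end EquivariantBundle

/-! ### The bundles of the complex -/

/-- The tautological bundle `𝒰` of rank five, a subbundle of `V ⊗ 𝒪`. -/
def taut : EquivariantBundle :=
  EquivariantBundle.subbundle vecRep isAlgebraic_vecRep X.space
    fun _ _ _ ha => Submodule.mem_map_of_mem ha

/-- The spinors annihilated by the isotropic subspace `x`. This is the line of pure spinors which
belongs to `x`; it lies in `S⁺`. -/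
def spinorLine (x : X) : Submodule ℂ S where
  carrier := {s | ∀ u ∈ x.space, cliffordAction u s = 0}
  add_mem' ha hb u hu := by rw [map_add, ha u hu, hb u hu, add_zero]
  zero_mem' u _ := map_zero _
  smul_mem' c s hs u hu := by rw [map_smul, hs u hu, smul_zero]

theorem cliffordAction_spinRep (g : Spin) (v : V) (s : S) :
    cliffordAction (vecRep g v) (spinRep g s) = spinRep g (cliffordAction v s) := by
  have h : ∀ v, cliffordRep (ι Q v) = cliffordAction v := fun v => by simp [cliffordRep]
  have e : ι Q (vecRep g v) * (g : Cl) = g * ι Q v := by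
    rw [ι_vecRep, mul_assoc, spinGroup.coe_star_mul_self, mul_one]
  have := LinearMap.congr_fun (congrArg cliffordRep e) s
  simp only [map_mul, h, Module.End.mul_apply] at this
  exact this

/-- The line bundle `𝒪(-1)`: the tautological bundle of the embedding of `X` in `ℙ(S⁺)` by pure
spinors, a subbundle of `S⁺ ⊗ 𝒪`. -/
def lineBundle : EquivariantBundle :=
  EquivariantBundle.subbundle spinRep isAlgebraic_spinRep spinorLine (by
    rintro g x s hs _ ⟨u, hu, rfl⟩
    rw [cliffordAction_spinRep, hs u hu, map_zero])

/-- The twist `E(-n)`. -/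
def EquivariantBundle.negTwist (E : EquivariantBundle) : ℕ → EquivariantBundle
  | 0 => E
  | n + 1 => (E.negTwist n).tensor lineBundle

/-- The trivial bundles `S⁺ ⊗ 𝒪` (for `i = 0`) and `S⁻ ⊗ 𝒪` (for `i = 1`). -/
def halfSpinBundle (i : ZMod 2) : EquivariantBundle :=
  EquivariantBundle.subbundle spinRep isAlgebraic_spinRep (fun _ => halfSpin i)
    fun g _ _ ha => spinRep_mem_halfSpin g i ha

/-- The spinor underlying an element of a fibre of `S± ⊗ 𝒪`. -/
def spinorVal {i : ZMod 2} {x : X} (s : (halfSpinBundle i).Fiber x) : S :=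
  (halfSpin i).subtype s

/-- The trivial bundle `V ⊗ 𝒪`. -/
def vecBundle : EquivariantBundle :=
  EquivariantBundle.trivial vecRep isAlgebraic_vecRep

/-- A pure tensor in a fibre of a tensor product of bundles. -/
def EquivariantBundle.tmul {E F : EquivariantBundle} {x : X} (a : E.Fiber x) (b : F.Fiber x) :
    (E.tensor F).Fiber x :=
  a ⊗ₜ[ℂ] b

/-! ### Irreducible homogeneous bundles -/

/-- The fundamental weight `ω₁ = ε₁`, in the basis `ε₁, …, ε₅` of characters of the torus in
`GL(W)` which is given by the diagonal entries. -/
def ω₁ : Fin 5 → ℤ := ![1, 0, 0, 0, 0]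

/-- The fundamental weight `ω₂ = ε₁ + ε₂`. -/
def ω₂ : Fin 5 → ℤ := ![1, 1, 0, 0, 0]

/-- The matrix of the action of a group element on `W`, which is identified with `V / U₀`, for an
element that stabilizes `U₀`. -/
def leviMatrix (g : Spin) : Matrix (Fin 5) (Fin 5) ℂ :=
  Matrix.of fun i j => (vecRep g (0, Pi.single j 1)).2 i

/-- `E` is the homogeneous bundle with highest weight `wt`: the stabilizer `P₅` of the base point
acts irreducibly on the fibre there, and the elements of `P₅` which act on `V / U₀ = U₀ᵛ` by upper
triangular matrices act on some non-zero vector `v` through the character `wt` of the diagonal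
entries, so that `v` is a highest weight vector of weight `wt`. These properties determine `E` up
to isomorphism. -/
structure EquivariantBundle.IsIrreducibleOfWeight (E : EquivariantBundle) (wt : Fin 5 → ℤ) :
    Prop where
  nontrivial : Nontrivial (E.Fiber x₀)
  irreducible : ∀ N : Submodule ℂ (E.Fiber x₀),
    (∀ (g : Spin) (hg : g • x₀ = x₀), ∀ v ∈ N, E.act g hg v ∈ N) → N = ⊥ ∨ N = ⊤
  highestWeight : ∃ v : E.Fiber x₀, v ≠ 0 ∧ ∀ (g : Spin) (hg : g • x₀ = x₀),
    (leviMatrix g).BlockTriangular id → E.act g hg v = (∏ i, leviMatrix g i i ^ wt i) • v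

/-! ### The maps of the complex -/

/-- The map `V → Uᵛ` given by the polar form of `Q`, for a point `x = U` of `X`. It induces the
isomorphism of `V / U` with `Uᵛ`. -/
def toDual (x : X) : V →ₗ[ℂ] Dual ℂ x.space :=
  x.space.subtype.dualMap ∘ₗ LinearMap.dualProd ℂ W

/-- The exterior product of two vectors. -/
def wedge (u v : V) : ⋀[ℂ]^2 V := exteriorPower.ιMulti ℂ 2 ![u, v]

/-- The coefficient of the top degree part of a spinor. -/
def topCoeff : S →ₗ[ℂ] ℂ :=
  ExteriorAlgebra.liftAlternating (Pi.single 5 Matrix.detRowAlternating)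

/-- The invariant pairing of spinors; the value at `s`, `t` is the top degree part of the exterior
product of the reverse of `s` with `t`. It makes `S⁺` the dual of `S⁻`. -/
def spinorPairing : S →ₗ[ℂ] S →ₗ[ℂ] ℂ :=
  ((LinearMap.mul ℂ S).compr₂ topCoeff).comp reverse

/-- The standard basis of `V = Wᵛ ⊕ W`. The dual basis for the polar form is given by exchanging
the two parts. -/
def vec : Fin 5 ⊕ Fin 5 → V
  | .inl i => (LinearMap.proj i, 0)
  | .inr i => (0, Pi.single i 1)

/-- The map `ξ : S⁻ ⊗ S⁺ → ⋀² V` which corresponds to the action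
`⋀² η : ⋀² V ⊗ S⁻ → S⁻`, `(u ∧ v) ⊗ t ↦ u v t - v u t`, through the identifications of `S⁺` with
the dual of `S⁻` and of `⋀² V` with its own dual; see `pairing_cliffordMap`. -/
def cliffordMap (t s : S) : ⋀[ℂ]^2 V :=
  ∑ a, ∑ b, spinorPairing s (cliffordAction (vec a) (cliffordAction (vec b) t)) •
    wedge (vec a.swap) (vec b.swap)

/-- The bilinear form on `⋀² V` induced by the polar form of `Q`. -/
def wedgePairing : ⋀[ℂ]^2 V →ₗ[ℂ] Dual ℂ (⋀[ℂ]^2 V) :=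
  exteriorPower.pairingDual ℂ V 2 ∘ₗ exteriorPower.map 2 (LinearMap.dualProd ℂ W)

theorem sum_vec (u : V) : ∑ a, LinearMap.dualProd ℂ W (vec a.swap) u • vec a = u := by
  refine Prod.ext (LinearMap.pi_ext' fun j => ?_) ?_
  · ext
    simp [vec, Fintype.sum_sum_type, Prod.fst_sum, Pi.single_apply]
  · ext j
    simp [vec, Fintype.sum_sum_type, Prod.snd_sum, Pi.single_apply]

theorem pairing_cliffordMap (t s : S) (u v : V) :
    wedgePairing (cliffordMap t s) (wedge u v) =
      spinorPairing s (cliffordAction u (cliffordAction v t) -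
        cliffordAction v (cliffordAction u t)) := by
  have h : ∀ u v : V, spinorPairing s (cliffordAction u (cliffordAction v t)) =
      ∑ a, ∑ b, LinearMap.dualProd ℂ W (vec a.swap) u * LinearMap.dualProd ℂ W (vec b.swap) v *
        spinorPairing s (cliffordAction (vec a) (cliffordAction (vec b) t)) := by
    intro u v
    conv_lhs => rw [← sum_vec u, ← sum_vec v]
    simp only [map_sum, map_smul, LinearMap.sum_apply, LinearMap.smul_apply, smul_eq_mul,
      Finset.mul_sum, mul_assoc]
    rw [Finset.sum_comm]
    exact Finset.sum_congr rfl fun a _ => Finset.sum_congr rfl fun b _ => mul_left_comm _ _ _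
  rw [map_sub, h, h, ← Finset.sum_sub_distrib]
  simp only [cliffordMap, map_sum, LinearMap.sum_apply, map_smul, LinearMap.smul_apply,
    ← Finset.sum_sub_distrib]
  refine Finset.sum_congr rfl fun a _ => Finset.sum_congr rfl fun b _ => ?_
  simp only [wedgePairing, wedge, LinearMap.comp_apply, exteriorPower.map_apply_ιMulti,
    exteriorPower.pairingDual_ιMulti_ιMulti, Matrix.det_fin_two, smul_eq_mul]
  simp
  ring

end SpinorTenfold

end

open SpinorTenfold

noncomputable section

namespace SpinorTenfold

open CliffordAlgebra Module
open scoped Matrix TensorProduct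

/-! ### Equivariant maps and the base point -/

/-! Everything is homogeneous under `Spin`, so the theorem reduces to linear algebra in the fibres
at `x₀`. A linear map of these fibres that commutes with the stabilizer extends to a morphism of
bundles by transport along the group (`Hom.ofBase`). Its regularity is automatic, because the group
action is regular (`Hom.ofEquivariant`). Injectivity, surjectivity and exactness need only be
checked at `x₀` (`Hom.exact_of_base` and its companions). Likewise, a representation of the
stabilizer embedded in the fibre of a known bundle induces a bundle (`FiberRep.bundle`). This
produces both the bundle of weight `ω₁ + ω₂` and `R₅`, the latter as a kernel.

At `x₀` one has `U₀ = Wᵛ`, the line `ℓ` of pure spinors is `ℂ · 1`, and `i` identifies `U₀ᵛ ⊗ ℓ`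
with `W ⊂ S⁻`. The middle map becomes `W ⊗ S⁺ → ⋀² V`, where `S⁺ = ⋀⁰ W ⊕ ⋀² W ⊕ ⋀⁴ W` and `⋀⁴ W ≅
Wᵛ`. The formula `cliffordMap_ι` shows what it does in each degree. It kills `W ⊗ ⋀⁰ W`. On `W ⊗ ⋀²
W` it is, up to a scalar, the product `W ⊗ ⋀² W → ⋀³ W ≅ ⋀² Wᵛ`. On `W ⊗ Wᵛ` it is `A ↦ 2A - tr(A)`,
which is invertible because it multiplies the trace by `2 - 5 = -3`. So the image is `Wᵛ ∧ V`, the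
kernel of `⋀² V → ⋀² U₀ᵛ` (`mem_cliffordRange`), and the kernel is built from `W` and the Schur
module of the partition `(2, 1)` (`sum_cliffordMap_eq_zero`, `sum_cliffordMap_ofSkew`).

The copy of `W` in the kernel is `U₀ᵛ ⊗ ℓ ⊗ ℓ`. On the quotient the stabilizer acts through its
matrix on `V / U₀`, times the square of its character on `ℓ` (`kernelTensor_act`); this accounts for
the twist by `-2`. The Schur module is irreducible because products of two reflections in the
stabilizer give enough matrices on `V / U₀` to make an invariant subspace stable under all matrices
(`eq_schurTensor_of_stabilizer`). A nonzero space of tensors with this stability contains all `x ⊗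
(x ∧ y)`, and these span. -/

theorem LocalFrame.coeff_comp {F F' F'' : X → Type} [∀ x, AddCommGroup (F x)]
    [∀ x, Module ℂ (F x)] [∀ x, AddCommGroup (F' x)] [∀ x, Module ℂ (F' x)]
    [∀ x, AddCommGroup (F'' x)] [∀ x, Module ℂ (F'' x)]
    (e : LocalFrame F) (e' : LocalFrame F') (e'' : LocalFrame F'') {x y z : X}
    (hx : x ∈ e.dom) (hy : y ∈ e'.dom) (hz : z ∈ e''.dom) (L : F x →ₗ[ℂ] F' y)
    (L' : F' y →ₗ[ℂ] F'' z) (i : Fin e.rank) (j : Fin e''.rank) :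
    e.coeff e'' hx hz (L' ∘ₗ L) i j =
      ∑ a, e.coeff e' hx hy L i a * e'.coeff e'' hy hz L' a j := by
  unfold LocalFrame.coeff
  conv_lhs => rw [LinearMap.comp_apply, ← (e'.basis y hy).sum_repr (L (e.basis x hx i))]
  simp only [map_sum, map_smul, Finsupp.finsetSum_apply, Finsupp.smul_apply, smul_eq_mul]

/-- A linear form on a product is the sum of its restrictions to the factors, so polynomiality of a
map into `Cl × Cl` can be checked on each component. -/
theorem poly_inl_add (φ : Dual ℂ (Cl × Cl)) (p r : Cl → Cl)
    (hp : (fun a => φ (p a, 0)) ∈ polyFun Cl) (hr : (fun a => φ (0, r a)) ∈ polyFun Cl) :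
    (fun a => φ (p a, r a)) ∈ polyFun Cl := by
  convert add_mem hp hr using 1
  funext a
  simp [← map_add]

namespace EquivariantBundle

variable (E F : EquivariantBundle)

/-- This is regularity of the action along the pairs `(k, 1)`, with `x₀` written as `1 • x₀`. -/
theorem regular_act_from_base {e e' : LocalFrame E.Fiber} (he : e ∈ E.atlas) (he' : e' ∈ E.atlas)
    (h0 : x₀ ∈ e.dom) {Y : Type} (k : Y → Spin) (hk : ∀ y, k y • x₀ ∈ e'.dom)
    (i : Fin e.rank) (j : Fin e'.rank) :
    (fun y => e.coeff e' h0 (hk y) (E.act (k y) rfl) i j) ∈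
      regularFun fun y : Y => (k y : Cl) :=
  E.regular_act he he' _ k (fun _ => 1) (fun a => (a, 1))
    (fun φ => poly_inl_add φ id (fun _ => 1)
      (dual_mem_polyFun (φ ∘ₗ LinearMap.inl ℂ Cl Cl)) (Subalgebra.algebraMap_mem _ (φ (0, 1))))
    (fun _ => rfl) (fun _ => x₀) (fun y => k y • x₀) (fun _ => one_smul _ _) (fun _ => rfl)
    (fun _ => h0) hk i j

/-- This is regularity of the action along the pairs `(k⁻¹, k)`; the inverse `star k` is linear in
`k`. -/
theorem regular_act_to_base {e e' : LocalFrame E.Fiber} (he : e ∈ E.atlas) (he' : e' ∈ E.atlas)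
    (h0 : x₀ ∈ e'.dom) {Y : Type} (k : Y → Spin) (hk : ∀ y, k y • x₀ ∈ e.dom)
    (i : Fin e.rank) (j : Fin e'.rank) :
    (fun y => e.coeff e' (hk y) h0 (E.act (k y)⁻¹ (inv_smul_smul _ _)) i j) ∈
      regularFun fun y : Y => (k y : Cl) :=
  E.regular_act he he' _ (fun y => (k y)⁻¹) k (fun a => (star a, a))
    (fun φ => poly_inl_add φ star id
      (dual_mem_polyFun (φ ∘ₗ LinearMap.inl ℂ Cl Cl ∘ₗ reverse ∘ₗ involute.toLinearMap))
      (dual_mem_polyFun (φ ∘ₗ LinearMap.inr ℂ Cl Cl)))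
    (fun _ => rfl) (fun y => k y • x₀) (fun _ => x₀) (fun _ => rfl)
    (fun _ => inv_smul_smul _ _) hk (fun _ => h0) i j

variable {E F}

theorem act_inv_act (g : Spin) {x y : X} (h : g • x = y) (h' : g⁻¹ • y = x) (v : E.Fiber x) :
    E.act g⁻¹ h' (E.act g h v) = v := by
  rw [← E.act_mul g⁻¹ g h h' (by rw [inv_mul_cancel, one_smul])]
  have : ∀ (k : Spin) (hk : k • x = x), k = 1 → E.act k hk v = v := by
    rintro _ _ rfl; exact E.act_one x v
  exact this _ _ (inv_mul_cancel g)

theorem act_act_inv (g : Spin) {x y : X} (h : g • x = y) (h' : g⁻¹ • y = x) (v : E.Fiber y) :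
    E.act g h (E.act g⁻¹ h' v) = v := by
  rw [← E.act_mul g g⁻¹ h' h (by rw [mul_inv_cancel, one_smul])]
  have : ∀ (k : Spin) (hk : k • y = y), k = 1 → E.act k hk v = v := by
    rintro _ _ rfl; exact E.act_one y v
  exact this _ _ (mul_inv_cancel g)

theorem act_congr {g g' : Spin} (e : g = g') {x y : X} (h : g • x = y) (h' : g' • x = y)
    (v : E.Fiber x) : E.act g h v = E.act g' h' v := by
  subst e; rfl

theorem act_injective (g : Spin) {x y : X} (h : g • x = y) : Function.Injective (E.act g h) :=
  Function.LeftInverse.injective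
    (g := E.act g⁻¹ (by rw [← h, inv_smul_smul])) fun v => act_inv_act g h _ v

theorem act_surjective (g : Spin) {x y : X} (h : g • x = y) : Function.Surjective (E.act g h) :=
  fun v => ⟨E.act g⁻¹ (by rw [← h, inv_smul_smul]) v, act_act_inv g h _ v⟩

/-- A family of linear maps which commutes with the action of the group is a morphism of bundles:
its regularity is automatic. -/
def Hom.ofEquivariant (app : ∀ x : X, E.Fiber x →ₗ[ℂ] F.Fiber x)
    (equivariant : ∀ (g : Spin) {x y : X} (h : g • x = y) (v : E.Fiber x),
      app y (E.act g h v) = F.act g h (app x v)) : E.Hom F where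
  app := app
  equivariant := equivariant
  regular := by
    intro e he e' he' i j
    obtain ⟨e₀, he₀, h0⟩ := E.cover x₀
    obtain ⟨e₀', he₀', h0'⟩ := F.cover x₀
    set Y := {g : Spin // g • x₀ ∈ e.dom ∧ g • x₀ ∈ e'.dom}
    -- Equivariance writes the map at `g • x₀` as `g ∘ (map at x₀) ∘ g⁻¹`: a constant matrix between
    -- two matrices that are regular in `g`.
    have key : (fun y : Y => e.coeff e' y.2.1 y.2.2 (app _) i j) =
        ∑ a, (fun y : Y => e.coeff e₀ y.2.1 h0 (E.act y.1⁻¹ (inv_smul_smul _ _)) i a) *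
          ∑ b, algebraMap ℂ (Y → ℂ) (e₀.coeff e₀' h0 h0' (app x₀) a b) *
            fun y : Y => e₀'.coeff e' h0' y.2.2 (F.act y.1 rfl) b j := by
      funext y
      have : app (y.1 • x₀) = (F.act y.1 rfl ∘ₗ app x₀) ∘ₗ E.act y.1⁻¹ (inv_smul_smul _ _) := by
        refine LinearMap.ext fun v => ?_
        simp only [LinearMap.comp_apply]
        rw [← equivariant, act_act_inv]
      rw [this, LocalFrame.coeff_comp e e₀ e' y.2.1 h0 y.2.2]
      simp only [LocalFrame.coeff_comp e₀ e₀' e' h0 h0' y.2.2, Finset.sum_apply, Pi.mul_apply]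
      rfl
    rw [key]
    exact sum_mem fun a _ => mul_mem
      (E.regular_act_to_base he he₀ h0 (fun y : Y => y.1) (fun y => y.2.1) i a)
      (sum_mem fun b _ => mul_mem (Subalgebra.algebraMap_mem _ _)
        (F.regular_act_from_base he₀' he' h0' (fun y : Y => y.1) (fun y => y.2.2) b j))

end EquivariantBundle

/-- A group element which moves the base point to `x`; it is trivial for `x = x₀`. -/
def X.lift (x : X) : Spin := open Classical in if x = x₀ then 1 else x.exists_smul.choose

theorem X.lift_smul (x : X) : x.lift • x₀ = x := by
  unfold X.lift
  split_ifs with h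
  · rw [h, one_smul]
  · exact x.exists_smul.choose_spec

/-- Because the lift of `x₀` is trivial, extended maps and induced actions restrict at `x₀` to the
given data, not to a conjugate of them. -/
theorem X.lift_base : X.lift x₀ = 1 := by simp [X.lift]

theorem X.lift_inv_smul (x : X) : x.lift⁻¹ • x = x₀ := by
  rw [inv_smul_eq_iff, X.lift_smul]

namespace EquivariantBundle

variable {E F : EquivariantBundle}

/-- A linear map of the fibres at the base point which commutes with the stabilizer extends to a
morphism of equivariant bundles. -/
def Hom.ofBase (f : E.Fiber x₀ →ₗ[ℂ] F.Fiber x₀)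
    (hf : ∀ (g : Spin) (hg : g • x₀ = x₀) (v : E.Fiber x₀),
      f (E.act g hg v) = F.act g hg (f v)) : E.Hom F :=
  Hom.ofEquivariant (fun x => F.act x.lift x.lift_smul ∘ₗ f ∘ₗ E.act x.lift⁻¹ x.lift_inv_smul) (by
    intro g x y h v
    simp only [LinearMap.comp_apply]
    -- Seen at `x₀` through the chosen lifts, the action of `g` is that of an element of the
    -- stabilizer, where `hf` applies.
    have hs : (y.lift⁻¹ * (g * x.lift)) • x₀ = x₀ := by
      rw [mul_smul, mul_smul, x.lift_smul, h, y.lift_inv_smul]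
    have hgx : (g * x.lift) • x₀ = y := by rw [mul_smul, x.lift_smul, h]
    obtain ⟨w, rfl⟩ := act_surjective x.lift x.lift_smul v
    rw [act_inv_act, ← E.act_mul _ _ x.lift_smul h hgx, ← E.act_mul _ _ hgx y.lift_inv_smul hs,
      hf, F.act_mul _ _ hgx y.lift_inv_smul hs, act_act_inv, F.act_mul])

theorem Hom.ofBase_app (f : E.Fiber x₀ →ₗ[ℂ] F.Fiber x₀)
    (hf : ∀ (g : Spin) (hg : g • x₀ = x₀) (v : E.Fiber x₀),
      f (E.act g hg v) = F.act g hg (f v)) : (Hom.ofBase f hf).app x₀ = f := by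
  refine LinearMap.ext fun v => ?_
  have h1 : ∀ (B : EquivariantBundle) (g : Spin) (hg : g • x₀ = x₀), g = 1 → ∀ w : B.Fiber x₀,
      B.act g hg w = w := by
    rintro B _ _ rfl w; exact B.act_one x₀ w
  change F.act _ _ (f (E.act _ _ v)) = f v
  rw [h1 F _ _ X.lift_base, h1 E _ _ (by rw [X.lift_base, inv_one])]

/-- The group permutes the fibres transitively by isomorphisms that commute with the morphism. The
same reason gives the next two results. -/
theorem Hom.injective_of_base (f : E.Hom F) (h : Function.Injective (f.app x₀)) (x : X) :
    Function.Injective (f.app x) := by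
  obtain ⟨g, hg⟩ := x.exists_smul
  intro a b hab
  obtain ⟨a, rfl⟩ := act_surjective g hg a
  obtain ⟨b, rfl⟩ := act_surjective g hg b
  rw [f.equivariant, f.equivariant] at hab
  rw [h (act_injective g hg hab)]

theorem Hom.surjective_of_base (f : E.Hom F) (h : Function.Surjective (f.app x₀)) (x : X) :
    Function.Surjective (f.app x) := by
  obtain ⟨g, hg⟩ := x.exists_smul
  intro a
  obtain ⟨a, rfl⟩ := act_surjective g hg a
  obtain ⟨b, rfl⟩ := h a
  exact ⟨E.act g hg b, f.equivariant g hg b⟩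

theorem Hom.exact_of_base {D : EquivariantBundle} (f : D.Hom E) (k : E.Hom F)
    (h : Function.Exact (f.app x₀) (k.app x₀)) (x : X) :
    Function.Exact (f.app x) (k.app x) := by
  obtain ⟨g, hg⟩ := x.exists_smul
  intro a
  obtain ⟨a, rfl⟩ := act_surjective g hg a
  rw [k.equivariant, map_eq_zero_iff _ (act_injective g hg), h a]
  constructor
  · rintro ⟨b, rfl⟩
    exact ⟨D.act g hg b, f.equivariant g hg b⟩
  · rintro ⟨b, hb⟩
    obtain ⟨b, rfl⟩ := act_surjective g hg b
    rw [f.equivariant] at hb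
    exact ⟨b, act_injective g hg hb⟩

end EquivariantBundle

/-! ### The bundle induced by a representation of the stabilizer -/

theorem regular_inv_of_ne_zero {Y A : Type} [AddCommGroup A] [Module ℂ A] {κ : Y → A} {f : Y → ℂ}
    (hf : f ∈ regularFun κ) (h : ∀ y, f y ≠ 0) : (fun y => (f y)⁻¹) ∈ regularFun κ := by
  intro y
  obtain ⟨p, hp, q, hq, h0, hpq⟩ := hf y
  have hp0 : p (κ y) ≠ 0 := fun hp0 => h y (by rw [hpq y h0, hp0, zero_div])
  -- The inverse of `p / q` is written `q² / (p q)`, so that nonvanishing of the denominator also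
  -- ensures `q ≠ 0`, where the formula for `f` is valid.
  refine ⟨q * q, mul_mem hq hq, p * q, mul_mem hp hq, mul_ne_zero hp0 h0, fun z hz => ?_⟩
  have hz1 : p (κ z) ≠ 0 := left_ne_zero_of_mul hz
  have hz2 : q (κ z) ≠ 0 := right_ne_zero_of_mul hz
  simp only [Pi.mul_apply, hpq z hz2]
  field_simp

theorem X.smul_lift_smul (g : Spin) {x y : X} (h : g • x = y) :
    (y.lift⁻¹ * (g * x.lift)) • x₀ = x₀ := by
  rw [mul_smul, mul_smul, x.lift_smul, h, y.lift_inv_smul]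

namespace EquivariantBundle

/-- An action of the stabilizer of the base point on a vector space `M`, together with an
equivariant embedding of `M` in the fibre of an equivariant bundle at the base point. -/
structure FiberRep (M : Type) [AddCommGroup M] [Module ℂ M] (F : EquivariantBundle) where
  /-- The action of the stabilizer. -/
  rep : ∀ g : Spin, g • x₀ = x₀ → M →ₗ[ℂ] M
  /-- The embedding. -/
  emb : M →ₗ[ℂ] F.Fiber x₀
  injective : Function.Injective emb
  emb_rep : ∀ (g : Spin) (hg : g • x₀ = x₀) (m : M), emb (rep g hg m) = F.act g hg (emb m)

namespace FiberRep

variable {M : Type} [AddCommGroup M] [Module ℂ M] {F : EquivariantBundle} (R : FiberRep M F)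

/-- The action on the fibres of the induced bundle, all of which are identified with `M`. -/
def act (g : Spin) {x y : X} (h : g • x = y) : M →ₗ[ℂ] M :=
  R.rep (y.lift⁻¹ * (g * x.lift)) (X.smul_lift_smul g h)

/-- The embedding of the fibre of the induced bundle at `x`. -/
def embAt (x : X) : M →ₗ[ℂ] F.Fiber x := F.act x.lift x.lift_smul ∘ₗ R.emb

theorem embAt_injective (x : X) : Function.Injective (R.embAt x) :=
  (act_injective _ _).comp R.injective

/-- The lifts cancel, so the induced action is the restriction of the action on `F`. Its group laws
then follow from those of `F` by injectivity of the embeddings. -/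
theorem embAt_act (g : Spin) {x y : X} (h : g • x = y) (m : M) :
    R.embAt y (R.act g h m) = F.act g h (R.embAt x m) := by
  have hgx : (g * x.lift) • x₀ = y := by rw [mul_smul, x.lift_smul, h]
  simp only [embAt, act, LinearMap.comp_apply, R.emb_rep]
  rw [F.act_mul _ _ hgx y.lift_inv_smul, act_act_inv, F.act_mul]

theorem act_one (x : X) (m : M) : R.act 1 (one_smul Spin x) m = m :=
  R.embAt_injective x (by rw [embAt_act, F.act_one])

theorem act_mul (g h : Spin) {x y z : X} (hxy : h • x = y) (hyz : g • y = z)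
    (hxz : (g * h) • x = z) (m : M) : R.act (g * h) hxz m = R.act g hyz (R.act h hxy m) :=
  R.embAt_injective z (by rw [embAt_act, embAt_act, embAt_act, F.act_mul])

theorem act_injective (g : Spin) {x y : X} (h : g • x = y) : Function.Injective (R.act g h) :=
  fun a b hab => R.embAt_injective x (EquivariantBundle.act_injective g h (by
    rw [← embAt_act, ← embAt_act, hab]))

/-- A projection from the fibre of the ambient bundle at `x`. -/
def proj (x : X) : F.Fiber x →ₗ[ℂ] M :=
  ((R.embAt x).exists_leftInverse_of_injective
    (LinearMap.ker_eq_bot.2 (R.embAt_injective x))).choose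

theorem proj_embAt (x : X) (m : M) : R.proj x (R.embAt x m) = m :=
  LinearMap.congr_fun ((R.embAt x).exists_leftInverse_of_injective
    (LinearMap.ker_eq_bot.2 (R.embAt_injective x))).choose_spec m

theorem act_bijective [FiniteDimensional ℂ M] (g : Spin) {x y : X} (h : g • x = y) :
    Function.Bijective (R.act g h) :=
  ⟨R.act_injective g h, LinearMap.injective_iff_surjective.1 (R.act_injective g h)⟩

variable [FiniteDimensional ℂ M]

/-- The matrix of the action of `g` on the fibre at the base point, in a local frame. -/
def frameMatrix (e : LocalFrame fun _ : X => M) {g : Spin} (hg : g • x₀ ∈ e.dom) (i : Fin e.rank)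
    (j : Fin (finrank ℂ M)) : ℂ :=
  (e.basis _ hg).repr (R.act g (rfl : g • x₀ = _) (finBasis ℂ M j)) i

/-- The inverse of `frameMatrix`. -/
def frameMatrixInv (e : LocalFrame fun _ : X => M) {g : Spin} (hg : g • x₀ ∈ e.dom)
    (i : Fin (finrank ℂ M)) (j : Fin e.rank) : ℂ :=
  (finBasis ℂ M).repr (R.act g⁻¹ (inv_smul_smul g x₀) (e.basis _ hg j)) i

/-- The local frames in which the action on the fibre at the base point is regular. -/
def IsRegularFrame (e : LocalFrame fun _ : X => M) : Prop :=
  (∀ i j, (fun y : {g : Spin // g • x₀ ∈ e.dom} => R.frameMatrix e y.2 i j) ∈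
    regularFun fun y : {g : Spin // g • x₀ ∈ e.dom} => (y.1 : Cl)) ∧
  ∀ i j, (fun y : {g : Spin // g • x₀ ∈ e.dom} => R.frameMatrixInv e y.2 i j) ∈
    regularFun fun y : {g : Spin // g • x₀ ∈ e.dom} => (y.1 : Cl)

/-- Going from `k • x₀` to `g • k • x₀` factors through `x₀`, as `k⁻¹` followed by `g * k`.
Regularity in the pair `(g, k)` is thus reduced to regularity of two matrices that depend on one
group element each. -/
theorem coeff_act (e e' : LocalFrame fun _ : X => M) {g k : Spin} (hk : k • x₀ ∈ e.dom)
    (hg : (g * k) • x₀ ∈ e'.dom) (hg' : g • k • x₀ ∈ e'.dom) (i : Fin e.rank) (j : Fin e'.rank) :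
    e.coeff e' hk hg' (R.act g (rfl : g • k • x₀ = _)) i j =
      ∑ a, R.frameMatrixInv e hk a i * R.frameMatrix e' hg j a := by
  have h : R.act g (rfl : g • k • x₀ = _) (e.basis _ hk i) =
      R.act (g * k) (mul_smul g k x₀) (R.act k⁻¹ (inv_smul_smul k x₀) (e.basis _ hk i)) := by
    have : g = (g * k) * k⁻¹ := by group
    have e2 : R.act g (rfl : g • k • x₀ = _) (e.basis _ hk i) =
        R.act ((g * k) * k⁻¹) (by rw [← this]) (e.basis _ hk i) :=
      R.embAt_injective _ (by rw [embAt_act, embAt_act]; exact act_congr this _ _ _)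
    rw [e2, R.act_mul]
  have hb : ∀ (y : X) (hy : (g * k) • x₀ = y) (hye : y ∈ e'.dom) (m : M),
      (e'.basis y hye).repr (R.act (g * k) hy m) j =
        (e'.basis _ hg).repr (R.act (g * k) (rfl : (g * k) • x₀ = _) m) j := by
    rintro _ rfl _ _; rfl
  unfold LocalFrame.coeff
  rw [h, hb]
  conv_lhs => rw [← (finBasis ℂ M).sum_repr (R.act k⁻¹ (inv_smul_smul k x₀) (e.basis _ hk i))]
  simp only [map_sum, map_smul, Finsupp.finsetSum_apply, Finsupp.smul_apply, smul_eq_mul]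
  rfl

theorem regular_coeff (e e' : LocalFrame fun _ : X => M) (he : R.IsRegularFrame e)
    (he' : R.IsRegularFrame e') (i : Fin e.rank) (j : Fin e'.rank) :
    (fun y : {p : Spin × Spin // p.2 • x₀ ∈ e.dom ∧ p.1 • p.2 • x₀ ∈ e'.dom} =>
      e.coeff e' y.2.1 y.2.2 (R.act y.1.1 (rfl : y.1.1 • y.1.2 • x₀ = _)) i j) ∈
    regularFun fun y : {p : Spin × Spin // p.2 • x₀ ∈ e.dom ∧ p.1 • p.2 • x₀ ∈ e'.dom} =>
      ((y.1.1 : Cl), (y.1.2 : Cl)) := by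
  set Y := {p : Spin × Spin // p.2 • x₀ ∈ e.dom ∧ p.1 • p.2 • x₀ ∈ e'.dom}
  have hY : ∀ y : Y, (y.1.1 * y.1.2) • x₀ ∈ e'.dom := fun y => by rw [mul_smul]; exact y.2.2
  have e1 : (fun y : Y => e.coeff e' y.2.1 y.2.2 (R.act y.1.1 (rfl : y.1.1 • y.1.2 • x₀ = _)) i j) =
      ∑ a, (fun y : Y => R.frameMatrixInv e y.2.1 a i) *
        fun y : Y => R.frameMatrix e' (hY y) j a := by
    funext y
    simp only [R.coeff_act e e' y.2.1 (hY y) y.2.2, Finset.sum_apply, Pi.mul_apply]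
  rw [e1]
  refine sum_mem fun a _ => mul_mem ?_ ?_
  · exact regular_comp (fun y : Y => ((y.1.1 : Cl), (y.1.2 : Cl))) _
      (fun y : Y => (⟨y.1.2, y.2.1⟩ : {g : Spin // g • x₀ ∈ e.dom})) (fun a => a.2)
      (fun _ => rfl) (fun φ => dual_mem_polyFun (φ ∘ₗ LinearMap.snd ℂ Cl Cl)) (he.2 a i)
  · exact regular_comp (fun y : Y => ((y.1.1 : Cl), (y.1.2 : Cl))) _
      (fun y : Y => (⟨y.1.1 * y.1.2, hY y⟩ : {g : Spin // g • x₀ ∈ e'.dom})) (fun a => a.1 * a.2)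
      (fun _ => rfl) (fun φ => polyFun_bilin ((LinearMap.mul ℂ Cl).compr₂ φ)
        (LinearMap.fst ℂ Cl Cl) (LinearMap.snd ℂ Cl Cl)) (he'.1 j a)

/-! ### Local frames of the induced bundle -/

section Frame

variable (x : X) (f : LocalFrame F.Fiber) (hx : x ∈ f.dom)

/-- The comparison of the fibres at `y` and `x`, through the ambient bundle and a local frame. -/
def compareAt {y : X} (hy : y ∈ f.dom) : M →ₗ[ℂ] M :=
  R.proj x ∘ₗ ((f.basis y hy).equiv (f.basis x hx) (Equiv.refl _)).toLinearMap ∘ₗ R.embAt y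

/-- The matrix of the comparison of the fibres at the base point and `g • x₀` with that at `x`. -/
def compareAtMatrix {g : Spin} (hg : g • x₀ ∈ f.dom) :
    Matrix (Fin (finrank ℂ M)) (Fin (finrank ℂ M)) ℂ :=
  LinearMap.toMatrix (finBasis ℂ M) (finBasis ℂ M)
    (R.compareAt x f hx hg ∘ₗ R.act g (rfl : g • x₀ = _))

theorem compareAtMatrix_det_ne_zero_iff {g : Spin} (hg : g • x₀ ∈ f.dom) :
    (R.compareAtMatrix x f hx hg).det ≠ 0 ↔ Function.Bijective (R.compareAt x f hx hg) := by
  rw [compareAtMatrix, LinearMap.det_toMatrix, ← isUnit_iff_ne_zero,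
    ← LinearMap.isUnit_iff_isUnit_det, Module.End.isUnit_iff, LinearMap.coe_comp]
  exact Function.Bijective.of_comp_iff _ (R.act_bijective g (rfl : g • x₀ = _))

/-- Through the embeddings, the entries are combinations with constant coefficients of the
coefficients of the action of `F` from `x₀`, which are regular. -/
theorem compareAtMatrix_regular (hf : f ∈ F.atlas) (i j : Fin (finrank ℂ M)) :
    (fun y : {g : Spin // g • x₀ ∈ f.dom} => R.compareAtMatrix x f hx y.2 i j) ∈
      regularFun fun y : {g : Spin // g • x₀ ∈ f.dom} => (y.1 : Cl) := by
  obtain ⟨f₀, hf₀, h0⟩ := F.cover x₀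
  set Y := {g : Spin // g • x₀ ∈ f.dom}
  have key : (fun y : Y => R.compareAtMatrix x f hx y.2 i j) =
      ∑ a, ∑ b, algebraMap ℂ (Y → ℂ) ((f₀.basis x₀ h0).repr (R.embAt x₀ (finBasis ℂ M j)) a *
        (finBasis ℂ M).repr (R.proj x (f.basis x hx b)) i) *
          fun y : Y => f₀.coeff f h0 y.2 (F.act y.1 rfl) a b := by
    funext y
    simp only [compareAtMatrix, LinearMap.toMatrix_apply, compareAt, LinearMap.comp_apply,
      embAt_act, LinearEquiv.coe_coe, Finset.sum_apply, Pi.mul_apply, Pi.algebraMap_apply,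
      Algebra.algebraMap_self, RingHom.id_apply]
    conv_lhs => rw [← (f₀.basis x₀ h0).sum_repr (R.embAt x₀ (finBasis ℂ M j))]
    simp only [map_sum, map_smul, Finsupp.finsetSum_apply, Finsupp.smul_apply, smul_eq_mul]
    refine Finset.sum_congr rfl fun a _ => ?_
    have : F.act y.1 rfl (f₀.basis x₀ h0 a) = ∑ b, f₀.coeff f h0 y.2 (F.act y.1 rfl) a b •
      f.basis _ y.2 b := ((f.basis _ y.2).sum_repr _).symm
    rw [this]
    simp only [map_sum, map_smul, Finsupp.finsetSum_apply, Finsupp.smul_apply, smul_eq_mul,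
      Basis.equiv_apply, Equiv.refl_apply, Finset.mul_sum]
    exact Finset.sum_congr rfl fun b _ => by ring
  rw [key]
  exact sum_mem fun a _ => sum_mem fun b _ => mul_mem (Subalgebra.algebraMap_mem _ _)
    (F.regular_act_from_base hf₀ hf h0 (fun y : Y => y.1) (fun y => y.2) a b)

/-- A local frame of the induced bundle. -/
def frame (hf : f ∈ F.atlas) : LocalFrame fun _ : X => M where
  dom := {y | ∃ hy : y ∈ f.dom, Function.Bijective (R.compareAt x f hx hy)}
  isOpen := by
    rintro g ⟨hg, hb⟩
    obtain ⟨q, hq, h0, h⟩ := f.isOpen g hg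
    -- Near `g` the determinant equals `p / q'`. In the product `q * (q' * p)`, `q` keeps the point
    -- in the domain of `f`, `q'` makes the formula valid, and `p` keeps the determinant nonzero.
    obtain ⟨p, hp, q', hq', h0', h'⟩ :=
      regular_det _ _ (R.compareAtMatrix_regular x f hx hf) ⟨g, hg⟩
    rw [← compareAtMatrix_det_ne_zero_iff] at hb
    refine ⟨q * (q' * p), mul_mem hq (mul_mem hq' hp), mul_ne_zero h0 (mul_ne_zero h0' ?_),
      fun k hk => ?_⟩
    · intro hp0
      exact hb ((h' ⟨g, hg⟩ h0').trans (by simp only [hp0, zero_div]))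
    · have hk1 := left_ne_zero_of_mul hk
      have hk2 := left_ne_zero_of_mul (right_ne_zero_of_mul hk)
      have hk3 := right_ne_zero_of_mul (right_ne_zero_of_mul hk)
      refine ⟨h k hk1, ?_⟩
      rw [← compareAtMatrix_det_ne_zero_iff]
      have := h' ⟨k, h k hk1⟩ hk2
      exact fun h0 => div_ne_zero hk3 hk2 (this.symm.trans h0)
  rank := finrank ℂ M
  basis y hy := (finBasis ℂ M).map (LinearEquiv.ofBijective _ hy.choose_spec).symm

theorem frame_dom_subset (hf : f ∈ F.atlas) {y : X} (hy : y ∈ (R.frame x f hx hf).dom) :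
    y ∈ f.dom :=
  Exists.choose hy

theorem compareAt_bijective (hf : f ∈ F.atlas) {y : X} (hy : y ∈ (R.frame x f hx hf).dom)
    (hy' : y ∈ f.dom) : Function.Bijective (R.compareAt x f hx hy') :=
  Exists.choose_spec hy

theorem frameMatrix_frame (hf : f ∈ F.atlas) {g : Spin} (hg : g • x₀ ∈ (R.frame x f hx hf).dom)
    (hg' : g • x₀ ∈ f.dom) (i j : Fin (finrank ℂ M)) :
    R.frameMatrix (R.frame x f hx hf) hg i j = R.compareAtMatrix x f hx hg' i j := by
  simp only [frameMatrix, compareAtMatrix, LinearMap.toMatrix_apply]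
  rfl

/-- The matrix is the inverse of `compareAtMatrix`. Cramer's rule shows it as regular where the
determinant does not vanish. -/
theorem frameMatrixInv_frame (hf : f ∈ F.atlas) {g : Spin}
    (hg : g • x₀ ∈ (R.frame x f hx hf).dom) (hg' : g • x₀ ∈ f.dom) (i j : Fin (finrank ℂ M)) :
    R.frameMatrixInv (R.frame x f hx hf) hg i j =
      (R.compareAtMatrix x f hx hg').det⁻¹ * (R.compareAtMatrix x f hx hg').adjugate i j := by
  have hb := R.compareAt_bijective x f hx hf hg hg'
  set L : Matrix (Fin (finrank ℂ M)) (Fin (finrank ℂ M)) ℂ :=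
    LinearMap.toMatrix (finBasis ℂ M) (finBasis ℂ M) (R.act g⁻¹ (inv_smul_smul g x₀) ∘ₗ
      (LinearEquiv.ofBijective _ hb).symm.toLinearMap) with hL
  have e : R.frameMatrixInv (R.frame x f hx hf) hg i j = L i j := by
    rw [hL, LinearMap.toMatrix_apply]
    rfl
  have h : R.compareAtMatrix x f hx hg' * L = 1 := by
    rw [hL, compareAtMatrix, ← LinearMap.toMatrix_comp, ← LinearMap.toMatrix_id (finBasis ℂ M)]
    congr 1
    refine LinearMap.ext fun m => ?_
    simp only [LinearMap.comp_apply, LinearMap.id_apply]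
    have : ∀ m, R.act g (rfl : g • x₀ = _) (R.act g⁻¹ (inv_smul_smul g x₀) m) = m := fun m =>
      R.embAt_injective _ (by rw [embAt_act, embAt_act, act_act_inv])
    rw [this]
    exact LinearEquiv.apply_symm_apply (LinearEquiv.ofBijective _ hb) m
  rw [e, ← Matrix.inv_eq_right_inv h, Matrix.inv_def, Ring.inverse_eq_inv']
  rfl

theorem isRegularFrame_frame (hf : f ∈ F.atlas) : R.IsRegularFrame (R.frame x f hx hf) := by
  set Y := {g : Spin // g • x₀ ∈ (R.frame x f hx hf).dom} with hY
  have hYf : ∀ y : Y, y.1 • x₀ ∈ f.dom := fun y => R.frame_dom_subset x f hx hf y.2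
  have hreg : ∀ i j : Fin (finrank ℂ M),
      (fun y : Y => R.compareAtMatrix x f hx (hYf y) i j) ∈ regularFun fun y : Y => (y.1 : Cl) :=
    fun i j => regular_comp (fun y : Y => (y.1 : Cl)) _
      (fun y : Y => (⟨y.1, hYf y⟩ : {g : Spin // g • x₀ ∈ f.dom})) id
      (fun _ => rfl) dual_mem_polyFun (R.compareAtMatrix_regular x f hx hf i j)
  refine ⟨fun i j => ?_, fun i j => ?_⟩
  · have e : (fun y : Y => R.frameMatrix (R.frame x f hx hf) y.2 i j) =
      fun y : Y => R.compareAtMatrix x f hx (hYf y) i j :=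
      funext fun y => R.frameMatrix_frame x f hx hf y.2 (hYf y) i j
    rw [e]
    exact hreg i j
  · have e : (fun y : Y => R.frameMatrixInv (R.frame x f hx hf) y.2 i j) =
        (fun y : Y => (R.compareAtMatrix x f hx (hYf y)).det⁻¹) *
          fun y : Y => (R.compareAtMatrix x f hx (hYf y)).adjugate i j :=
      funext fun y => R.frameMatrixInv_frame x f hx hf y.2 (hYf y) i j
    rw [e]
    exact mul_mem (regular_inv_of_ne_zero (regular_det _ _ hreg) fun y =>
      (R.compareAtMatrix_det_ne_zero_iff x f hx (hYf y)).2
        (R.compareAt_bijective x f hx hf y.2 (hYf y)))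
      (poly_adjugate _ _ hreg i j)

theorem mem_frame_dom (hf : f ∈ F.atlas) : x ∈ (R.frame x f hx hf).dom := by
  refine ⟨hx, ?_⟩
  have : R.compareAt x f hx hx = LinearMap.id := LinearMap.ext fun m => by
    simp [compareAt, proj_embAt]
  rw [this]
  exact Function.bijective_id

end Frame

/-- The equivariant bundle which is induced by an action of the stabilizer of the base point. -/
def bundle : EquivariantBundle where
  Fiber _ := M
  act g _ _ h := R.act g h
  act_one := R.act_one
  act_mul g h _ _ _ hxy hyz hxz := R.act_mul g h hxy hyz hxz
  -- All regular frames are admitted; `frame` supplies one around each point.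
  atlas := {e | R.IsRegularFrame e}
  cover x := by
    obtain ⟨f, hf, hx⟩ := F.cover x
    exact ⟨_, R.isRegularFrame_frame x f hx hf, R.mem_frame_dom x f hx hf⟩
  regular e he e' he' i j := R.regular_coeff e e' he he' i j

theorem bundle_act_base (g : Spin) (hg : g • x₀ = x₀) (m : M) :
    R.bundle.act g hg m = R.rep g hg m := by
  refine R.injective ?_
  rw [R.emb_rep]
  change R.emb (R.rep _ _ m) = _
  rw [R.emb_rep]
  exact act_congr (by rw [X.lift_base]; group) _ _ _

end FiberRep

end EquivariantBundle

/-! ### The polar form and the pairing of spinors -/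

/-- The exterior algebra is the Clifford algebra of the zero form. This version is stated with
`ExteriorAlgebra.ι`, so that it can be used for rewriting spinors. -/
theorem exterior_contractLeft_ι_mul (f : Dual ℂ W) (w : W) (s : S) :
    contractLeft f (ExteriorAlgebra.ι ℂ w * s) =
      f w • s - ExteriorAlgebra.ι ℂ w * contractLeft f s :=
  contractLeft_ι_mul _ _ _

theorem exterior_contractLeft_ι (f : Dual ℂ W) (w : W) :
    contractLeft f (ExteriorAlgebra.ι ℂ w) = algebraMap ℂ S (f w) :=
  CliffordAlgebra.contractLeft_ι _ f w

theorem cliffordAction_apply (v : V) (s : S) :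
    cliffordAction v s = contractLeft v.1 s + ExteriorAlgebra.ι ℂ v.2 * s := rfl

/-- Polarization of `v · v · s = Q(v) s`. -/
theorem cliffordAction_anticomm (u v : V) (s : S) :
    cliffordAction u (cliffordAction v s) + cliffordAction v (cliffordAction u s) =
      LinearMap.dualProd ℂ W u v • s := by
  have h := LinearMap.congr_fun (cliffordAction_sq (u + v)) s
  have hu := LinearMap.congr_fun (cliffordAction_sq u) s
  have hv := LinearMap.congr_fun (cliffordAction_sq v) s
  simp only [map_add, Module.End.mul_apply, LinearMap.add_apply,
    Module.algebraMap_end_apply] at h hu hv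
  rw [hu, hv] at h
  have e : LinearMap.dualProd ℂ W u v = Q (u + v) - Q u - Q v := by
    simp [LinearMap.dualProd_apply_apply]
    ring
  rw [e, sub_smul, sub_smul, ← h]
  abel

/-- The form is the scalar by which the anticommutator acts. It is compared on the nonzero spinor `g
· 1`, using equivariance of the Clifford action. -/
theorem dualProd_vecRep (g : Spin) (u v : V) :
    LinearMap.dualProd ℂ W (vecRep g u) (vecRep g v) = LinearMap.dualProd ℂ W u v := by
  have h := cliffordAction_anticomm (vecRep g u) (vecRep g v) (spinRep g 1)
  simp only [cliffordAction_spinRep] at h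
  rw [← map_add, cliffordAction_anticomm, map_smul] at h
  have h1 : spinRep g (1 : S) ≠ 0 := by
    intro h0
    exact one_ne_zero ((Representation.apply_bijective spinRep g).1 (h0.trans (map_zero _).symm))
  exact (smul_left_injective ℂ h1 h).symm

theorem toDual_apply (x : X) (v : V) (u : x.space) :
    toDual x v u = LinearMap.dualProd ℂ W v u := rfl

theorem act_toDual (g : Spin) {x y : X} (h : g • x = y) (v : V) :
    taut.dual.act g h (toDual x v) = toDual y (vecRep g v) := by
  refine LinearMap.ext fun u => ?_
  change LinearMap.dualProd ℂ W v (vecRep g⁻¹ u.1) = LinearMap.dualProd ℂ W (vecRep g v) u.1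
  rw [← dualProd_vecRep g v]
  simp

/-! ### The top coefficient and adjoints for the pairing of spinors -/

theorem topCoeff_ιMulti (n : ℕ) (w : Fin n → W) :
    topCoeff (ExteriorAlgebra.ιMulti ℂ n w) =
      (Pi.single 5 Matrix.detRowAlternating : ∀ n, W [⋀^Fin n]→ₗ[ℂ] ℂ) n w :=
  ExteriorAlgebra.liftAlternating_apply_ιMulti _ _

theorem topCoeff_eq_zero {n : ℕ} (hn : n ≠ 5) {s : S} (hs : s ∈ ⋀[ℂ]^n W) : topCoeff s = 0 := by
  rw [← ExteriorAlgebra.ιMulti_span_fixedDegree] at hs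
  induction hs using Submodule.span_induction with
  | mem x hx =>
    obtain ⟨w, rfl⟩ := hx
    rw [topCoeff_ιMulti, Pi.single_eq_of_ne hn]
    rfl
  | zero => exact map_zero _
  | add x y _ _ hx hy => rw [map_add, hx, hy, add_zero]
  | smul c x _ hx => rw [map_smul, hx, smul_zero]

theorem ι_mul_mem_exteriorPower {n : ℕ} (w : W) {s : S} (hs : s ∈ ⋀[ℂ]^n W) :
    ExteriorAlgebra.ι ℂ w * s ∈ ⋀[ℂ]^(n + 1) W := by
  rw [show (⋀[ℂ]^(n + 1) W) = LinearMap.range (ExteriorAlgebra.ι ℂ) * ⋀[ℂ]^n W from pow_succ' _ _]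
  exact Submodule.mul_mem_mul ⟨w, rfl⟩ hs

theorem contractLeft_mem_exteriorPower (d : Dual ℂ W) (n : ℕ) (w : Fin (n + 1) → W) :
    contractLeft d (ExteriorAlgebra.ιMulti ℂ (n + 1) w : S) ∈ ⋀[ℂ]^n W := by
  induction n with
  | zero =>
    rw [ExteriorAlgebra.ιMulti_succ_apply, ExteriorAlgebra.ιMulti_zero_apply, mul_one,
      exterior_contractLeft_ι]
    exact Submodule.mem_one.2 ⟨_, rfl⟩
  | succ n ih =>
    rw [ExteriorAlgebra.ιMulti_succ_apply, exterior_contractLeft_ι_mul]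
    exact sub_mem (Submodule.smul_mem _ _ (ExteriorAlgebra.ιMulti_range ℂ _ ⟨_, rfl⟩))
      (ι_mul_mem_exteriorPower _ (ih _))

theorem exterior_induction {P : S → Prop} (s : S)
    (multi : ∀ (n : ℕ) (w : Fin n → W), P (ExteriorAlgebra.ιMulti ℂ n w))
    (zero : P 0) (add : ∀ x y, P x → P y → P (x + y)) (smul : ∀ (c : ℂ) x, P x → P (c • x)) :
    P s := by
  have hs : s ∈ Submodule.span ℂ (Set.range fun x : Σ n, (Fin n → W) =>
      ExteriorAlgebra.ιMulti ℂ x.1 x.2) := by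
    rw [ExteriorAlgebra.ιMulti_span]; trivial
  induction hs using Submodule.span_induction with
  | mem x hx => obtain ⟨⟨n, w⟩, rfl⟩ := hx; exact multi n w
  | zero => exact zero
  | add x y _ _ hx hy => exact add x y hx hy
  | smul c x _ hx => exact smul c x hx

theorem ιMulti_eq_zero_of_lt {n : ℕ} (hn : 5 < n) (w : Fin n → W) :
    ExteriorAlgebra.ιMulti ℂ n w = 0 := by
  refine AlternatingMap.map_linearDependent _ _ fun h => ?_
  have := h.fintype_card_le_finrank
  simp at this
  omega

/-- Contraction lowers the degree by one, so a part of degree five could come only from degree six,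
which is zero. -/
theorem topCoeff_contractLeft (d : Dual ℂ W) (s : S) : topCoeff (contractLeft d s) = 0 := by
  induction s using exterior_induction with
  | multi n w =>
    rcases n with _ | n
    · rw [ExteriorAlgebra.ιMulti_zero_apply]
      erw [contractLeft_one]
      exact map_zero _
    · by_cases hn : n = 5
      · rw [ιMulti_eq_zero_of_lt (by omega), map_zero, map_zero]
      · exact topCoeff_eq_zero hn (contractLeft_mem_exteriorPower d n w)
  | zero => rw [map_zero, map_zero]
  | add x y hx hy => rw [map_add, map_add, hx, hy, add_zero]
  | smul c x hx => rw [map_smul, map_smul, hx, smul_zero]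

/-- Integration by parts: contraction is a skew derivation and the top coefficient of a contraction
vanishes. The induction moves the vectors of `s` over to `t`. -/
theorem topCoeff_contractRight_mul (d : Dual ℂ W) (s t : S) :
    topCoeff (contractRight s d * t) = topCoeff (s * contractLeft d t) := by
  induction s using right_induction generalizing t with
  | algebraMap r =>
    rw [contractRight_algebraMap, zero_mul, map_zero, ← Algebra.smul_def, map_smul,
      topCoeff_contractLeft, smul_zero]
  | add x y hx hy =>
    rw [map_add, LinearMap.add_apply, add_mul, add_mul, map_add, map_add, hx, hy]
  | mul_ι w x hx =>
    rw [contractRight_mul_ι, sub_mul, mul_assoc, map_sub, hx, mul_assoc]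
    erw [exterior_contractLeft_ι_mul]
    rw [mul_sub, map_sub, smul_mul_assoc, mul_smul_comm]
    erw [sub_sub_cancel]

theorem spinorPairing_apply (s t : S) :
    spinorPairing s t = topCoeff (reverse s * t) := rfl

theorem spinorPairing_contractLeft (d : Dual ℂ W) (s t : S) :
    spinorPairing (contractLeft d s) t = spinorPairing s (contractLeft d t) := by
  rw [spinorPairing_apply, spinorPairing_apply, ← topCoeff_contractRight_mul, contractRight_eq,
    reverse_reverse]

theorem spinorPairing_ι_mul (w : W) (s t : S) :
    spinorPairing (ExteriorAlgebra.ι ℂ w * s) t = spinorPairing s (ExteriorAlgebra.ι ℂ w * t) := by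
  rw [spinorPairing_apply, spinorPairing_apply, reverse.map_mul]
  erw [reverse_ι]
  rw [mul_assoc]

/-- Vectors are self-adjoint because reversal exchanges left and right contraction and fixes `W`.
Hence the adjoint of any Clifford element is its reverse. -/
theorem spinorPairing_cliffordAction (v : V) (s t : S) :
    spinorPairing (cliffordAction v s) t = spinorPairing s (cliffordAction v t) := by
  rw [cliffordAction_apply, cliffordAction_apply, map_add, map_add, LinearMap.add_apply,
    spinorPairing_contractLeft, spinorPairing_ι_mul]

theorem spinorPairing_cliffordRep (x : Cl) (s t : S) :
    spinorPairing (cliffordRep x s) t = spinorPairing s (cliffordRep (reverse x) t) := by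
  induction x using CliffordAlgebra.induction generalizing s t with
  | algebraMap r => simp
  | ι v => simpa [cliffordRep] using spinorPairing_cliffordAction v s t
  | mul x y hx hy => rw [reverse.map_mul, map_mul, map_mul, Module.End.mul_apply,
      Module.End.mul_apply, hx, hy]
  | add x y hx hy => simp only [map_add, LinearMap.add_apply, hx, hy]

/-- An element of the group is even, so its reverse, the adjoint, equals its `star`, which is its
inverse. -/
theorem spinorPairing_spinRep (g : Spin) (s t : S) :
    spinorPairing (spinRep g s) (spinRep g t) = spinorPairing s t := by
  change spinorPairing (cliffordRep g s) (cliffordRep g t) = _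
  have h : reverse (g : Cl) * g = 1 := by
    have := spinGroup.star_mul_self_of_mem g.2
    rwa [star_def, spinGroup.involute_eq g.2] at this
  rw [spinorPairing_cliffordRep, ← Module.End.mul_apply, ← map_mul, h, map_one,
      Module.End.one_apply]

/-! ### The map `ξ` -/

theorem update_pair_zero (u v w : V) : Function.update ![u, v] 0 w = ![w, v] := by
  funext i
  fin_cases i <;> rfl

theorem update_pair_one (u v w : V) : Function.update ![u, v] 1 w = ![u, w] := by
  funext i
  fin_cases i <;> rfl

/-- The exterior product of two vectors, as a bilinear map. -/
def wedgeMap : V →ₗ[ℂ] V →ₗ[ℂ] ⋀[ℂ]^2 V :=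
  LinearMap.mk₂ ℂ wedge
    (fun u u' v => by
      have := (exteriorPower.ιMulti ℂ 2).map_update_add ![u, v] 0 u u'
      simp only [update_pair_zero] at this
      exact this)
    (fun c u v => by
      have := (exteriorPower.ιMulti ℂ 2).map_update_smul ![u, v] 0 c u
      simp only [update_pair_zero] at this
      exact this)
    (fun u v v' => by
      have := (exteriorPower.ιMulti ℂ 2).map_update_add ![u, v] 1 v v'
      simp only [update_pair_one] at this
      exact this)
    (fun c u v => by
      have := (exteriorPower.ιMulti ℂ 2).map_update_smul ![u, v] 1 c v
      simp only [update_pair_one] at this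
      exact this)

theorem wedgeMap_apply (u v : V) : wedgeMap u v = wedge u v := rfl

theorem map_wedge (L : V →ₗ[ℂ] V) (u v : V) :
    exteriorPower.map 2 L (wedge u v) = wedge (L u) (L v) := by
  rw [wedge, exteriorPower.map_apply_ιMulti, wedge]
  congr 1
  funext i
  fin_cases i <;> rfl

theorem wedge_swap (u v : V) : wedge u v = -wedge v u := by
  have h : ∀ w, wedgeMap w w = 0 := fun w =>
    (exteriorPower.ιMulti ℂ 2).map_eq_zero_of_eq ![w, w] (i := 0) (j := 1) rfl (by decide)
  have := h (u + v)
  simp only [map_add, LinearMap.add_apply, h, zero_add, add_zero] at this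
  exact eq_neg_of_add_eq_zero_right this

/-- `cliffordMap` as a bilinear map. -/
def cliffordMapHom : S →ₗ[ℂ] S →ₗ[ℂ] ⋀[ℂ]^2 V :=
  LinearMap.mk₂ ℂ cliffordMap
    (fun t t' s => by simp [cliffordMap, add_smul, Finset.sum_add_distrib])
    (fun c t s => by simp [cliffordMap, mul_smul, Finset.smul_sum])
    (fun t s s' => by simp [cliffordMap, add_smul, Finset.sum_add_distrib])
    (fun c t s => by simp [cliffordMap, mul_smul, Finset.smul_sum])

/-- The form is invariant, so coordinates may be computed after translation by `g`. This serves to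
expand the standard basis in its translate. -/
theorem vecRep_vec (g : Spin) (v : V) :
    v = ∑ c, LinearMap.dualProd ℂ W (vecRep g (vec c.swap)) (vecRep g v) • vec c := by
  simp only [dualProd_vecRep]
  exact (sum_vec v).symm

theorem sum_vec_swap (u : V) : ∑ a, LinearMap.dualProd ℂ W (vec a) u • vec a.swap = u := by
  conv_rhs => rw [← sum_vec u]
  exact Fintype.sum_equiv (Equiv.sumComm _ _) _ _ fun a => by simp

/-- The sum that defines `ξ` runs over a basis and its dual basis, so it is unchanged when both are
moved by `g`; the pairing and the Clifford action are invariant. -/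
theorem cliffordMap_spinRep (g : Spin) (t s : S) :
    cliffordMap (spinRep g t) (spinRep g s) = exteriorPower.map 2 (vecRep g) (cliffordMap t s) := by
  have h1 : ∀ a, cliffordAction (vec a) = ∑ c, LinearMap.dualProd ℂ W (vec a)
      (vecRep g (vec c.swap)) • cliffordAction (vecRep g (vec c)) := by
    intro a
    have : vec a = ∑ c, LinearMap.dualProd ℂ W (vec a)
      (vecRep g (vec c.swap)) • vecRep g (vec c) := by
      have h := congrArg (vecRep g) (vecRep_vec g (vecRep g⁻¹ (vec a)))
      simp only [map_sum, map_smul, Representation.self_inv_apply] at h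
      conv_lhs => rw [h]
      exact Finset.sum_congr rfl fun c _ => by
        rw [← (LinearMap.isSymm_dualProd ℂ W).eq, RingHom.id_apply]
    conv_lhs => rw [this]
    simp only [map_sum, map_smul]
  have h2 : ∀ a b, spinorPairing (spinRep g s)
      (cliffordAction (vec a) (cliffordAction (vec b) (spinRep g t))) =
      ∑ c, ∑ d, LinearMap.dualProd ℂ W (vec a) (vecRep g (vec c.swap)) *
        LinearMap.dualProd ℂ W (vec b) (vecRep g (vec d.swap)) *
        spinorPairing s (cliffordAction (vec c) (cliffordAction (vec d) t)) := by
    intro a b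
    rw [h1 a, h1 b]
    simp only [LinearMap.sum_apply, LinearMap.smul_apply, map_sum, map_smul, cliffordAction_spinRep,
      spinorPairing_spinRep, smul_eq_mul, Finset.mul_sum, mul_assoc]
    rw [Finset.sum_comm]
    exact Finset.sum_congr rfl fun c _ => Finset.sum_congr rfl fun d _ => mul_left_comm _ _ _
  simp only [cliffordMap, h2, map_sum, map_smul, map_wedge, Finset.sum_smul]
  -- The dual vectors expand with the same coefficients as in `h2`; after reordering, the two
  -- fourfold sums agree term by term.
  have h3 : ∀ c d : Fin 5 ⊕ Fin 5, wedge (vecRep g (vec c.swap)) (vecRep g (vec d.swap)) =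
      ∑ a, ∑ b, (LinearMap.dualProd ℂ W (vec a) (vecRep g (vec c.swap)) *
        LinearMap.dualProd ℂ W (vec b) (vecRep g (vec d.swap))) •
          wedge (vec a.swap) (vec b.swap) := by
    intro c d
    conv_lhs => rw [← sum_vec_swap (vecRep g (vec c.swap)), ← sum_vec_swap (vecRep g (vec d.swap)),
      ← wedgeMap_apply]
    simp only [map_sum, map_smul, LinearMap.sum_apply, LinearMap.smul_apply, mul_smul,
      Finset.smul_sum, wedgeMap_apply]
    rw [Finset.sum_comm]
    exact Finset.sum_congr rfl fun a _ => Finset.sum_congr rfl fun b _ => smul_comm _ _ _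
  simp only [h3, Finset.smul_sum, smul_smul]
  have h4 : ∀ f : (Fin 5 ⊕ Fin 5) → (Fin 5 ⊕ Fin 5) → (Fin 5 ⊕ Fin 5) → (Fin 5 ⊕ Fin 5) → ⋀[ℂ]^2 V,
      ∑ a, ∑ b, ∑ c, ∑ d, f a b c d = ∑ c, ∑ d, ∑ a, ∑ b, f a b c d := by
    intro f
    have h5 : ∀ a, ∑ b, ∑ c, ∑ d, f a b c d = ∑ c, ∑ d, ∑ b, f a b c d := fun a => by
      rw [Finset.sum_comm]
      exact Finset.sum_congr rfl fun c _ => Finset.sum_comm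
    simp only [h5]
    rw [Finset.sum_comm]
    exact Finset.sum_congr rfl fun c _ => Finset.sum_comm
  rw [h4]
  refine Finset.sum_congr rfl fun c _ => Finset.sum_congr rfl fun d _ =>
    Finset.sum_congr rfl fun a _ => Finset.sum_congr rfl fun b _ => ?_
  rw [mul_comm]

/-! ### Spinors in terms of the standard basis -/

/-- The standard basis vectors of `W`, as spinors. -/
def basisSpinor (i : Fin 5) : S := ExteriorAlgebra.ι ℂ (Pi.single i 1)

/-- The linear coordinates of `W`. -/
def coordW (i : Fin 5) : Dual ℂ W := LinearMap.proj i

@[simp] theorem coordW_apply (i : Fin 5) (w : W) : coordW i w = w i := rfl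

theorem sum_coordW (f : Dual ℂ W) : f = ∑ i, f (Pi.single i 1) • coordW i := by
  refine LinearMap.pi_ext' fun j => ?_
  ext
  simp [coordW, Pi.single_apply]

/-- The volume element of `⋀ W`. -/
def volSpinor : S := ExteriorAlgebra.ιMulti ℂ 5 fun i => (Pi.single i 1 : W)

/-- The scalar part of a spinor. -/
def scalarPart : S →ₐ[ℂ] ℂ := ExteriorAlgebra.algebraMapInv

@[simp] theorem scalarPart_ι (w : W) : scalarPart (ExteriorAlgebra.ι ℂ w) = 0 := by
  simp [scalarPart, ExteriorAlgebra.algebraMapInv]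

theorem ι_eq_sum (w : W) : ExteriorAlgebra.ι ℂ w = ∑ i, w i • basisSpinor i := by
  conv_lhs => rw [pi_eq_sum_univ' w]
  rw [map_sum]
  exact Finset.sum_congr rfl fun i _ => map_smul _ _ _

theorem ι_swap (u v : W) (s : S) : ExteriorAlgebra.ι ℂ u * (ExteriorAlgebra.ι ℂ v * s) =
    -(ExteriorAlgebra.ι ℂ v * (ExteriorAlgebra.ι ℂ u * s)) := by
  rw [← mul_assoc, ← mul_assoc, ← neg_mul, eq_neg_of_add_eq_zero_left
    (ExteriorAlgebra.ι_add_mul_swap u v)]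

/-! ### The volume element and its pairings -/

theorem ι_mul_vol (w : W) : ExteriorAlgebra.ι ℂ w * volSpinor = 0 := by
  have h := ExteriorAlgebra.ιMulti_succ_apply (R := ℂ)
    (Fin.cons w (fun i => (Pi.single i 1 : W)) : Fin 6 → W)
  rw [ιMulti_eq_zero_of_lt (by omega)] at h
  exact h.symm

theorem topCoeff_vol : topCoeff volSpinor = 1 := by
  rw [volSpinor, topCoeff_ιMulti, Pi.single_eq_same, Matrix.detRowAlternating]
  change Matrix.det _ = 1
  have e : (fun i => (Pi.single i 1 : W)) = (1 : Matrix (Fin 5) (Fin 5) ℂ) := by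
    funext i j
    simp only [Matrix.one_apply, Pi.single_apply, eq_comm (a := i)]
  rw [e, Matrix.det_one]

theorem spinorPairing_vol (s : S) : spinorPairing s volSpinor = scalarPart s := by
  induction s using left_induction with
  | algebraMap r =>
    rw [spinorPairing_apply, reverse.commutes, ← Algebra.smul_def, map_smul, topCoeff_vol]
    erw [scalarPart.commutes]
    simp
  | add x y hx hy => rw [map_add, map_add, LinearMap.add_apply, hx, hy]
  | ι_mul x w _ =>
    erw [spinorPairing_ι_mul, ι_mul_vol, map_mul, scalarPart_ι, map_zero, zero_mul]

theorem vol_eq_mul : volSpinor = basisSpinor 0 * (basisSpinor 1 * (basisSpinor 2 *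
    (basisSpinor 3 * basisSpinor 4))) := by
  simp [volSpinor, ExteriorAlgebra.ιMulti_apply, basisSpinor]
  rfl

/-- Reversal of five factors is an even permutation, so no sign appears. -/
theorem spinorPairing_vol_one : spinorPairing volSpinor 1 = 1 := by
  have h : reverse volSpinor = ExteriorAlgebra.ιMulti ℂ 5
      fun i => (Pi.single (Fin.rev i) 1 : W) := by
    have hr : ∀ i, reverse (basisSpinor i) = basisSpinor i := fun i => reverse_ι _
    rw [vol_eq_mul]
    simp only [reverse.map_mul, hr]
    simp [ExteriorAlgebra.ιMulti_apply, basisSpinor, mul_assoc]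
    rfl
  rw [spinorPairing_apply, mul_one, h, topCoeff_ιMulti, Pi.single_eq_same, Matrix.detRowAlternating]
  change Matrix.det _ = 1
  have e : (fun i => (Pi.single (Fin.rev i) 1 : W) : Matrix (Fin 5) (Fin 5) ℂ) =
      (Equiv.Perm.permMatrix ℂ (Fin.revPerm : Equiv.Perm (Fin 5))) := by
    ext i j
    simp [Equiv.Perm.permMatrix, PEquiv.toMatrix_apply, Pi.single_apply, eq_comm]
  rw [e, Matrix.det_permutation]
  have : Equiv.Perm.sign (Fin.revPerm : Equiv.Perm (Fin 5)) = 1 := by decide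
  simp [this]

theorem spinorPairing_vol_ι_mul (w : W) (s : S) :
    spinorPairing volSpinor (ExteriorAlgebra.ι ℂ w * s) = 0 := by
  rw [← spinorPairing_ι_mul, ι_mul_vol, map_zero, LinearMap.zero_apply]

/-- An alternating map in five vectors is fixed by its values on orderings of a basis, so `ιMulti`
is the determinant times the volume element. -/
theorem exists_ιMulti_eq_smul_vol (w : Fin 5 → W) :
    ∃ c : ℂ, ExteriorAlgebra.ιMulti ℂ 5 w = c • volSpinor := by
  have h : ExteriorAlgebra.ιMulti ℂ 5 = (LinearMap.toSpanSingleton ℂ S volSpinor).compAlternatingMap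
      (Pi.basisFun ℂ (Fin 5)).det := by
    refine Basis.ext_alternating (Pi.basisFun ℂ (Fin 5)) fun i hi => ?_
    let σ : Equiv.Perm (Fin 5) := Equiv.ofBijective i (Finite.injective_iff_bijective.1 hi)
    change ExteriorAlgebra.ιMulti ℂ 5 ((Pi.basisFun ℂ (Fin 5)) ∘ σ) =
      (LinearMap.toSpanSingleton ℂ S volSpinor).compAlternatingMap
      (Pi.basisFun ℂ (Fin 5)).det ((Pi.basisFun ℂ (Fin 5)) ∘ σ)
    rw [AlternatingMap.map_perm, AlternatingMap.map_perm]
    congr 1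
    simp only [LinearMap.compAlternatingMap_apply, Basis.det_self, LinearMap.toSpanSingleton_apply,
      one_smul]
    rw [volSpinor]
    congr 1
    funext i
    simp
  exact ⟨_, by rw [h]; rfl⟩

theorem exterior_span_induction {n : ℕ} {P : ∀ s : S, s ∈ ⋀[ℂ]^n W → Prop}
    (multi : ∀ w : Fin n → W, P (ExteriorAlgebra.ιMulti ℂ n w)
      (ExteriorAlgebra.ιMulti_range ℂ n ⟨w, rfl⟩))
    (zero : P 0 (zero_mem _)) (add : ∀ x y hx hy, P x hx → P y hy → P (x + y) (add_mem hx hy))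
    (smul : ∀ (c : ℂ) x hx, P x hx → P (c • x) (Submodule.smul_mem _ c hx)) (s : S)
    (hs : s ∈ ⋀[ℂ]^n W) : P s hs := by
  have h : ∀ hs' : s ∈ Submodule.span ℂ (Set.range (ExteriorAlgebra.ιMulti ℂ n (M := W))),
      P s (by rwa [← ExteriorAlgebra.ιMulti_span_fixedDegree]) := by
    intro hs'
    induction hs' using Submodule.span_induction with
    | mem x hx => obtain ⟨w, rfl⟩ := hx; exact multi w
    | zero => exact zero
    | add x y hx' hy' hx hy =>
      rw [ExteriorAlgebra.ιMulti_span_fixedDegree] at hx' hy'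
      exact add x y hx' hy' (hx hx') (hy hy')
    | smul c x hx' hx =>
      rw [ExteriorAlgebra.ιMulti_span_fixedDegree] at hx'
      exact smul c x hx' (hx hx')
  exact h (by rwa [ExteriorAlgebra.ιMulti_span_fixedDegree])

theorem exists_eq_smul_vol {s : S} (hs : s ∈ ⋀[ℂ]^5 W) : ∃ c : ℂ, s = c • volSpinor := by
  induction s, hs using exterior_span_induction with
  | multi w => exact exists_ιMulti_eq_smul_vol w
  | zero => exact ⟨0, (zero_smul _ _).symm⟩
  | add x y _ _ hx hy =>
    obtain ⟨c, rfl⟩ := hx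
    obtain ⟨d, rfl⟩ := hy
    exact ⟨c + d, (add_smul _ _ _).symm⟩
  | smul d x _ hx =>
    obtain ⟨c, rfl⟩ := hx
    exact ⟨d * c, smul_smul _ _ _⟩

theorem eq_zero_of_mem_six {s : S} (hs : s ∈ ⋀[ℂ]^6 W) : s = 0 := by
  induction s, hs using exterior_span_induction with
  | multi w => exact ιMulti_eq_zero_of_lt (by omega) w
  | zero => rfl
  | add x y _ _ hx hy => rw [hx, hy, add_zero]
  | smul d x _ hx => rw [hx, smul_zero]

theorem contractLeft_mem {n : ℕ} (d : Dual ℂ W) {s : S} (hs : s ∈ ⋀[ℂ]^(n + 1) W) :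
    contractLeft d s ∈ ⋀[ℂ]^n W := by
  induction s, hs using exterior_span_induction with
  | multi w => exact contractLeft_mem_exteriorPower d n w
  | zero => rw [map_zero]; exact zero_mem _
  | add x y _ _ hx hy => rw [map_add]; exact add_mem hx hy
  | smul c x _ hx => rw [map_smul]; exact Submodule.smul_mem _ _ hx

/-- The Euler operator, which multiplies the elements of degree `n` by `n`. -/
def euler (s : S) : S := ∑ i, basisSpinor i * contractLeft (coordW i) s

/-- The Euler operator is a derivation for which vectors have weight one: contraction gives one
term, and the other passes two vectors across each other twice. -/
theorem euler_ι_mul (w : W) (s : S) : euler (ExteriorAlgebra.ι ℂ w * s) =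
    ExteriorAlgebra.ι ℂ w * s + ExteriorAlgebra.ι ℂ w * euler s := by
  simp only [euler, exterior_contractLeft_ι_mul, mul_sub, Finset.sum_sub_distrib, coordW_apply,
    mul_smul_comm, Finset.mul_sum]
  rw [sub_eq_add_neg, ← Finset.sum_neg_distrib]
  congr 1
  · simp only [← smul_mul_assoc]
    rw [← Finset.sum_mul, ← ι_eq_sum]
  · exact Finset.sum_congr rfl fun i _ => by rw [basisSpinor, ι_swap, neg_neg]

theorem euler_add (s t : S) : euler (s + t) = euler s + euler t := by
  simp [euler, mul_add, Finset.sum_add_distrib]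

theorem euler_smul (c : ℂ) (s : S) : euler (c • s) = c • euler s := by
  simp [euler, Finset.smul_sum]

theorem euler_zero : euler 0 = 0 := by simp [euler]

theorem euler_ιMulti (n : ℕ) (w : Fin n → W) :
    euler (ExteriorAlgebra.ιMulti ℂ n w) = (n : ℂ) • ExteriorAlgebra.ιMulti ℂ n w := by
  induction n with
  | zero =>
    have : ∀ i, contractLeft (coordW i) (1 : S) = 0 := fun i => CliffordAlgebra.contractLeft_one _ _
    simp [euler, this]
  | succ n ih =>
    rw [ExteriorAlgebra.ιMulti_succ_apply, euler_ι_mul, ih, mul_smul_comm, Nat.cast_succ, add_smul,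
      one_smul, add_comm]

theorem euler_mem {n : ℕ} {s : S} (hs : s ∈ ⋀[ℂ]^n W) : euler s = (n : ℂ) • s := by
  induction s, hs using exterior_span_induction with
  | multi w => exact euler_ιMulti n w
  | zero => rw [euler_zero, smul_zero]
  | add x y _ _ hx hy => rw [euler_add, hx, hy, smul_add]
  | smul c x _ hx => rw [euler_smul, hx, smul_comm]

/-- The contraction by `coordW i` and the product with `basisSpinor i` have anticommutator one; this
is summed over the five indices. -/
theorem sum_contractLeft_basisSpinor_mul (s : S) :
    ∑ i, contractLeft (coordW i) (basisSpinor i * s) = (5 : ℂ) • s - euler s := by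
  simp only [basisSpinor, exterior_contractLeft_ι_mul, Finset.sum_sub_distrib, euler]
  simp [Algebra.smul_def, map_ofNat]

/-- In degree four the preceding sum is `(5 - 4) s = s`, and each product with a basis vector is a
multiple of the volume element. This is the identification `⋀⁴ W ≅ Wᵛ`. -/
theorem exists_eq_contractLeft_vol {s : S} (hs : s ∈ ⋀[ℂ]^4 W) :
    ∃ f : Dual ℂ W, s = contractLeft f volSpinor := by
  choose c hc using fun i => exists_eq_smul_vol (ι_mul_mem_exteriorPower (Pi.single i 1) hs)
  have h := sum_contractLeft_basisSpinor_mul s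
  rw [euler_mem hs, ← sub_smul] at h
  norm_num at h
  refine ⟨∑ i, c i • coordW i, ?_⟩
  rw [← h, map_sum, LinearMap.sum_apply]
  refine Finset.sum_congr rfl fun i _ => ?_
  rw [basisSpinor, hc i, map_smul, map_smul, LinearMap.smul_apply]

theorem exists_eq_ι {s : S} (hs : s ∈ ⋀[ℂ]^1 W) : ∃ w, s = ExteriorAlgebra.ι ℂ w := by
  rw [show ⋀[ℂ]^1 W = LinearMap.range (ExteriorAlgebra.ι ℂ) from pow_one _] at hs
  obtain ⟨w, rfl⟩ := hs
  exact ⟨w, rfl⟩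

theorem exists_eq_algebraMap {s : S} (hs : s ∈ ⋀[ℂ]^0 W) : ∃ c : ℂ, s = algebraMap ℂ S c := by
  rw [show ⋀[ℂ]^0 W = 1 from pow_zero _] at hs
  obtain ⟨c, rfl⟩ := Submodule.mem_one.1 hs
  exact ⟨c, rfl⟩

/-- The skew-symmetric matrix of the part of degree two of a spinor. -/
def skewPart : S →ₗ[ℂ] (Fin 5 → Fin 5 → ℂ) :=
  LinearMap.pi fun i => LinearMap.pi fun j =>
    scalarPart.toLinearMap ∘ₗ contractLeft (coordW j) ∘ₗ contractLeft (coordW i)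

theorem skewPart_apply (s : S) (i j : Fin 5) :
    skewPart s i j = scalarPart (contractLeft (coordW j) (contractLeft (coordW i) s)) := rfl

theorem skewPart_swap (s : S) (i j : Fin 5) : skewPart s j i = -skewPart s i j := by
  rw [skewPart_apply, skewPart_apply, contractLeft_comm, map_neg]

/-- The element of degree two with given matrix. -/
def ofSkew (T : Fin 5 → Fin 5 → ℂ) : S :=
  (2⁻¹ : ℂ) • ∑ i, ∑ j, T i j • (basisSpinor i * basisSpinor j)

theorem skewPart_basisSpinor_mul (a b i j : Fin 5) :
    skewPart (basisSpinor a * basisSpinor b) i j =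
      (if i = a then 1 else 0) * (if j = b then 1 else 0) -
        (if i = b then 1 else 0) * (if j = a then 1 else 0) := by
  rw [skewPart_apply, basisSpinor, basisSpinor, exterior_contractLeft_ι_mul,
    exterior_contractLeft_ι, map_sub, map_smul, exterior_contractLeft_ι, ← Algebra.commutes,
    ← Algebra.smul_def, map_smul, exterior_contractLeft_ι]
  simp only [map_sub, map_smul, coordW_apply, AlgHom.commutes, Pi.single_apply, smul_eq_mul,
    Algebra.algebraMap_self, RingHom.id_apply]

theorem skewPart_ofSkew (T : Fin 5 → Fin 5 → ℂ) (hT : ∀ i j, T j i = -T i j) :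
    skewPart (ofSkew T) = T := by
  funext i j
  simp only [ofSkew, map_smul, map_sum, Pi.smul_apply, Finset.sum_apply, skewPart_basisSpinor_mul,
    smul_eq_mul, mul_sub, Finset.sum_sub_distrib]
  simp [hT i j]
  ring

theorem skewPart_algebraMap (c : ℂ) : skewPart (algebraMap ℂ S c) = 0 := by
  funext i j
  rw [skewPart_apply]
  erw [contractLeft_algebraMap]
  simp

/-- Euler's formula in degree two. The factor `2⁻¹` in `ofSkew` cancels the degree. -/
theorem ofSkew_skewPart {s : S} (hs : s ∈ ⋀[ℂ]^2 W) : ofSkew (skewPart s) = s := by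
  have h := euler_mem hs
  have h2 : ∀ i, contractLeft (coordW i) s = ∑ j, skewPart s i j • basisSpinor j := by
    intro i
    obtain ⟨w, hw⟩ := exists_eq_ι (contractLeft_mem (coordW i) hs)
    rw [hw, ι_eq_sum]
    refine Finset.sum_congr rfl fun j _ => ?_
    rw [skewPart_apply, hw, exterior_contractLeft_ι, coordW_apply]
    erw [scalarPart.commutes]
    rfl
  simp only [euler, h2, Finset.mul_sum, mul_smul_comm] at h
  rw [ofSkew, h, smul_smul]
  norm_num

/-- Multiplying by two vectors shifts degrees `0, 2, 4` to `2, 4, 6`, and degree six vanishes. -/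
theorem halfSpin_zero_decomposition {s : S} (hs : s ∈ halfSpin 0) :
    ∃ (c : ℂ) (b : S) (f : Dual ℂ W), b ∈ ⋀[ℂ]^2 W ∧
      s = algebraMap ℂ S c + b + contractLeft f volSpinor := by
  have key : ∃ a ∈ ⋀[ℂ]^0 W, ∃ b ∈ ⋀[ℂ]^2 W, ∃ c ∈ ⋀[ℂ]^4 W, s = a + b + c := by
    unfold halfSpin at hs
    induction s, hs using even_induction with
    | algebraMap r => exact ⟨_, Submodule.mem_one.2 ⟨r, rfl⟩, 0, zero_mem _, 0, zero_mem _, by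
        rw [add_zero, add_zero]⟩
    | add x y _ _ hx hy =>
      obtain ⟨a, ha, b, hb, c, hc, rfl⟩ := hx
      obtain ⟨a', ha', b', hb', c', hc', rfl⟩ := hy
      exact ⟨_, add_mem ha ha', _, add_mem hb hb', _, add_mem hc hc', by abel⟩
    | ι_mul_ι_mul u v x _ ih =>
      obtain ⟨a, ha, b, hb, c, hc, rfl⟩ := ih
      have h2 : ∀ (n : ℕ) (z : S), z ∈ ⋀[ℂ]^n W →
          ExteriorAlgebra.ι ℂ u * (ExteriorAlgebra.ι ℂ v * z) ∈ ⋀[ℂ]^(n + 1 + 1) W :=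
        fun n z hz => ι_mul_mem_exteriorPower u (ι_mul_mem_exteriorPower v hz)
      refine ⟨0, zero_mem _, _, h2 0 a ha, _, h2 2 b hb, ?_⟩
      rw [mul_assoc]
      change ExteriorAlgebra.ι ℂ u * (ExteriorAlgebra.ι ℂ v * (a + b + c)) = _
      rw [mul_add, mul_add, mul_add, mul_add, eq_zero_of_mem_six (h2 4 c hc), add_zero, zero_add]
  obtain ⟨a, ha, b, hb, c, hc, rfl⟩ := key
  obtain ⟨r, rfl⟩ := exists_eq_algebraMap ha
  obtain ⟨f, rfl⟩ := exists_eq_contractLeft_vol hc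
  exact ⟨r, b, f, hb, rfl⟩

theorem spinorPairing_contractLeft_vol (f : Dual ℂ W) (w : W) :
    spinorPairing (contractLeft f volSpinor) (ExteriorAlgebra.ι ℂ w) = f w := by
  rw [spinorPairing_contractLeft, exterior_contractLeft_ι, Algebra.algebraMap_eq_smul_one, map_smul,
    spinorPairing_vol_one, smul_eq_mul, mul_one]

theorem spinorPairing_one_ι (w : W) : spinorPairing 1 (ExteriorAlgebra.ι ℂ w) = 0 := by
  rw [spinorPairing_apply, reverse.map_one, one_mul]
  refine topCoeff_eq_zero (n := 1) (by omega) ?_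
  rw [show ⋀[ℂ]^1 W = LinearMap.range (ExteriorAlgebra.ι ℂ) from pow_one _]
  exact ⟨w, rfl⟩

theorem ι_mem (w : W) : ExteriorAlgebra.ι ℂ w ∈ ⋀[ℂ]^1 W := by
  rw [show ⋀[ℂ]^1 W = LinearMap.range (ExteriorAlgebra.ι ℂ) from pow_one _]
  exact ⟨w, rfl⟩

theorem spinorPairing_ofSkew_apply (T : Fin 5 → Fin 5 → ℂ) (t : S) :
    spinorPairing (ofSkew T) t =
      2⁻¹ * ∑ i, ∑ j, T i j * topCoeff (basisSpinor j * (basisSpinor i * t)) := by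
  simp only [ofSkew, map_smul, map_sum, LinearMap.smul_apply, LinearMap.sum_apply, smul_eq_mul]
  congr 1
  refine Finset.sum_congr rfl fun i _ => Finset.sum_congr rfl fun j _ => ?_
  rw [basisSpinor, spinorPairing_ι_mul, ← mul_one (basisSpinor j), basisSpinor, spinorPairing_ι_mul,
    spinorPairing_apply, reverse.map_one, one_mul, mul_one]

theorem spinorPairing_ofSkew_ι (T : Fin 5 → Fin 5 → ℂ) (w : W) :
    spinorPairing (ofSkew T) (ExteriorAlgebra.ι ℂ w) = 0 := by
  rw [spinorPairing_ofSkew_apply]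
  have : ∀ i j : Fin 5, topCoeff (basisSpinor j * (basisSpinor i * ExteriorAlgebra.ι ℂ w)) = 0 :=
    fun i j => topCoeff_eq_zero (n := 3) (by omega)
      (ι_mul_mem_exteriorPower _ (ι_mul_mem_exteriorPower _ (ι_mem w)))
  simp [this]

/-- The even spinors which are orthogonal to `W` have no part of degree four. -/
theorem exists_eq_add_ofSkew {s : S} (hs : s ∈ halfSpin 0)
    (h : ∀ w, spinorPairing s (ExteriorAlgebra.ι ℂ w) = 0) :
    ∃ c : ℂ, s = algebraMap ℂ S c + ofSkew (skewPart s) := by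
  obtain ⟨c, b, f, hb, rfl⟩ := halfSpin_zero_decomposition hs
  have hf : f = 0 := by
    refine LinearMap.ext fun w => ?_
    have := h w
    rw [map_add, map_add, LinearMap.add_apply, LinearMap.add_apply, spinorPairing_contractLeft_vol,
      Algebra.algebraMap_eq_smul_one, map_smul, LinearMap.smul_apply, spinorPairing_one_ι,
      ← ofSkew_skewPart hb, spinorPairing_ofSkew_ι, smul_zero, zero_add, zero_add] at this
    exact this
  subst hf
  refine ⟨c, ?_⟩
  rw [map_zero, LinearMap.zero_apply, add_zero, map_add, skewPart_algebraMap, zero_add,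
    ofSkew_skewPart hb]

/-! ### The pure spinors of the base point -/

/-- The homogeneous components of a spinor. -/
def component (n : ℕ) (s : S) : S := DirectSum.decompose (fun i : ℕ => ⋀[ℂ]^i W) s n

theorem component_euler (n : ℕ) (s : S) : component n (euler s) = (n : ℂ) • component n s := by
  have hadd : ∀ x y, component n (x + y) = component n x + component n y := fun x y => by
    simp [component, DirectSum.decompose_add]
  have hsmul : ∀ (c : ℂ) x, component n (c • x) = c • component n x := fun c x => by
    rw [component, DirectSum.decompose_smul]; rfl
  induction s using exterior_induction with
  | multi m w =>
    rw [euler_ιMulti, hsmul]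
    by_cases h : m = n
    · subst h; rfl
    · have : component n (ExteriorAlgebra.ιMulti ℂ m w) = 0 :=
        DirectSum.decompose_of_mem_ne (fun i : ℕ => ⋀[ℂ]^i W)
          (ExteriorAlgebra.ιMulti_range ℂ m ⟨w, rfl⟩) h
      rw [this, smul_zero, smul_zero]
  | zero => simp [euler_zero, component]
  | add x y hx hy => rw [euler_add, hadd, hadd, hx, hy, smul_add]
  | smul c x hx => rw [euler_smul, hsmul, hsmul, hx, smul_comm]

/-- Such a spinor is killed by the Euler operator, which acts on degree `n` by `n`, so only its
component of degree zero survives. -/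
theorem exists_eq_algebraMap_of_contractLeft {s : S} (hs : ∀ f, contractLeft f s = 0) :
    ∃ c : ℂ, s = algebraMap ℂ S c := by
  have h0 : euler s = 0 := by simp [euler, hs]
  have h1 : ∀ n, n ≠ 0 → component n s = 0 := by
    intro n hn
    have := component_euler n s
    rw [h0] at this
    have h2 : component n 0 = 0 := by simp [component]
    rw [h2] at this
    exact (smul_eq_zero.1 this.symm).resolve_left (Nat.cast_ne_zero.2 hn)
  have h3 : s = component 0 s := by
    classical
    conv_lhs => rw [← DirectSum.sum_support_decompose (fun i : ℕ => ⋀[ℂ]^i W) s]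
    refine Finset.sum_eq_single 0 (fun n _ hn => h1 n hn) fun h => ?_
    rw [DFinsupp.notMem_support_iff.1 h]
    rfl
  rw [h3]
  exact exists_eq_algebraMap (SetLike.coe_mem _)

theorem mem_space_base (v : V) : v ∈ x₀.space ↔ v.2 = 0 := by
  change v ∈ U₀ ↔ _
  simp [U₀, Submodule.mem_prod]

theorem one_mem_spinorLine : (1 : S) ∈ spinorLine x₀ := by
  intro u hu
  rw [mem_space_base] at hu
  rw [cliffordAction_apply, hu, map_zero, zero_mul, add_zero]
  exact CliffordAlgebra.contractLeft_one _ _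

theorem exists_eq_smul_one {s : S} (hs : s ∈ spinorLine x₀) : ∃ c : ℂ, s = c • (1 : S) := by
  obtain ⟨c, rfl⟩ := exists_eq_algebraMap_of_contractLeft (s := s) fun f => by
    have := hs (f, 0) ((mem_space_base _).2 rfl)
    rwa [cliffordAction_apply, map_zero, zero_mul, add_zero] at this
  exact ⟨c, Algebra.algebraMap_eq_smul_one _⟩

/-! ### The map `ξ` on `W ⊗ S⁺` -/

/-- The tensors of the Schur functor of the partition `(2, 1)`: they are skew-symmetric in the last
two indices and their cyclic sums vanish. -/
def schurTensor : Submodule ℂ (Fin 5 → Fin 5 → Fin 5 → ℂ) where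
  carrier := {T | (∀ a b c, T a c b = -T a b c) ∧ ∀ a b c, T a b c + T b c a + T c a b = 0}
  add_mem' := by
    rintro T T' ⟨h1, h2⟩ ⟨h1', h2'⟩
    refine ⟨fun a b c => ?_, fun a b c => ?_⟩
    · simp only [Pi.add_apply, h1 a b c, h1' a b c]; ring
    · simp only [Pi.add_apply]
      linear_combination h2 a b c + h2' a b c
  zero_mem' := ⟨fun a b c => by simp, fun a b c => by simp⟩
  smul_mem' := by
    rintro r T ⟨h1, h2⟩
    refine ⟨fun a b c => ?_, fun a b c => ?_⟩
    · simp only [Pi.smul_apply, h1 a b c, smul_neg]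
    · simp only [Pi.smul_apply, smul_eq_mul]
      linear_combination r * h2 a b c

/-- The scalar is the determinant of the coordinates `i, j, l` of the three vectors. -/
theorem contractLeft_contractLeft_contractLeft_mul (i j l : Fin 5) (u v w : W) :
    contractLeft (coordW l) (contractLeft (coordW j) (contractLeft (coordW i)
      (ExteriorAlgebra.ι ℂ u * (ExteriorAlgebra.ι ℂ v * ExteriorAlgebra.ι ℂ w)))) =
    (u i * v j * w l - u i * w j * v l - v i * u j * w l + v i * w j * u l + w i * u j * v l -
      w i * v j * u l) • (1 : S) := by
  simp only [exterior_contractLeft_ι_mul, exterior_contractLeft_ι, map_sub, map_smul, mul_sub,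
    Algebra.algebraMap_eq_smul_one, mul_smul_comm, mul_one, coordW_apply]
  module

/-- The formula separates the degrees of `s`: the double sum sees only degree two, the other two
terms only degree four. The factor `2` arises because the two mixed orders, a linear form before or
after a vector, contribute equally by skew-symmetry of the wedge. -/
theorem cliffordMap_ι (w : W) (s : S) : cliffordMap (ExteriorAlgebra.ι ℂ w) s =
    ∑ p, ∑ q, spinorPairing s (basisSpinor p * (basisSpinor q * ExteriorAlgebra.ι ℂ w)) •
      wedge (vec (.inl p)) (vec (.inl q)) -
    spinorPairing s (ExteriorAlgebra.ι ℂ w) • ∑ p, wedge (vec (.inl p)) (vec (.inr p)) +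
    (2 : ℂ) • ∑ p, spinorPairing s (basisSpinor p) • wedge (vec (.inl p)) (0, w) := by
  have h1 : ∀ p q, cliffordAction (vec (.inl p)) (cliffordAction (vec (.inl q))
      (ExteriorAlgebra.ι ℂ w)) = 0 := fun p q => by
    simp only [cliffordAction_apply, vec, map_zero, zero_mul, add_zero, exterior_contractLeft_ι]
    exact contractLeft_algebraMap _ _ _
  have h2 : ∀ p q, cliffordAction (vec (.inl p)) (cliffordAction (vec (.inr q))
      (ExteriorAlgebra.ι ℂ w)) = (Pi.single q 1 : W) p • ExteriorAlgebra.ι ℂ w -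
        w p • basisSpinor q := fun p q => by
    simp only [cliffordAction_apply, vec, map_zero, zero_mul, add_zero, exterior_contractLeft_ι,
      LinearMap.zero_apply, zero_add, exterior_contractLeft_ι_mul, LinearMap.proj_apply,
      Algebra.algebraMap_eq_smul_one, mul_smul_comm, mul_one, basisSpinor]
  have h3 : ∀ p q, cliffordAction (vec (.inr p)) (cliffordAction (vec (.inl q))
      (ExteriorAlgebra.ι ℂ w)) = w q • basisSpinor p := fun p q => by
    simp only [cliffordAction_apply, vec, map_zero, zero_mul, add_zero, exterior_contractLeft_ι,
      LinearMap.zero_apply, zero_add, LinearMap.proj_apply,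
      Algebra.algebraMap_eq_smul_one, mul_smul_comm, mul_one, basisSpinor]
  have h4 : ∀ p q, cliffordAction (vec (.inr p)) (cliffordAction (vec (.inr q))
      (ExteriorAlgebra.ι ℂ w)) = basisSpinor p * (basisSpinor q * ExteriorAlgebra.ι ℂ w) :=
    fun p q => by
      simp only [cliffordAction_apply, vec, map_zero, LinearMap.zero_apply, zero_add, basisSpinor]
  have hw : ∀ p, wedge (vec (.inl p)) (0, w) = ∑ q, w q • wedge (vec (.inl p)) (vec (.inr q)) := by
    intro p
    have : ((0, w) : V) = ∑ q, w q • vec (.inr q) := by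
      refine Prod.ext ?_ ?_
      · simp [vec, Prod.fst_sum]
      · conv_lhs => rw [show ((0, w) : V).2 = w from rfl, pi_eq_sum_univ' w]
        simp [vec, Prod.snd_sum]
    simp only [← wedgeMap_apply]
    rw [this, map_sum]
    simp only [map_smul]
  have hs : ∀ p q, wedge (vec (.inr p)) (vec (.inl q)) = -wedge (vec (.inl q)) (vec (.inr p)) :=
    fun p q => wedge_swap _ _
  simp only [cliffordMap, Fintype.sum_sum_type, Sum.swap_inl, Sum.swap_inr, h1, h2, h3, h4, hw, hs,
    map_zero, zero_smul, Finset.sum_const_zero, zero_add, map_sub, map_smul, smul_eq_mul, sub_smul,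
    smul_neg, Finset.sum_sub_distrib, Finset.sum_add_distrib, Finset.smul_sum, smul_smul,
    Finset.sum_neg_distrib]
  simp only [Pi.single_apply, ite_mul, one_mul, zero_mul, ite_smul, zero_smul, Finset.sum_ite_eq,
    Finset.mem_univ, if_true]
  rw [Finset.sum_comm (f := fun p q => (w p * spinorPairing s (basisSpinor q)) •
    wedge (vec (.inl q)) (vec (.inr p)))]
  simp only [mul_comm (w _), two_mul, add_smul, Finset.sum_add_distrib]
  abel

/-- The spinor `1` pairs only with degree five, while the elements in `cliffordMap_ι` have degrees
one and three. -/
theorem cliffordMap_ι_one (w : W) : cliffordMap (ExteriorAlgebra.ι ℂ w) 1 = 0 := by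
  have h : ∀ p q,
      spinorPairing 1 (basisSpinor p * (basisSpinor q * ExteriorAlgebra.ι ℂ w)) = 0 := by
    intro p q
    rw [spinorPairing_apply, reverse.map_one, one_mul]
    exact topCoeff_eq_zero (n := 3) (by omega)
      (ι_mul_mem_exteriorPower _ (ι_mul_mem_exteriorPower _ (ι_mem w)))
  have h' : ∀ p, spinorPairing 1 (basisSpinor p) = 0 := fun p => spinorPairing_one_ι _
  simp [cliffordMap_ι, h, h', spinorPairing_one_ι]

/-- Moving a vector past four others gives the sign `+1`. -/
theorem ι_swap_swap (u v w x y : W) : ExteriorAlgebra.ι ℂ u * (ExteriorAlgebra.ι ℂ v *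
    (ExteriorAlgebra.ι ℂ w * (ExteriorAlgebra.ι ℂ x * ExteriorAlgebra.ι ℂ y))) =
    ExteriorAlgebra.ι ℂ y * (ExteriorAlgebra.ι ℂ u * (ExteriorAlgebra.ι ℂ v *
    (ExteriorAlgebra.ι ℂ w * ExteriorAlgebra.ι ℂ x))) := by
  have h : ExteriorAlgebra.ι ℂ x * ExteriorAlgebra.ι ℂ y =
      -(ExteriorAlgebra.ι ℂ y * ExteriorAlgebra.ι ℂ x) :=
    eq_neg_of_add_eq_zero_left (ExteriorAlgebra.ι_add_mul_swap x y)
  rw [h, mul_neg, ι_swap w y, neg_neg, ι_swap v y, mul_neg, ι_swap u y, neg_neg]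

/-- The element of degree three with given tensor. -/
def ofTensor (T : Fin 5 → Fin 5 → Fin 5 → ℂ) : S :=
  ∑ k, ∑ a, ∑ b, T k a b • (basisSpinor a * (basisSpinor b * basisSpinor k))

/-- This recognizes `ξ` on `W ⊗ ⋀² W` as the product into `⋀³ W`, followed by the pairing of `⋀³ W`
with `⋀² W`. The `2⁻¹` is that of `ofSkew`. -/
theorem sum_spinorPairing_ofSkew (T : Fin 5 → Fin 5 → Fin 5 → ℂ) (p q : Fin 5) :
    ∑ k, spinorPairing (ofSkew (T k)) (basisSpinor p * (basisSpinor q * basisSpinor k)) =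
      2⁻¹ * spinorPairing (ofTensor T) (basisSpinor p * basisSpinor q) := by
  simp only [spinorPairing_ofSkew_apply, ofTensor, map_sum, map_smul, LinearMap.sum_apply,
    LinearMap.smul_apply, smul_eq_mul]
  rw [Finset.mul_sum]
  refine Finset.sum_congr rfl fun k _ => ?_
  congr 1
  refine Finset.sum_congr rfl fun a _ => Finset.sum_congr rfl fun b _ => ?_
  congr 1
  simp only [basisSpinor]
  rw [spinorPairing_ι_mul, spinorPairing_ι_mul, spinorPairing_apply]
  erw [reverse_ι]
  rw [ι_swap_swap]

theorem contractLeft_ofTensor (T : Fin 5 → Fin 5 → Fin 5 → ℂ) (i j l : Fin 5) :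
    contractLeft (coordW l) (contractLeft (coordW j) (contractLeft (coordW i) (ofTensor T))) =
      (T l i j - T j i l - T l j i + T i j l + T j l i - T i l j) • (1 : S) := by
  simp only [ofTensor, map_sum, map_smul, basisSpinor,
    contractLeft_contractLeft_contractLeft_mul, smul_smul, ← Finset.sum_smul]
  congr 1
  simp only [Pi.single_apply, mul_sub, mul_add, Finset.sum_sub_distrib, Finset.sum_add_distrib]
  simp
  ring

theorem vol_mem : volSpinor ∈ ⋀[ℂ]^5 W := ExteriorAlgebra.ιMulti_range ℂ 5 ⟨_, rfl⟩

/-- A trivector orthogonal to `⋀² W` is zero; read on coordinates, this is the vanishing of the full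
skew-symmetrization of `T`. -/
theorem tensor_relation {T : Fin 5 → Fin 5 → Fin 5 → ℂ}
    (h : ∀ p q, spinorPairing (ofTensor T) (basisSpinor p * basisSpinor q) = 0) (i j l : Fin 5) :
    T l i j - T j i l - T l j i + T i j l + T j l i - T i l j = 0 := by
  have h2 : ∀ t ∈ ⋀[ℂ]^2 W, spinorPairing (ofTensor T) t = 0 := by
    intro t ht
    rw [← ofSkew_skewPart ht, ofSkew]
    simp [h]
  -- Testing on a triple contraction of the volume element extracts one coordinate: the contractions
  -- move to the trivector, and pairing with the volume element reads off the scalar part.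
  have := h2 _ (contractLeft_mem (coordW i) (contractLeft_mem (coordW j)
    (contractLeft_mem (coordW l) vol_mem)))
  rw [← spinorPairing_contractLeft, ← spinorPairing_contractLeft, ← spinorPairing_contractLeft,
    spinorPairing_vol, contractLeft_ofTensor, map_smul, map_one, smul_eq_mul, mul_one] at this
  exact this

theorem ofTensor_eq_zero {T : Fin 5 → Fin 5 → Fin 5 → ℂ} (hT : T ∈ schurTensor) :
    ofTensor T = 0 := by
  have hcyc : ∀ a b k, basisSpinor a * (basisSpinor b * basisSpinor k) =
      basisSpinor b * (basisSpinor k * basisSpinor a) := by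
    intro a b k
    have h : basisSpinor a * basisSpinor k = -(basisSpinor k * basisSpinor a) :=
      eq_neg_of_add_eq_zero_left (ExteriorAlgebra.ι_add_mul_swap _ _)
    have h' : basisSpinor a * (basisSpinor b * basisSpinor k) =
      -(basisSpinor b * (basisSpinor a * basisSpinor k)) := ι_swap _ _ _
    rw [h', h, mul_neg, neg_neg]
  have hrot : ∀ F : Fin 5 → Fin 5 → Fin 5 → S,
      ∑ k, ∑ a, ∑ b, F k a b = ∑ k, ∑ a, ∑ b, F a b k := by
    intro F
    symm
    rw [Finset.sum_comm]
    exact Finset.sum_congr rfl fun k _ => Finset.sum_comm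
  have h1 : ofTensor T =
      ∑ k, ∑ a, ∑ b, T a b k • (basisSpinor a * (basisSpinor b * basisSpinor k)) := by
    rw [ofTensor, hrot]
    refine Finset.sum_congr rfl fun k _ => Finset.sum_congr rfl fun a _ =>
      Finset.sum_congr rfl fun b _ => ?_
    rw [hcyc a b k]
  have h2 : ofTensor T =
      ∑ k, ∑ a, ∑ b, T b k a • (basisSpinor a * (basisSpinor b * basisSpinor k)) := by
    rw [h1, hrot]
    refine Finset.sum_congr rfl fun k _ => Finset.sum_congr rfl fun a _ =>
      Finset.sum_congr rfl fun b _ => ?_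
    rw [hcyc a b k]
  -- Products of three basis vectors are invariant under cyclic rotation, so three copies of the sum
  -- collect the cyclic sums of `T`, which vanish.
  have h3 : (3 : ℂ) • ofTensor T = 0 := by
    have : (3 : ℂ) • ofTensor T = ofTensor T + ofTensor T + ofTensor T := by module
    rw [this]
    nth_rw 2 [h1]
    nth_rw 2 [h2]
    rw [ofTensor]
    simp only [← Finset.sum_add_distrib, ← add_smul, hT.2]
    simp
  exact (smul_eq_zero.1 h3).resolve_left (by norm_num)

/-- The tensors of the Schur functor give elements of the kernel of `ξ`. -/
theorem sum_cliffordMap_ofSkew {T : Fin 5 → Fin 5 → Fin 5 → ℂ} (hT : T ∈ schurTensor) :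
    ∑ k, cliffordMap (basisSpinor k) (ofSkew (T k)) = 0 := by
  simp only [basisSpinor, cliffordMap_ι, spinorPairing_ofSkew_ι, zero_smul, Finset.sum_const_zero,
    smul_zero, sub_zero, add_zero]
  rw [Finset.sum_comm]
  refine Finset.sum_eq_zero fun p _ => ?_
  rw [Finset.sum_comm]
  refine Finset.sum_eq_zero fun q _ => ?_
  rw [← Finset.sum_smul]
  have := sum_spinorPairing_ofSkew T p q
  simp only [basisSpinor] at this
  rw [this, ofTensor_eq_zero hT, map_zero, LinearMap.zero_apply, mul_zero, zero_smul]

/-- The elements of the kernel of `ξ`. -/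
theorem sum_cliffordMap_eq_zero {s : Fin 5 → S} (hs : ∀ k, s k ∈ halfSpin 0)
    (h : ∑ k, cliffordMap (basisSpinor k) (s k) = 0) :
    (fun k => skewPart (s k)) ∈ schurTensor ∧
      ∀ k, ∃ c : ℂ, s k = algebraMap ℂ S c + ofSkew (skewPart (s k)) := by
  have h1 : ∀ u v : V, ∑ k, spinorPairing (s k)
      (cliffordAction u (cliffordAction v (basisSpinor k)) -
        cliffordAction v (cliffordAction u (basisSpinor k))) = 0 := by
    intro u v
    simp only [← pairing_cliffordMap]
    rw [← LinearMap.sum_apply, ← map_sum, h, map_zero, LinearMap.zero_apply]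
  -- Pairing with `coordW p ∧ e_q` isolates degree four. For the matrix `B p q = ⟨s p, e_q⟩` it says
  -- `tr(B) δ - 2 B = 0`.
  have h2 : ∀ p q : Fin 5,
      (if p = q then (1 : ℂ) else 0) * ∑ k, spinorPairing (s k) (basisSpinor k) -
        2 * spinorPairing (s p) (basisSpinor q) = 0 := by
    intro p q
    have hk : ∀ k, spinorPairing (s k) (cliffordAction (coordW p, 0) (cliffordAction
        (0, Pi.single q 1) (basisSpinor k)) - cliffordAction (0, Pi.single q 1)
          (cliffordAction (coordW p, 0) (basisSpinor k))) =
        (if p = q then 1 else 0) * spinorPairing (s k) (basisSpinor k) -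
          2 * ((if p = k then 1 else 0) * spinorPairing (s k) (basisSpinor q)) := by
      intro k
      simp only [cliffordAction_apply, basisSpinor, map_zero, zero_mul, add_zero,
        exterior_contractLeft_ι, LinearMap.zero_apply, zero_add, exterior_contractLeft_ι_mul,
        Algebra.algebraMap_eq_smul_one, mul_smul_comm, mul_one, map_sub, map_smul, smul_eq_mul]
      simp only [coordW_apply, Pi.single_apply]
      ring
    have := h1 (coordW p, 0) (0, Pi.single q 1)
    simp only [hk, Finset.sum_sub_distrib, ← Finset.mul_sum] at this
    have e : ∑ k, (if p = k then (1 : ℂ) else 0) * spinorPairing (s k) (basisSpinor q) =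
        spinorPairing (s p) (basisSpinor q) := by simp
    rwa [e] at this
  -- Taking the trace gives `(5 - 2) tr(B) = 0`, and then `B = 0`.
  have htr : ∑ k, spinorPairing (s k) (basisSpinor k) = 0 := by
    have := Finset.sum_congr rfl fun (p : Fin 5) (_ : p ∈ Finset.univ) => h2 p p
    simp only [if_true, one_mul, Finset.sum_sub_distrib, ← Finset.mul_sum] at this
    simp at this
    linear_combination (1 / 3) * this
  have h3 : ∀ k w, spinorPairing (s k) (ExteriorAlgebra.ι ℂ w) = 0 := by
    intro k w
    rw [ι_eq_sum, map_sum]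
    refine Finset.sum_eq_zero fun q _ => ?_
    have := h2 k q
    rw [htr, mul_zero, zero_sub, neg_eq_zero, mul_eq_zero] at this
    rw [map_smul, this.resolve_left two_ne_zero, smul_zero]
  choose c hc using fun k => exists_eq_add_ofSkew (hs k) (h3 k)
  refine ⟨⟨fun k a b => skewPart_swap _ _ _, ?_⟩, fun k => ⟨c k, hc k⟩⟩
  -- Pairing with wedges of two vectors of `W` gives the condition on degree two. The scalars `c k`
  -- do not contribute, as they pair only with degree five.
  have h4 : ∀ p q, spinorPairing (ofTensor fun k => skewPart (s k))
      (basisSpinor p * basisSpinor q) = 0 := by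
    intro p q
    have := h1 (0, Pi.single p 1) (0, Pi.single q 1)
    simp only [cliffordAction_apply, map_zero, LinearMap.zero_apply, zero_add] at this
    have hdeg : ∀ k, topCoeff (ExteriorAlgebra.ι ℂ (Pi.single p 1 : W) *
        (ExteriorAlgebra.ι ℂ (Pi.single q 1 : W) * basisSpinor k)) = 0 := fun k =>
      topCoeff_eq_zero (n := 3) (by omega)
        (ι_mul_mem_exteriorPower _ (ι_mul_mem_exteriorPower _ (ι_mem _)))
    have h5 : ∀ k, spinorPairing (s k) (ExteriorAlgebra.ι ℂ (Pi.single p 1 : W) *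
        (ExteriorAlgebra.ι ℂ (Pi.single q 1 : W) * basisSpinor k) -
        ExteriorAlgebra.ι ℂ (Pi.single q 1 : W) *
        (ExteriorAlgebra.ι ℂ (Pi.single p 1 : W) * basisSpinor k)) =
        2 * spinorPairing (ofSkew (skewPart (s k)))
          (basisSpinor p * (basisSpinor q * basisSpinor k)) := by
      intro k
      conv_lhs => rw [hc k]
      rw [ι_swap (Pi.single q 1), sub_neg_eq_add, ← two_smul ℂ, map_smul, map_add,
        LinearMap.add_apply, Algebra.algebraMap_eq_smul_one, map_smul, LinearMap.smul_apply,
        spinorPairing_apply 1, reverse.map_one, one_mul, hdeg k, smul_zero, zero_add,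
        smul_eq_mul]
      rfl
    simp only [h5] at this
    rw [← Finset.mul_sum, sum_spinorPairing_ofSkew] at this
    simpa using this
  intro a b c
  -- By skew-symmetry in the last two indices, the six terms are twice the cyclic sum.
  have h5 := tensor_relation h4 a b c
  rw [skewPart_swap (s a) b c, skewPart_swap (s b) c a, skewPart_swap (s c) a b] at h5
  linear_combination (1 / 2) * h5

/-! ### The kernel of the projection of `⋀² V` -/

theorem vol_mem_halfSpin : volSpinor ∈ halfSpin 1 := by
  have h : ∀ (i : Fin 5) (k : ZMod 2) (s : S), s ∈ halfSpin k →
      basisSpinor i * s ∈ halfSpin (k + 1) := by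
    intro i k s hs
    have := cliffordAction_mem_halfSpin (0, Pi.single i 1) k hs
    rwa [cliffordAction_apply, map_zero, LinearMap.zero_apply, zero_add] at this
  have h4 : basisSpinor 4 ∈ halfSpin 1 := ι_mem_evenOdd_one _ _
  rw [vol_eq_mul]
  have h5 := h 0 _ _ (h 1 _ _ (h 2 _ _ (h 3 _ _ h4)))
  rwa [show (1 + 1 + 1 + 1 + 1 : ZMod 2) = 1 by decide] at h5

theorem contractLeft_mem_halfSpin_zero (f : Dual ℂ W) {s : S} (hs : s ∈ halfSpin 1) :
    contractLeft f s ∈ halfSpin 0 := by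
  have h := contractLeft_mem_halfSpin f 1 hs
  rwa [show (1 + 1 : ZMod 2) = 0 by decide] at h

theorem contractLeft_mem_halfSpin_one (f : Dual ℂ W) {s : S} (hs : s ∈ halfSpin 0) :
    contractLeft f s ∈ halfSpin 1 := by
  have h := contractLeft_mem_halfSpin f 0 hs
  rwa [show (0 + 1 : ZMod 2) = 1 by decide] at h

/-- The image of `W ⊗ S⁺` under `ξ`. -/
def cliffordRange : Submodule ℂ (⋀[ℂ]^2 V) :=
  Submodule.span ℂ {ω | ∃ (w : W) (s : S), s ∈ halfSpin 0 ∧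
    ω = cliffordMap (ExteriorAlgebra.ι ℂ w) s}

/-- The contraction of the volume element by `coordW p` is sent to `2 e^p ∧ w - w_p Ω`, where `e^q =
coordW q` and `Ω = ∑ e^q ∧ e_q`. It remains to obtain `Ω` itself. -/
theorem wedge_inl_mem_cliffordRange (p : Fin 5) (w : W) :
    wedge (vec (.inl p)) (0, w) ∈ cliffordRange := by
  have h0 : ∀ (p : Fin 5) (w : W), (2 : ℂ) • wedge (vec (.inl p)) (0, w) -
      w p • ∑ q, wedge (vec (.inl q)) (vec (.inr q)) ∈ cliffordRange := by
    intro p w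
    refine Submodule.subset_span ⟨w, contractLeft (coordW p) volSpinor,
      contractLeft_mem_halfSpin_zero _ vol_mem_halfSpin, ?_⟩
    rw [cliffordMap_ι]
    have h1 : ∀ a b, spinorPairing (contractLeft (coordW p) volSpinor)
        (basisSpinor a * (basisSpinor b * ExteriorAlgebra.ι ℂ w)) = 0 := by
      intro a b
      simp only [basisSpinor]
      rw [spinorPairing_contractLeft, exterior_contractLeft_ι_mul, map_sub, map_smul,
        spinorPairing_vol_ι_mul, spinorPairing_vol_ι_mul, smul_zero, sub_zero]
    have h2 : ∀ q, spinorPairing (contractLeft (coordW p) volSpinor) (basisSpinor q) =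
        if p = q then 1 else 0 := by
      intro q
      rw [basisSpinor, spinorPairing_contractLeft_vol, coordW_apply, Pi.single_apply]
    simp only [h1, h2, spinorPairing_contractLeft_vol, coordW_apply, zero_smul,
      Finset.sum_const_zero, ite_smul, one_smul, Finset.sum_ite_eq, Finset.mem_univ, if_true]
    abel
  have h1 : ∑ q, wedge (vec (.inl q)) (vec (.inr q)) ∈ cliffordRange := by
    have h2 := sum_mem (t := Finset.univ) fun q _ => h0 q (Pi.single q 1)
    simp only [Pi.single_eq_same, one_smul, Finset.sum_sub_distrib, ← Finset.smul_sum] at h2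
    -- The sum over `p` with `w = e_p` is `(2 - 5) Ω`.
    have h3 := Submodule.smul_mem _ (-(1 / 3) : ℂ) h2
    convert h3 using 1
    simp only [vec, Finset.sum_const, Finset.card_univ, Fintype.card_fin]
    module
  have h2 := Submodule.smul_mem _ (2⁻¹ : ℂ) (add_mem (h0 p w) (Submodule.smul_mem _ (w p) h1))
  rwa [sub_add_cancel, smul_smul, inv_mul_cancel₀ two_ne_zero, one_smul] at h2

theorem sum_skew_smul {N : Type} [AddCommGroup N] [Module ℂ N] (F : Fin 5 → Fin 5 → N)
    (p q : Fin 5) : ∑ a, ∑ b, ((if p = a then (1 : ℂ) else 0) * (if q = b then 1 else 0) -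
      (if p = b then 1 else 0) * (if q = a then 1 else 0)) • F a b = F p q - F q p := by
  simp only [sub_smul, Finset.sum_sub_distrib, mul_smul, ite_smul, one_smul, zero_smul,
    Finset.sum_ite_eq, Finset.mem_univ, if_true]
  simp

theorem wedge_inl_inl_mem_cliffordRange (p q : Fin 5) :
    wedge (vec (.inl p)) (vec (.inl q)) ∈ cliffordRange := by
  by_cases hpq : p = q
  · subst hpq
    have h : wedge (vec (.inl p)) (vec (.inl p)) = 0 :=
      (exteriorPower.ιMulti ℂ 2).map_eq_zero_of_eq _ (i := 0) (j := 1) rfl (by decide)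
    rw [h]
    exact zero_mem _
  -- Multiplying by `e_k`, with `k` a third index, reduces the three-by-three determinant from the
  -- triple contraction to the minor of `p, q`.
  obtain ⟨k, hkp, hkq⟩ : ∃ k : Fin 5, k ≠ p ∧ k ≠ q := by
    revert p q
    decide
  have hs : contractLeft (coordW p) (contractLeft (coordW q) (contractLeft (coordW k) volSpinor)) ∈
      halfSpin 0 :=
    contractLeft_mem_halfSpin_zero _ (contractLeft_mem_halfSpin_one _
      (contractLeft_mem_halfSpin_zero _ vol_mem_halfSpin))
  have h : cliffordMap (ExteriorAlgebra.ι ℂ (Pi.single k 1)) (contractLeft (coordW p)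
      (contractLeft (coordW q) (contractLeft (coordW k) volSpinor))) ∈ cliffordRange :=
    Submodule.subset_span ⟨_, _, hs, rfl⟩
  have h1 : ∀ w, spinorPairing (contractLeft (coordW p)
      (contractLeft (coordW q) (contractLeft (coordW k) volSpinor)))
        (ExteriorAlgebra.ι ℂ w) = 0 := by
    intro w
    rw [spinorPairing_contractLeft, spinorPairing_contractLeft, exterior_contractLeft_ι]
    erw [contractLeft_algebraMap]
    exact map_zero _
  have h2 : ∀ a b, spinorPairing (contractLeft (coordW p)
      (contractLeft (coordW q) (contractLeft (coordW k) volSpinor)))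
      (basisSpinor a * (basisSpinor b * ExteriorAlgebra.ι ℂ (Pi.single k 1))) =
      (if p = a then 1 else 0) * (if q = b then 1 else 0) -
        (if p = b then 1 else 0) * (if q = a then 1 else 0) := by
    intro a b
    rw [spinorPairing_contractLeft, spinorPairing_contractLeft, spinorPairing_contractLeft,
      basisSpinor, basisSpinor, contractLeft_contractLeft_contractLeft_mul, map_smul,
      spinorPairing_vol_one]
    simp only [Pi.single_apply, if_neg hkp.symm, if_neg hkq.symm, if_true, smul_eq_mul]
    ring
  have h3 : ∀ a, spinorPairing (contractLeft (coordW p) (contractLeft (coordW q)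
      (contractLeft (coordW k) volSpinor))) (basisSpinor a) = 0 := fun a => h1 _
  have h4 : cliffordMap (ExteriorAlgebra.ι ℂ (Pi.single k 1)) (contractLeft (coordW p)
      (contractLeft (coordW q) (contractLeft (coordW k) volSpinor))) =
      (2 : ℂ) • wedge (vec (.inl p)) (vec (.inl q)) := by
    have h5 := sum_skew_smul (fun a b => wedge (vec (.inl a)) (vec (.inl b))) p q
    rw [cliffordMap_ι]
    simp only [h1, h2, h3, zero_smul, sub_zero, Finset.sum_const_zero, smul_zero, add_zero]
    rw [h5, wedge_swap (vec (.inl q)), sub_neg_eq_add, two_smul]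
  rw [h4] at h
  have := Submodule.smul_mem _ (2⁻¹ : ℂ) h
  rwa [smul_smul, inv_mul_cancel₀ two_ne_zero, one_smul] at this

theorem wedge_mem_cliffordRange (f : Dual ℂ W) (v : V) : wedge (f, 0) v ∈ cliffordRange := by
  have h : wedge (f, 0) v = ∑ p, f (Pi.single p 1) • (wedge (vec (.inl p)) (0, v.2) +
      ∑ q, v.1 (Pi.single q 1) • wedge (vec (.inl p)) (vec (.inl q))) := by
    have hf : ∀ f : Dual ℂ W, ((f, 0) : V) = ∑ p, f (Pi.single p 1) • vec (.inl p) := by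
      intro f
      refine Prod.ext ?_ ?_
      · conv_lhs => rw [show ((f, 0) : V).1 = f from rfl, sum_coordW f]
        simp only [vec, Prod.fst_sum, Prod.smul_fst]
        rfl
      · simp [vec, Prod.snd_sum]
    have hv : v = (0, v.2) + ∑ q, v.1 (Pi.single q 1) • vec (.inl q) := by
      rw [← hf]
      simp
    rw [← wedgeMap_apply, hf f]
    conv_lhs => rw [hv]
    simp only [map_sum, map_smul, map_add, LinearMap.sum_apply, LinearMap.smul_apply,
      wedgeMap_apply, smul_add]
    simp only [Finset.smul_sum, smul_smul, Finset.sum_add_distrib]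
    congr 1
    rw [Finset.sum_comm]
    simp only [mul_comm]
  rw [h]
  exact sum_mem fun p _ => Submodule.smul_mem _ _ (add_mem (wedge_inl_mem_cliffordRange _ _)
    (sum_mem fun q _ => Submodule.smul_mem _ _ (wedge_inl_inl_mem_cliffordRange _ _)))

/-- The section of `toDual x₀`. -/
def ofDual : Dual ℂ x₀.space →ₗ[ℂ] V :=
  LinearMap.inr ℂ (Dual ℂ W) W ∘ₗ LinearMap.pi fun i =>
    LinearMap.applyₗ ⟨(coordW i, 0), (mem_space_base _).2 rfl⟩

/-! ### The splitting of `V → U₀ᵛ` and the kernel on `⋀² V` -/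

theorem toDual_base_apply (v : V) (u : x₀.space) : toDual x₀ v u = u.1.1 v.2 := by
  rw [toDual_apply, LinearMap.dualProd_apply_apply, (mem_space_base _).1 u.2]
  simp

theorem ofDual_apply (θ : Dual ℂ x₀.space) : ofDual θ = (0, (ofDual θ).2) := rfl

theorem ofDual_toDual (v : V) : ofDual (toDual x₀ v) = (0, v.2) := by
  refine Prod.ext rfl (funext fun i => ?_)
  change toDual x₀ v _ = _
  rw [toDual_base_apply]
  rfl

theorem toDual_ofDual (θ : Dual ℂ x₀.space) : toDual x₀ (ofDual θ) = θ := by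
  refine LinearMap.ext fun u => ?_
  obtain ⟨⟨f, w⟩, hu⟩ := u
  obtain rfl : w = 0 := (mem_space_base _).1 hu
  rw [toDual_base_apply]
  have h : (⟨(f, 0), hu⟩ : x₀.space) = ∑ i, f (Pi.single i 1) •
      ⟨(coordW i, 0), (mem_space_base _).2 rfl⟩ := by
    refine Subtype.ext (Prod.ext ?_ ?_)
    · simp only [AddSubmonoidClass.coe_finsetSum, Prod.fst_sum]
      exact sum_coordW f
    · simp [Prod.snd_sum]
  conv_rhs => rw [h]
  conv_lhs => rw [show (⟨(f, 0), hu⟩ : x₀.space).1.1 = f from rfl, sum_coordW f]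
  simp only [LinearMap.sum_apply, LinearMap.smul_apply, map_sum, map_smul]
  rfl

theorem toDual_base_surjective : Function.Surjective (toDual x₀) :=
  fun θ => ⟨_, toDual_ofDual θ⟩

/-- Every term of `cliffordMap_ι` has a factor in `U₀`, which `toDual x₀` kills. -/
theorem toDual_cliffordMap (w : W) (s : S) :
    exteriorPower.map 2 (toDual x₀) (cliffordMap (ExteriorAlgebra.ι ℂ w) s) = 0 := by
  have h : ∀ (p : Fin 5) (v : V), exteriorPower.map 2 (toDual x₀) (wedge (vec (.inl p)) v) = 0 := by
    intro p v
    rw [wedge, exteriorPower.map_apply_ιMulti]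
    refine (exteriorPower.ιMulti ℂ 2).map_coord_zero 0 ?_
    refine LinearMap.ext fun u => ?_
    change toDual x₀ (vec (.inl p)) u = 0
    rw [toDual_base_apply]
    exact map_zero _
  rw [cliffordMap_ι]
  simp [h]

theorem mem_cliffordRange {ω : ⋀[ℂ]^2 V} (hω : exteriorPower.map 2 (toDual x₀) ω = 0) :
    ω ∈ cliffordRange := by
  -- The identity minus the projector `⋀²` of the splitting has values in `U₀ ∧ V`, which lies in
  -- the range. On the kernel the projector vanishes, so `ω` is its own difference.
  have h : cliffordRange.mkQ ∘ₗ (LinearMap.id - exteriorPower.map 2 (ofDual ∘ₗ toDual x₀)) = 0 := by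
    refine exteriorPower.linearMap_ext ?_
    refine AlternatingMap.ext fun v => ?_
    simp only [LinearMap.compAlternatingMap_apply, LinearMap.comp_apply, LinearMap.sub_apply,
      LinearMap.id_apply, exteriorPower.map_apply_ιMulti, Submodule.mkQ_apply]
    change _ = (0 : ⋀[ℂ]^2 V ⧸ cliffordRange)
    rw [Submodule.Quotient.mk_eq_zero]
    have e1 : exteriorPower.ιMulti ℂ 2 v = wedge (v 0) (v 1) := by
      rw [wedge]
      congr 1
      funext i
      fin_cases i <;> rfl
    have e2 : exteriorPower.ιMulti ℂ 2 ((ofDual ∘ₗ toDual x₀) ∘ v) =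
        wedge (0, (v 0).2) (0, (v 1).2) := by
      rw [wedge]
      congr 1
      funext i
      fin_cases i
      · exact ofDual_toDual (v 0)
      · exact ofDual_toDual (v 1)
    have e3 : ∀ (f : Dual ℂ W) (w : W), ((f, w) : V) = (f, 0) + (0, w) := fun f w => by simp
    have e4 : ∀ u v : V, wedge u v - wedge (0, u.2) (0, v.2) =
        wedge (u.1, 0) v - wedge (v.1, 0) (0, u.2) := by
      rintro ⟨f, w⟩ ⟨f', w'⟩
      rw [wedge_swap (f', 0)]
      simp only [← wedgeMap_apply]
      rw [e3 f w, e3 f' w']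
      simp only [map_add, LinearMap.add_apply]
      abel
    rw [e1, e2, e4]
    exact sub_mem (wedge_mem_cliffordRange _ _) (wedge_mem_cliffordRange _ _)
  have := LinearMap.congr_fun h ω
  simp only [LinearMap.comp_apply, LinearMap.sub_apply, LinearMap.id_apply, exteriorPower.map_comp,
    hω, map_zero, sub_zero, Submodule.mkQ_apply, LinearMap.zero_apply,
    Submodule.Quotient.mk_eq_zero] at this
  exact this

/-! ### The Schur module of the partition `(2, 1)` -/

open scoped Kronecker in
/-- The action of matrices on tensors in `W ⊗ W ⊗ W`. -/
def tensorAct (A : Matrix (Fin 5) (Fin 5) ℂ) :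
    (Fin 5 → Fin 5 → Fin 5 → ℂ) →ₗ[ℂ] (Fin 5 → Fin 5 → Fin 5 → ℂ) where
  -- With the Kronecker cube, multiplicativity in `A` is inherited from matrices.
  toFun T a b c := ((A ⊗ₖ (A ⊗ₖ A)) *ᵥ fun p => T p.1 p.2.1 p.2.2) (a, b, c)
  map_add' T T' := by
    funext a b c
    exact congrFun (Matrix.mulVec_add _ _ _) (a, b, c)
  map_smul' r T := by
    funext a b c
    exact congrFun (Matrix.mulVec_smul (A ⊗ₖ (A ⊗ₖ A)) r fun p => T p.1 p.2.1 p.2.2) (a, b, c)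

theorem tensorAct_mul (A B : Matrix (Fin 5) (Fin 5) ℂ) (T : Fin 5 → Fin 5 → Fin 5 → ℂ) :
    tensorAct (A * B) T = tensorAct A (tensorAct B T) := by
  funext a b c
  simp only [tensorAct, LinearMap.coe_mk, AddHom.coe_mk, Matrix.mul_kronecker_mul,
    ← Matrix.mulVec_mulVec]

theorem tensorAct_apply (A : Matrix (Fin 5) (Fin 5) ℂ) (T : Fin 5 → Fin 5 → Fin 5 → ℂ)
    (a b c : Fin 5) :
    tensorAct A T a b c = ∑ i, ∑ j, ∑ k, A a i * (A b j * A c k) * T i j k := by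
  simp only [tensorAct, LinearMap.coe_mk, AddHom.coe_mk, Matrix.mulVec, dotProduct,
    Fintype.sum_prod_type, Matrix.kroneckerMap_apply]

theorem tensorAct_mem {T : Fin 5 → Fin 5 → Fin 5 → ℂ} (A : Matrix (Fin 5) (Fin 5) ℂ)
    (hT : T ∈ schurTensor) : tensorAct A T ∈ schurTensor := by
  refine ⟨fun a b c => ?_, fun a b c => ?_⟩
  · simp only [tensorAct_apply, ← Finset.sum_neg_distrib]
    refine Finset.sum_congr rfl fun i _ => ?_
    rw [Finset.sum_comm]
    refine Finset.sum_congr rfl fun j _ => Finset.sum_congr rfl fun k _ => ?_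
    rw [hT.1 i j k]
    ring
  · have h1 : tensorAct A T b c a = ∑ i, ∑ j, ∑ k, A a i * (A b j * A c k) * T j k i := by
      rw [tensorAct_apply]
      conv_rhs => rw [Finset.sum_comm]
      refine Finset.sum_congr rfl fun j _ => ?_
      conv_rhs => rw [Finset.sum_comm]
      exact Finset.sum_congr rfl fun k _ => Finset.sum_congr rfl fun i _ => by ring
    have h2 : tensorAct A T c a b = ∑ i, ∑ j, ∑ k, A a i * (A b j * A c k) * T k i j := by
      rw [tensorAct_apply, Finset.sum_comm]
      refine Finset.sum_congr rfl fun i _ => ?_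
      rw [Finset.sum_comm]
      exact Finset.sum_congr rfl fun k _ => Finset.sum_congr rfl fun i _ => by ring
    rw [h1, h2, tensorAct_apply]
    simp only [← Finset.sum_add_distrib, ← mul_add, hT.2, mul_zero, Finset.sum_const_zero]

/-- The tensor `x ⊗ (y ⊗ z - z ⊗ y)`. -/
def wedgeTensor (x y z : W) (a b c : Fin 5) : ℂ := x a * (y b * z c - z b * y c)

theorem wedgeTensor_mem (x y : W) : wedgeTensor x x y ∈ schurTensor :=
  ⟨fun a b c => by simp only [wedgeTensor]; ring, fun a b c => by simp only [wedgeTensor]; ring⟩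

theorem tensorAct_wedgeTensor (A : Matrix (Fin 5) (Fin 5) ℂ) (x y z : W) :
    tensorAct A (wedgeTensor x y z) = wedgeTensor (A *ᵥ x) (A *ᵥ y) (A *ᵥ z) := by
  funext a b c
  have h : ∀ x y z : W, ∑ i, ∑ j, ∑ k, A a i * (A b j * A c k) * (x i * (y j * z k)) =
      (A *ᵥ x) a * ((A *ᵥ y) b * (A *ᵥ z) c) := by
    intro x y z
    simp only [Matrix.mulVec, dotProduct]
    rw [Finset.sum_mul]
    refine Finset.sum_congr rfl fun i _ => ?_
    rw [Finset.sum_mul_sum, Finset.mul_sum]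
    refine Finset.sum_congr rfl fun j _ => ?_
    rw [Finset.mul_sum]
    exact Finset.sum_congr rfl fun k _ => by ring
  simp only [tensorAct_apply, wedgeTensor, mul_sub, Finset.sum_sub_distrib]
  rw [h x y z, h x z y]

theorem wedgeTensor_polarize (x y z : W) : wedgeTensor x y z + wedgeTensor y x z =
    wedgeTensor (x + y) (x + y) z - wedgeTensor x x z - wedgeTensor y y z := by
  funext a b c
  simp only [wedgeTensor, Pi.add_apply, Pi.sub_apply]
  ring

theorem three_smul_eq_sum {T : Fin 5 → Fin 5 → Fin 5 → ℂ} (hT : T ∈ schurTensor) :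
    (3 : ℂ) • T = ∑ a, ∑ b, ∑ c, T a b c • (wedgeTensor (Pi.single a 1) (Pi.single b 1)
      (Pi.single c 1) + wedgeTensor (Pi.single b 1) (Pi.single a 1) (Pi.single c 1)) := by
  funext p q r
  -- Skew-symmetry doubles the first term, and the cyclic relation turns the other two into a third
  -- copy.
  have h : T p q r - T p r q + (T q p r - T r p q) = 3 * T p q r := by
    linear_combination -hT.1 p q r - hT.2 p q r - hT.1 q r p * (-1)
  simp only [Pi.smul_apply, smul_eq_mul, ← h, Finset.sum_apply, Pi.add_apply, wedgeTensor]
  simp [Pi.single_apply, mul_add, mul_sub, Finset.sum_add_distrib, Finset.sum_sub_distrib]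

theorem exists_ne_zero_of_ne_bot {N : Submodule ℂ (Fin 5 → Fin 5 → Fin 5 → ℂ)}
    (hN : N ≤ schurTensor) (hne : N ≠ ⊥) (h : ∀ A, ∀ T ∈ N, tensorAct A T ∈ N) :
    ∃ T ∈ N, T 0 0 1 ≠ 0 := by
  by_contra! h0
  obtain ⟨T, hT, hT0⟩ := Submodule.exists_mem_ne_zero_of_ne_bot hne
  -- With rows `u` and `v`, the entry `(0, 0, 1)` of the transformed tensor is the value of `T`, as
  -- a trilinear form, at `(u, u, v)`. Polarization then makes `T` skew in its first two indices.
  have key : ∀ u v : W, ∑ i, ∑ j, ∑ k, u i * (u j * v k) * T i j k = 0 := by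
    intro u v
    have := h0 _ (h (Matrix.of ![u, v, 0, 0, 0]) T hT)
    rwa [tensorAct_apply] at this
  have h1 : ∀ a c, T a a c = 0 := fun a c => by
    have := key (Pi.single a 1) (Pi.single c 1)
    simpa [Pi.single_apply] using this
  have h2 : ∀ a b c, T a b c + T b a c = 0 := fun a b c => by
    have := key (Pi.single a 1 + Pi.single b 1) (Pi.single c 1)
    simp [Pi.single_apply, add_mul, mul_add, Finset.sum_add_distrib, h1] at this
    linear_combination this
  refine hT0 (funext fun a => funext fun b => funext fun c => ?_)
  have e := hN hT
  have : 3 * T a b c = 0 := by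
    linear_combination e.2 a b c - e.1 b a c + h2 a b c - h2 a c b + e.1 a b c
  simpa using this

theorem wedgeTensor_mem_of_stable {N : Submodule ℂ (Fin 5 → Fin 5 → Fin 5 → ℂ)}
    (hN : N ≤ schurTensor) (hne : N ≠ ⊥) (h : ∀ A, ∀ T ∈ N, tensorAct A T ∈ N) (x y : W) :
    wedgeTensor x x y ∈ N := by
  obtain ⟨T, hT, hT0⟩ := exists_ne_zero_of_ne_bot hN hne h
  have e := hN hT
  have h010 := e.1 0 0 1
  have h100 : T 1 0 0 = 0 := by linear_combination (e.1 1 0 0) / 2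
  have h111 : T 1 1 1 = 0 := by linear_combination (e.1 1 1 1) / 2
  let A : W → Matrix (Fin 5) (Fin 5) ℂ := fun x => Matrix.of fun i => ![x i, y i, 0, 0, 0]
  -- The matrix sends `e_0, e_1` to `x, y` and kills the rest. Adding the value at `-x` removes odd
  -- degree in `x`; the symmetries of `T` kill `T 1 1 1` and `T 1 0 0`, leaving the terms quadratic
  -- in `x`.
  have key : tensorAct (A x) T + tensorAct (A (-x)) T = (2 * T 0 0 1) • wedgeTensor x x y := by
    funext p q r
    simp only [Pi.add_apply, Pi.smul_apply, tensorAct_apply, smul_eq_mul, wedgeTensor, A,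
      Fin.sum_univ_five, Matrix.of_apply, Pi.neg_apply]
    simp
    rw [h010, h100, h111]
    ring
  have h2 : (2 * T 0 0 1) ≠ 0 := by simpa using hT0
  rw [← inv_smul_smul₀ h2 (wedgeTensor x x y), ← key]
  exact N.smul_mem _ (add_mem (h _ T hT) (h _ T hT))

theorem eq_schurTensor_of_stable {N : Submodule ℂ (Fin 5 → Fin 5 → Fin 5 → ℂ)}
    (hN : N ≤ schurTensor) (hne : N ≠ ⊥) (h : ∀ A, ∀ T ∈ N, tensorAct A T ∈ N) :
    N = schurTensor := by
  refine le_antisymm hN fun T hT => ?_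
  have hw := wedgeTensor_mem_of_stable hN hne h
  rw [← inv_smul_smul₀ (three_ne_zero : (3 : ℂ) ≠ 0) T, three_smul_eq_sum hT]
  refine N.smul_mem _ (sum_mem fun a _ => sum_mem fun b _ => sum_mem fun c _ => N.smul_mem _ ?_)
  rw [wedgeTensor_polarize]
  exact sub_mem (sub_mem (hw _ _) (hw _ _)) (hw _ _)

/-! ### Stability under all matrices -/

theorem tensorAct_diagonal (d : Fin 5 → ℂ) (T : Fin 5 → Fin 5 → Fin 5 → ℂ) (a b c : Fin 5) :
    tensorAct (Matrix.diagonal d) T a b c = d a * d b * d c * T a b c := by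
  simp [tensorAct_apply, Matrix.diagonal_apply, mul_assoc]

/-- The entries are polynomials of degree at most three in the `k`-th diagonal entry, so their
fourth difference vanishes. This reaches a singular matrix from invertible ones. -/
theorem tensorAct_diagonal_update_zero (k : Fin 5) (T : Fin 5 → Fin 5 → Fin 5 → ℂ) :
    tensorAct (Matrix.diagonal (Function.update 1 k 0)) T =
      (4 : ℂ) • tensorAct (Matrix.diagonal (Function.update 1 k 1)) T -
      (6 : ℂ) • tensorAct (Matrix.diagonal (Function.update 1 k 2)) T +
      (4 : ℂ) • tensorAct (Matrix.diagonal (Function.update 1 k 3)) T -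
      tensorAct (Matrix.diagonal (Function.update 1 k 4)) T := by
  funext a b c
  simp only [Pi.add_apply, Pi.sub_apply, Pi.smul_apply, smul_eq_mul, tensorAct_diagonal,
    Function.update_apply, Pi.one_apply]
  split_ifs <;> ring

theorem tensorAct_mem_of_elementary {N : Submodule ℂ (Fin 5 → Fin 5 → Fin 5 → ℂ)}
    (hd : ∀ (k : Fin 5) (r : ℂ), r ≠ 0 → ∀ T ∈ N,
      tensorAct (Matrix.diagonal (Function.update 1 k (r ^ 2))) T ∈ N)
    (ht : ∀ (i j : Fin 5) (t : ℂ), i ≠ j → ∀ T ∈ N, tensorAct (Matrix.transvection i j t) T ∈ N)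
    (A : Matrix (Fin 5) (Fin 5) ℂ) : ∀ T ∈ N, tensorAct A T ∈ N := by
  have hd' : ∀ (k : Fin 5) (t : ℂ), ∀ T ∈ N,
      tensorAct (Matrix.diagonal (Function.update 1 k t)) T ∈ N := by
    intro k t T hT
    -- The group supplies only squares, but every complex number is a square.
    have hne : ∀ t : ℂ, t ≠ 0 → tensorAct (Matrix.diagonal (Function.update 1 k t)) T ∈ N := by
      intro t ht0
      obtain ⟨r, rfl⟩ := IsAlgClosed.exists_pow_nat_eq t two_pos
      exact hd k r (by rintro rfl; simp at ht0) T hT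
    rcases eq_or_ne t 0 with rfl | ht0
    · rw [tensorAct_diagonal_update_zero]
      exact sub_mem (add_mem (sub_mem (N.smul_mem _ (hne _ (by norm_num)))
        (N.smul_mem _ (hne _ (by norm_num)))) (N.smul_mem _ (hne _ (by norm_num))))
        (hne _ (by norm_num))
    · exact hne t ht0
  refine Matrix.diagonal_transvection_induction (fun A => ∀ T ∈ N, tensorAct A T ∈ N) A
    (fun d _ T hT => ?_) (fun t T hT => ht _ _ _ t.hij T hT) fun A B hA hB T hT => ?_
  · have e : Matrix.diagonal d = Matrix.diagonal (Function.update 1 0 (d 0)) *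
        (Matrix.diagonal (Function.update 1 1 (d 1)) *
        (Matrix.diagonal (Function.update 1 2 (d 2)) *
        (Matrix.diagonal (Function.update 1 3 (d 3)) *
        Matrix.diagonal (Function.update 1 4 (d 4))))) := by
      simp only [Matrix.diagonal_mul_diagonal]
      congr 1
      funext a
      fin_cases a <;> simp
    rw [e]
    simp only [tensorAct_mul]
    exact hd' _ _ _ (hd' _ _ _ (hd' _ _ _ (hd' _ _ _ (hd' _ _ _ hT))))
  · rw [tensorAct_mul]
    exact hA _ (hB _ hT)

/-! ### Elements of the stabilizer of the base point -/

theorem polar_Q (u v : V) : QuadraticMap.polar Q u v = u.1 v.2 + v.1 u.2 := by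
  simp only [QuadraticMap.polar, QuadraticForm.dualProd_apply, Prod.fst_add, Prod.snd_add, map_add,
    LinearMap.add_apply]
  ring

/-- Since `star` negates vectors, unitarity of `ι a` means `-Q a = 1`; hence the normalization `-1`.
-/
theorem ι_mem_pinGroup {a : V} (ha : Q a = -1) : ι Q a ∈ pinGroup Q := by
  have h : ι Q a * -ι Q a = 1 := by rw [mul_neg, ι_sq_scalar, ha, map_neg, map_one, neg_neg]
  refine pinGroup.mem_iff.2 ⟨?_, ?_⟩
  · exact ⟨⟨ι Q a, -ι Q a, h, by rw [neg_mul, ← mul_neg, h]⟩, Subgroup.subset_closure ⟨a, rfl⟩, rfl⟩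
  · rw [Unitary.mem_iff, star_ι, neg_mul, ← mul_neg]
    exact ⟨h, h⟩

theorem ι_mul_ι_mem_spinGroup {a b : V} (ha : Q a = -1) (hb : Q b = -1) :
    ι Q a * ι Q b ∈ spinGroup Q :=
  ⟨mul_mem (ι_mem_pinGroup ha) (ι_mem_pinGroup hb), ι_mul_ι_mem_evenOdd_zero Q a b⟩

/-- Each vector conjugates by a reflection up to sign, and the two signs cancel. -/
theorem vecRep_ι_mul_ι {a b : V} (h : ι Q a * ι Q b ∈ spinGroup Q) (ha : Q a = -1) (hb : Q b = -1)
    (v : V) : vecRep ⟨ι Q a * ι Q b, h⟩ v =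
      v + QuadraticMap.polar Q b v • b +
        QuadraticMap.polar Q a (v + QuadraticMap.polar Q b v • b) • a := by
  have h1 : vecRep ⟨ι Q a * ι Q b, h⟩ v =
      vectorPart (ι Q a * (ι Q b * ι Q v * ι Q b) * ι Q a) := by
    rw [← vectorPart_ι (vecRep _ v), ι_vecRep]
    simp [mul_assoc, star_ι]
  rw [h1, ι_mul_ι_mul_ι, ι_mul_ι_mul_ι, vectorPart_ι, ha, hb]
  simp only [neg_smul, one_smul, sub_neg_eq_add]
  rw [add_comm, add_comm v]

theorem smul_base_eq {g : Spin} (h : ∀ f : Dual ℂ W, (vecRep g (f, 0)).2 = 0) : g • x₀ = x₀ := by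
  refine Subtype.ext (Submodule.eq_of_le_of_finrank_le ?_ ?_)
  · rintro _ ⟨⟨f, w⟩, hv, rfl⟩
    have hw : w = 0 := (mem_space_base (f, w)).1 hv
    exact (mem_space_base _).2 (by rw [hw]; exact h f)
  · exact (LinearEquiv.finrank_eq (Submodule.equivMapOfInjective (vecRep g)
      (Representation.apply_bijective vecRep g).1 U₀)).le

theorem vecRep_snd_of_smul_base {g : Spin} (hg : g • x₀ = x₀) {v : V} (hv : v.2 = 0) :
    (vecRep g v).2 = 0 := by
  rw [← mem_space_base] at hv ⊢
  rw [← hg]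
  exact Submodule.mem_map_of_mem hv

theorem vecRep_snd {g : Spin} (hg : g • x₀ = x₀) (v : V) :
    (vecRep g v).2 = leviMatrix g *ᵥ v.2 := by
  have h : v = (v.1, 0) + ∑ i, v.2 i • ((0, Pi.single i 1) : V) := by
    refine Prod.ext (by simp [Prod.fst_sum]) ?_
    ext j
    simp [Prod.snd_sum, Pi.single_apply]
  conv_lhs => rw [h]
  rw [map_add, Prod.snd_add, vecRep_snd_of_smul_base hg rfl, zero_add, map_sum, Prod.snd_sum]
  ext j
  simp only [map_smul, Prod.smul_snd, Finset.sum_apply, Pi.smul_apply, smul_eq_mul, Matrix.mulVec,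
    dotProduct, leviMatrix, Matrix.of_apply, mul_comm]

/-- The product of two orthogonal reflections with the same second component up to a scalar. -/
theorem exists_spin_transvection (f : Dual ℂ W) (w : W) (c : ℂ) (hc : c ≠ 0) (f' : Dual ℂ W)
    (hf : f w = 1) (hf' : f' w = 1) : ∃ g : Spin, g • x₀ = x₀ ∧ ∀ i j, leviMatrix g i j =
      (1 : Matrix (Fin 5) (Fin 5) ℂ) i j +
        (c ^ 2 * f' (Pi.single j 1) - f (Pi.single j 1)) * w i := by
  -- Both vectors have norm `-1`, and their images in `V / U₀` are multiples of `w`. So the product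
  -- preserves `U₀` and differs from the identity on `V / U₀` by multiples of `w`.
  set a : V := (-c⁻¹ • f, c • w) with ha
  set b : V := (-f', w) with hb
  have hQa : Q a = -1 := by simp [ha, hf, hc]
  have hQb : Q b = -1 := by simp [hb, hf']
  have hm := ι_mul_ι_mem_spinGroup hQa hQb
  have key : ∀ v : V, (vecRep ⟨_, hm⟩ v).2 = v.2 + (c ^ 2 * f' v.2 - f v.2) • w := by
    intro v
    rw [vecRep_ι_mul_ι hm hQa hQb]
    simp only [polar_Q, ha, hb, Prod.snd_add, Prod.smul_snd, Prod.fst_add, Prod.smul_fst, map_add,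
      map_smul, LinearMap.add_apply, LinearMap.smul_apply, LinearMap.neg_apply,
      smul_eq_mul, hf, hf']
    ext i
    simp only [Pi.add_apply, Pi.smul_apply, smul_eq_mul]
    field_simp
    ring
  refine ⟨⟨_, hm⟩, smul_base_eq fun f => by rw [key]; simp, fun i j => ?_⟩
  simp only [leviMatrix, Matrix.of_apply]
  rw [key]
  simp [Matrix.one_apply, Pi.single_apply]

theorem exists_leviMatrix_eq_transvection (i j : Fin 5) (t : ℂ) (hij : i ≠ j) :
    ∃ g : Spin, g • x₀ = x₀ ∧ leviMatrix g = Matrix.transvection i j t := by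
  -- Here `c = 1`, and the two linear forms differ by `t • coordW j`.
  obtain ⟨g, hg, h⟩ := exists_spin_transvection (coordW i) (Pi.single i 1) 1 one_ne_zero
    (coordW i + t • coordW j) (by simp) (by simp [hij])
  refine ⟨g, hg, Matrix.ext fun p q => ?_⟩
  rw [h]
  simp only [Matrix.transvection, Matrix.add_apply, Matrix.single_apply, coordW_apply,
    LinearMap.add_apply, LinearMap.smul_apply, Pi.single_apply, smul_eq_mul]
  congr 1
  by_cases h1 : p = i <;> by_cases h2 : q = j <;> simp [h1, h2, eq_comm]
  all_goals grind

theorem exists_leviMatrix_eq_diagonal (k : Fin 5) (r : ℂ) (hr : r ≠ 0) :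
    ∃ g : Spin, g • x₀ = x₀ ∧ leviMatrix g = Matrix.diagonal (Function.update 1 k (r ^ 2)) := by
  -- Equal linear forms leave `1 + (r² - 1)` at position `k`.
  obtain ⟨g, hg, h⟩ := exists_spin_transvection (coordW k) (Pi.single k 1) r hr
    (coordW k) (by simp) (by simp)
  refine ⟨g, hg, Matrix.ext fun p q => ?_⟩
  rw [h]
  simp only [Matrix.diagonal_apply, Matrix.one_apply, coordW_apply, Pi.single_apply,
    Function.update_apply, Pi.one_apply]
  by_cases h1 : p = k <;> by_cases h2 : q = k <;> simp [h1, h2]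

theorem eq_schurTensor_of_stabilizer {N : Submodule ℂ (Fin 5 → Fin 5 → Fin 5 → ℂ)}
    (hN : N ≤ schurTensor) (hne : N ≠ ⊥)
    (h : ∀ g : Spin, g • x₀ = x₀ → ∀ T ∈ N, tensorAct (leviMatrix g) T ∈ N) : N = schurTensor := by
  refine eq_schurTensor_of_stable hN hne (tensorAct_mem_of_elementary ?_ ?_)
  · intro k r hr T hT
    obtain ⟨g, hg, e⟩ := exists_leviMatrix_eq_diagonal k r hr
    exact e ▸ h g hg T hT
  · intro i j t hij T hT
    obtain ⟨g, hg, e⟩ := exists_leviMatrix_eq_transvection i j t hij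
    exact e ▸ h g hg T hT

/-! ### The bundle of highest weight `ω₁ + ω₂` -/

/-- The basis of the dual of `U₀` which is given by the standard basis of `W`. -/
def dualVec (i : Fin 5) : Dual ℂ x₀.space := toDual x₀ (0, Pi.single i 1)

theorem dualVec_linearIndependent : LinearIndependent ℂ dualVec := by
  rw [Fintype.linearIndependent_iff]
  intro c hc i
  have h := congrArg (fun θ => (ofDual θ).2 i) hc
  simpa [dualVec, map_sum, ofDual_toDual, Prod.snd_sum, Pi.single_apply] using h

theorem toDual_base (v : V) : toDual x₀ v = ∑ i, v.2 i • dualVec i := by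
  have h : ∀ θ θ' : Dual ℂ x₀.space, (ofDual θ).2 = (ofDual θ').2 → θ = θ' := by
    intro θ θ' h
    rw [← toDual_ofDual θ, ← toDual_ofDual θ', ofDual_apply θ, ofDual_apply θ', h]
  refine h _ _ ?_
  rw [ofDual_toDual]
  ext j
  simp [dualVec, map_sum, ofDual_toDual, Prod.snd_sum, Pi.single_apply]

theorem act_dualVec (g : Spin) (hg : g • x₀ = x₀) (j : Fin 5) :
    taut.dual.act g hg (dualVec j) = ∑ i, leviMatrix g i j • dualVec i := by
  have h := act_toDual g hg (0, Pi.single j 1)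
  refine h.trans ?_
  rw [toDual_base, vecRep_snd hg]
  simp
  rfl

/-- The basis `dualVec`. -/
def dualBasis : Basis (Fin 5) ℂ (Dual ℂ x₀.space) :=
  Basis.mk dualVec_linearIndependent fun θ _ => by
    rw [← toDual_ofDual θ, toDual_base]
    exact sum_mem fun i _ => Submodule.smul_mem _ _ (Submodule.subset_span ⟨i, rfl⟩)

@[simp] theorem dualBasis_apply (i : Fin 5) : dualBasis i = dualVec i := Basis.mk_apply _ _ _

/-- The tensor in `U₀ᵛ ⊗ U₀ᵛ ⊗ U₀ᵛ` with given coordinates. -/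
def dualTensor : (Fin 5 → Fin 5 → Fin 5 → ℂ) →ₗ[ℂ]
    Dual ℂ x₀.space ⊗[ℂ] (Dual ℂ x₀.space ⊗[ℂ] Dual ℂ x₀.space) where
  toFun T := ∑ a, ∑ b, ∑ c, T a b c • (dualVec a ⊗ₜ[ℂ] (dualVec b ⊗ₜ[ℂ] dualVec c))
  map_add' T T' := by simp only [Pi.add_apply, add_smul, Finset.sum_add_distrib]
  map_smul' r T := by
    simp only [Pi.smul_apply, smul_eq_mul, mul_smul, Finset.smul_sum, RingHom.id_apply]

theorem dualTensor_apply (T : Fin 5 → Fin 5 → Fin 5 → ℂ) : dualTensor T =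
    ∑ a, ∑ b, ∑ c, T a b c • (dualVec a ⊗ₜ[ℂ] (dualVec b ⊗ₜ[ℂ] dualVec c)) := rfl

theorem dualTensor_injective : Function.Injective dualTensor := by
  rw [injective_iff_map_eq_zero]
  intro T hT
  have h : ∑ p : Fin 5 × Fin 5 × Fin 5, T p.1 p.2.1 p.2.2 •
      (dualBasis.tensorProduct (dualBasis.tensorProduct dualBasis)) p = 0 := by
    rw [← hT, dualTensor_apply]
    simp [Fintype.sum_prod_type, Basis.tensorProduct_apply]
  funext a b c
  exact Fintype.linearIndependent_iff.1 (Basis.linearIndependent _) _ h (a, b, c)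

/-- This turns the action on the triple tensor power of `U₀ᵛ` into `tensorAct`, so that `schurRep`
is a subrepresentation. -/
theorem map_dualTensor (L : Dual ℂ x₀.space →ₗ[ℂ] Dual ℂ x₀.space) (A : Matrix (Fin 5) (Fin 5) ℂ)
    (hL : ∀ j, L (dualVec j) = ∑ i, A i j • dualVec i) (T : Fin 5 → Fin 5 → Fin 5 → ℂ) :
    TensorProduct.map L (TensorProduct.map L L) (dualTensor T) = dualTensor (tensorAct A T) := by
  have h1 : ∀ i j k, TensorProduct.map L (TensorProduct.map L L)
      (dualVec i ⊗ₜ[ℂ] (dualVec j ⊗ₜ[ℂ] dualVec k)) = ∑ a, ∑ b, ∑ c,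
        (A a i * (A b j * A c k)) • (dualVec a ⊗ₜ[ℂ] (dualVec b ⊗ₜ[ℂ] dualVec c)) := by
    intro i j k
    rw [TensorProduct.map_tmul, TensorProduct.map_tmul, hL, hL, hL, TensorProduct.sum_tmul]
    refine Finset.sum_congr rfl fun a _ => ?_
    rw [TensorProduct.sum_tmul, TensorProduct.tmul_sum]
    refine Finset.sum_congr rfl fun b _ => ?_
    rw [TensorProduct.tmul_sum, TensorProduct.tmul_sum]
    refine Finset.sum_congr rfl fun c _ => ?_
    rw [TensorProduct.smul_tmul_smul, TensorProduct.smul_tmul_smul]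
  simp only [dualTensor_apply, map_sum, map_smul, h1, tensorAct_apply, Finset.smul_sum,
    Finset.sum_smul, smul_smul]
  have e : ∀ F : Fin 5 → Fin 5 → Fin 5 → Fin 5 → Fin 5 → Fin 5 →
      Dual ℂ x₀.space ⊗[ℂ] (Dual ℂ x₀.space ⊗[ℂ] Dual ℂ x₀.space),
      ∑ i, ∑ j, ∑ k, ∑ a, ∑ b, ∑ c, F i j k a b c =
        ∑ a, ∑ b, ∑ c, ∑ i, ∑ j, ∑ k, F i j k a b c := by
    intro F
    have := Finset.sum_comm (s := (Finset.univ : Finset (Fin 5 × Fin 5 × Fin 5)))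
      (t := (Finset.univ : Finset (Fin 5 × Fin 5 × Fin 5)))
      (f := fun p q => F p.1 p.2.1 p.2.2 q.1 q.2.1 q.2.2)
    simpa only [Fintype.sum_prod_type] using this
  rw [e]
  simp only [mul_comm]

/-- The action of the stabilizer on the Schur module of the partition `(2, 1)`, realized in
`𝒰ᵛ ⊗ 𝒰ᵛ ⊗ 𝒰ᵛ`. -/
def schurRep : EquivariantBundle.FiberRep schurTensor
    (taut.dual.tensor (taut.dual.tensor taut.dual)) where
  rep g _ := (tensorAct (leviMatrix g)).restrict fun _ hT => tensorAct_mem _ hT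
  emb := dualTensor ∘ₗ schurTensor.subtype
  injective := dualTensor_injective.comp Subtype.val_injective
  emb_rep g hg T := (map_dualTensor (taut.dual.act g hg) _ (act_dualVec g hg) T.1).symm

/-- The homogeneous bundle with highest weight `ω₁ + ω₂`. -/
def schurBundle : EquivariantBundle := schurRep.bundle

theorem schurBundle_act (g : Spin) (hg : g • x₀ = x₀) (T : schurTensor) :
    (schurBundle.act g hg T : schurTensor) = ⟨tensorAct (leviMatrix g) T.1, tensorAct_mem _ T.2⟩ :=
  schurRep.bundle_act_base g hg T

theorem schurBundle_irreducible (N : Submodule ℂ schurTensor)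
    (h : ∀ (g : Spin) (hg : g • x₀ = x₀), ∀ T ∈ N, schurBundle.act g hg T ∈ N) :
    N = ⊥ ∨ N = ⊤ := by
  refine or_iff_not_imp_left.2 fun hne => ?_
  have key : N.map schurTensor.subtype = schurTensor := by
    refine eq_schurTensor_of_stabilizer (Submodule.map_subtype_le _ _) ?_ ?_
    · exact fun h => hne (Submodule.map_injective_of_injective schurTensor.injective_subtype
        (h.trans (Submodule.map_bot _).symm))
    · rintro g hg _ ⟨T, hT, rfl⟩
      exact ⟨_, h g hg T hT, congrArg Subtype.val (schurBundle_act g hg T)⟩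
  refine Submodule.map_injective_of_injective schurTensor.injective_subtype ?_
  rw [key, Submodule.map_top, Submodule.range_subtype]

theorem exists_highestWeight : ∃ T : schurTensor, T ≠ 0 ∧ ∀ (g : Spin) (hg : g • x₀ = x₀),
    (leviMatrix g).BlockTriangular id →
      (schurBundle.act g hg T : schurTensor) = (∏ i, leviMatrix g i i ^ (ω₁ + ω₂) i) • T := by
  -- The highest weight vector is `e_0 ⊗ (e_0 ∧ e_1)`. An upper triangular matrix scales `e_0` and
  -- adds to a multiple of `e_1` only a multiple of `e_0`, which the wedge removes. The weight is
  -- `(2, 1, 0, 0, 0)`.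
  refine ⟨⟨_, wedgeTensor_mem (Pi.single 0 1) (Pi.single 1 1)⟩, fun h => ?_, fun g hg hA => ?_⟩
  · have := congrFun (congrFun (congrFun (congrArg Subtype.val h) 0) 0) 1
    simp [wedgeTensor] at this
  · have hlt : ∀ i j, j < i → leviMatrix g i j = 0 := fun i j hij => hA hij
    have h0 : leviMatrix g *ᵥ Pi.single 0 1 = leviMatrix g 0 0 • Pi.single 0 1 := by
      ext i
      fin_cases i <;> simp [hlt]
    have h1 : leviMatrix g *ᵥ Pi.single 1 1 =
        leviMatrix g 0 1 • Pi.single 0 1 + leviMatrix g 1 1 • Pi.single 1 1 := by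
      ext i
      fin_cases i <;> simp [hlt]
    rw [schurBundle_act]
    refine Subtype.ext ?_
    change tensorAct (leviMatrix g) _ = (∏ i, leviMatrix g i i ^ (ω₁ + ω₂) i) • wedgeTensor _ _ _
    rw [tensorAct_wedgeTensor, h0, h1]
    funext a b c
    simp [wedgeTensor, Fin.prod_univ_five, ω₁, ω₂]
    ring

theorem schurBundle_isIrreducible : schurBundle.IsIrreducibleOfWeight (ω₁ + ω₂) where
  nontrivial := by
    obtain ⟨T, hT, _⟩ := exists_highestWeight
    exact ⟨T, 0, hT⟩
  irreducible := schurBundle_irreducible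
  highestWeight := exists_highestWeight

/-! ### The maps of the complex, as morphisms of equivariant bundles -/

theorem EquivariantBundle.tensor_hom_ext {E F : EquivariantBundle} {x : X} {A : Type}
    [AddCommGroup A] [Module ℂ A] {f k : (E.tensor F).Fiber x →ₗ[ℂ] A}
    (h : ∀ (a : E.Fiber x) (b : F.Fiber x), f (tmul a b) = k (tmul a b))
    (v : (E.tensor F).Fiber x) :
    f v = k v :=
  LinearMap.congr_fun (TensorProduct.ext' h) v

theorem EquivariantBundle.act_tmul {E F : EquivariantBundle} (g : Spin) {x y : X} (h : g • x = y)
    (a : E.Fiber x) (b : F.Fiber x) :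
    (E.tensor F).act g h (tmul a b) = tmul (E.act g h a) (F.act g h b) := rfl

/-- `U₀` annihilates its pure spinors, so the choice of representative in `V` does not matter. -/
theorem cliffordAction_ofDual (v : V) {s : S} (hs : s ∈ spinorLine x₀) :
    cliffordAction (ofDual (toDual x₀ v)) s = cliffordAction v s := by
  have h : v = (0, v.2) + (v.1, 0) := by simp
  conv_rhs => rw [h]
  rw [ofDual_toDual, map_add, LinearMap.add_apply, hs (v.1, 0) ((mem_space_base _).2 rfl), add_zero]

theorem cliffordAction_ofDual_one (θ : Dual ℂ x₀.space) :
    cliffordAction (ofDual θ) 1 = ExteriorAlgebra.ι ℂ (ofDual θ).2 := by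
  rw [ofDual_apply, cliffordAction_apply]
  simp

theorem cliffordAction_ofDual_mem (θ : Dual ℂ x₀.space) {s : S} (hs : s ∈ spinorLine x₀) :
    cliffordAction (ofDual θ) s ∈ halfSpin 1 := by
  obtain ⟨c, rfl⟩ := exists_eq_smul_one hs
  rw [map_smul, cliffordAction_ofDual_one]
  exact Submodule.smul_mem _ _ (ι_mem_evenOdd_one _ _)

/-- The Clifford multiplication `U₀ᵛ ⊗ ℓ → S⁻`, for the line `ℓ` of pure spinors of `U₀`. -/
def spinorMapBase : Dual ℂ x₀.space ⊗[ℂ] spinorLine x₀ →ₗ[ℂ] halfSpin 1 :=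
  (TensorProduct.lift ((cliffordAction ∘ₗ ofDual).compl₂ (spinorLine x₀).subtype)).codRestrict
    (halfSpin 1) fun τ => by
      induction τ with
      | zero => rw [map_zero]; exact zero_mem _
      | tmul θ s => exact cliffordAction_ofDual_mem θ s.2
      | add a b ha hb => rw [map_add]; exact add_mem ha hb

theorem spinorMapBase_tmul (θ : Dual ℂ x₀.space) (s : spinorLine x₀) :
    (spinorMapBase (θ ⊗ₜ s) : S) = cliffordAction (ofDual θ) s := rfl

theorem exists_eq_tmul_one (τ : Dual ℂ x₀.space ⊗[ℂ] spinorLine x₀) :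
    ∃ θ : Dual ℂ x₀.space, τ = θ ⊗ₜ ⟨1, one_mem_spinorLine⟩ := by
  induction τ with
  | zero => exact ⟨0, by simp⟩
  | tmul θ s =>
    obtain ⟨c, hc⟩ := exists_eq_smul_one s.2
    refine ⟨c • θ, ?_⟩
    rw [TensorProduct.smul_tmul]
    congr 1
    exact Subtype.ext hc
  | add a b ha hb =>
    obtain ⟨θ, rfl⟩ := ha
    obtain ⟨θ', rfl⟩ := hb
    exact ⟨θ + θ', by rw [TensorProduct.add_tmul]⟩

theorem spinorMapBase_injective : Function.Injective spinorMapBase := by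
  rw [injective_iff_map_eq_zero]
  intro τ hτ
  obtain ⟨θ, rfl⟩ := exists_eq_tmul_one τ
  have h := congrArg Subtype.val hτ
  rw [spinorMapBase_tmul, cliffordAction_ofDual_one] at h
  have h2 : (ofDual θ).2 = 0 := (ExteriorAlgebra.ι_eq_zero_iff _).1 h
  rw [← toDual_ofDual θ, ofDual_apply, h2, Prod.mk_zero_zero, map_zero, TensorProduct.zero_tmul]

theorem spinorMapBase_equivariant (g : Spin) (hg : g • x₀ = x₀)
    (τ : (taut.dual.tensor lineBundle).Fiber x₀) :
    (halfSpinBundle 1).act g hg (spinorMapBase τ) =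
      (spinorMapBase ((taut.dual.tensor lineBundle).act g hg τ) : (halfSpinBundle 1).Fiber x₀) := by
  let f : (taut.dual.tensor lineBundle).Fiber x₀ →ₗ[ℂ] (halfSpinBundle 1).Fiber x₀ := spinorMapBase
  refine EquivariantBundle.tensor_hom_ext (f := (halfSpinBundle 1).act g hg ∘ₗ f)
    (k := f ∘ₗ (taut.dual.tensor lineBundle).act g hg) (fun θ s => ?_) τ
  obtain ⟨v, rfl⟩ := toDual_base_surjective θ
  have h : taut.dual.act g hg (toDual x₀ v) = toDual x₀ (vecRep g v) := act_toDual g hg v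
  refine Subtype.ext ?_
  change spinRep g (cliffordAction (ofDual (toDual x₀ v)) s.1) =
    cliffordAction (ofDual (taut.dual.act g hg (toDual x₀ v))) (lineBundle.act g hg s).1
  rw [h, cliffordAction_ofDual _ (lineBundle.act g hg s).2, cliffordAction_ofDual _ s.2,
    ← cliffordAction_spinRep]
  rfl

/-- The morphism `i : 𝒰ᵛ(-1) → S⁻ ⊗ 𝒪` of Clifford multiplication. -/
def spinorMap : (taut.dual.negTwist 1).Hom (halfSpinBundle 1) :=
  EquivariantBundle.Hom.ofBase (E := taut.dual.negTwist 1) (F := halfSpinBundle 1) spinorMapBase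
    fun g hg τ => (spinorMapBase_equivariant g hg τ).symm

theorem spinorMap_app_base : spinorMap.app x₀ = spinorMapBase :=
  EquivariantBundle.Hom.ofBase_app _ _

theorem spinorVal_spinorMap_base (τ : Dual ℂ x₀.space ⊗[ℂ] spinorLine x₀) :
    spinorVal (spinorMap.app x₀ τ) = spinorMapBase τ := by
  rw [spinorMap_app_base]
  rfl

theorem spinorMap_tmul (x : X) (v : V) (s : spinorLine x) :
    spinorVal (spinorMap.app x (EquivariantBundle.tmul (E := taut.dual) (F := lineBundle)
      (toDual x v) s)) = cliffordAction v s := by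
  obtain ⟨g, hg⟩ := x.exists_smul
  obtain ⟨s, rfl⟩ := EquivariantBundle.act_surjective (E := lineBundle) g hg s
  have hv : v = vecRep g (vecRep g⁻¹ v) := by simp
  have e : EquivariantBundle.tmul (E := taut.dual) (F := lineBundle) (toDual x v)
      (lineBundle.act g hg s) = (taut.dual.negTwist 1).act g hg
        (EquivariantBundle.tmul (E := taut.dual) (F := lineBundle)
          (toDual x₀ (vecRep g⁻¹ v)) s) := by
    conv_lhs => rw [hv, ← act_toDual g hg]
    rfl
  have h := spinorMap.equivariant g hg (EquivariantBundle.tmul (E := taut.dual) (F := lineBundle)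
    (toDual x₀ (vecRep g⁻¹ v)) s)
  rw [← e] at h
  rw [h]
  refine (congrArg (spinRep g)
    (spinorVal_spinorMap_base (toDual x₀ (vecRep g⁻¹ v) ⊗ₜ[ℂ] s))).trans ?_
  change spinRep g (cliffordAction (ofDual (toDual x₀ (vecRep g⁻¹ v))) s.1) =
    cliffordAction v (spinRep g s.1)
  rw [cliffordAction_ofDual _ s.2, ← cliffordAction_spinRep, ← hv]

theorem spinorMap_injective (x : X) : Function.Injective (spinorMap.app x) :=
  spinorMap.injective_of_base (by
    rw [spinorMap_app_base]
    exact spinorMapBase_injective) x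

/-- The fibre of the morphism `ξ ∘ (i ⊗ id)`. -/
def wedgeMapAt (x : X) : ((taut.dual.negTwist 1).tensor (halfSpinBundle 0)).Fiber x →ₗ[ℂ]
    (vecBundle.extPow 2).Fiber x :=
  TensorProduct.lift (cliffordMapHom.compl₁₂ ((halfSpin 1).subtype ∘ₗ spinorMap.app x)
    (halfSpin 0).subtype)

theorem wedgeMapAt_tmul (x : X) (τ : (taut.dual.negTwist 1).Fiber x)
    (s : (halfSpinBundle 0).Fiber x) : wedgeMapAt x (EquivariantBundle.tmul τ s) =
      cliffordMap (spinorVal (spinorMap.app x τ)) (spinorVal s) := rfl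

/-- The morphism `ξ ∘ (i ⊗ id) : 𝒰ᵛ(-1) ⊗ S⁺ → ⋀² V ⊗ 𝒪`. -/
def toWedge : ((taut.dual.negTwist 1).tensor (halfSpinBundle 0)).Hom (vecBundle.extPow 2) :=
  EquivariantBundle.Hom.ofEquivariant wedgeMapAt fun g x y h v =>
    EquivariantBundle.tensor_hom_ext
      (f := wedgeMapAt y ∘ₗ ((taut.dual.negTwist 1).tensor (halfSpinBundle 0)).act g h)
      (k := (vecBundle.extPow 2).act g h ∘ₗ wedgeMapAt x) (fun τ s => by
        rw [LinearMap.comp_apply, LinearMap.comp_apply, EquivariantBundle.act_tmul,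
          wedgeMapAt_tmul, wedgeMapAt_tmul, spinorMap.equivariant]
        exact cliffordMap_spinRep g _ _) v

theorem toWedge_tmul (x : X) (τ : (taut.dual.negTwist 1).Fiber x)
    (s : (halfSpinBundle 0).Fiber x) : toWedge.app x (EquivariantBundle.tmul τ s) =
      cliffordMap (spinorVal (spinorMap.app x τ)) (spinorVal s) := rfl

/-- The projection `⋀² V ⊗ 𝒪 → ⋀² 𝒰ᵛ`. -/
def wedgeProj : (vecBundle.extPow 2).Hom (taut.dual.extPow 2) :=
  EquivariantBundle.Hom.ofEquivariant (E := vecBundle.extPow 2) (F := taut.dual.extPow 2)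
    (fun x => exteriorPower.map 2 (toDual x)) (by
      intro g x y h ω
      let L : Dual ℂ x.space →ₗ[ℂ] Dual ℂ y.space := taut.dual.act g h
      have e : toDual y ∘ₗ vecRep g = L ∘ₗ toDual x :=
        LinearMap.ext fun v => (act_toDual g h v).symm
      change (exteriorPower.map 2 (toDual y) ∘ₗ exteriorPower.map 2 (vecRep g)) ω =
        (exteriorPower.map 2 L ∘ₗ exteriorPower.map 2 (toDual x)) ω
      rw [← exteriorPower.map_comp, e, exteriorPower.map_comp])

/-- This translates the morphism at `x₀` into the map `W ⊗ S⁺ → ⋀² V` that was computed above. -/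
theorem toWedge_base_tmul_one (θ : Dual ℂ x₀.space) (s : halfSpin 0) :
    toWedge.app x₀ (EquivariantBundle.tmul (E := taut.dual.negTwist 1) (F := halfSpinBundle 0)
      (EquivariantBundle.tmul (E := taut.dual) (F := lineBundle) θ
        (⟨1, one_mem_spinorLine⟩ : spinorLine x₀)) s) =
      cliffordMap (ExteriorAlgebra.ι ℂ (ofDual θ).2) s.1 := by
  rw [← cliffordAction_ofDual_one]
  exact (toWedge_tmul x₀ _ s).trans
    (congrArg (fun t => cliffordMap t s.1) (spinorVal_spinorMap_base _))

theorem toWedge_wedgeProj_exact (x : X) : Function.Exact (toWedge.app x) (wedgeProj.app x) := by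
  refine EquivariantBundle.Hom.exact_of_base toWedge wedgeProj (fun ω => ⟨fun hω => ?_, ?_⟩) x
  · have h := mem_cliffordRange hω
    refine Submodule.span_le (p := LinearMap.range (toWedge.app x₀)) |>.2 ?_ h
    rintro _ ⟨w, s, hs, rfl⟩
    exact ⟨_, (toWedge_base_tmul_one (toDual x₀ (0, w)) ⟨s, hs⟩).trans (by rw [ofDual_toDual])⟩
  · rintro ⟨τ, rfl⟩
    refine EquivariantBundle.tensor_hom_ext (f := wedgeProj.app x₀ ∘ₗ toWedge.app x₀) (k := 0)
      (fun τ s => ?_) τ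
    obtain ⟨θ, rfl⟩ := exists_eq_tmul_one τ
    exact (congrArg (wedgeProj.app x₀) (toWedge_base_tmul_one θ s)).trans (toDual_cliffordMap _ _)

theorem wedgeProj_surjective (x : X) : Function.Surjective (wedgeProj.app x) :=
  wedgeProj.surjective_of_base (exteriorPower.map_surjective toDual_base_surjective) x

/-! ### The action of the stabilizer on spinors of degree at most two -/

theorem skewPart_ι_mul_ι (x y : W) (i j : Fin 5) :
    skewPart (ExteriorAlgebra.ι ℂ x * ExteriorAlgebra.ι ℂ y) i j = x i * y j - x j * y i := by
  rw [skewPart_apply, exterior_contractLeft_ι_mul, exterior_contractLeft_ι,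
    map_sub, map_smul, exterior_contractLeft_ι, ← Algebra.commutes, ← Algebra.smul_def, map_smul,
    exterior_contractLeft_ι]
  simp only [map_sub, map_smul, coordW_apply, AlgHom.commutes, smul_eq_mul,
    Algebra.algebraMap_self, RingHom.id_apply]
  ring

theorem exists_spinRep_one {g : Spin} (hg : g • x₀ = x₀) :
    ∃ χ : ℂ, spinRep g (1 : S) = χ • (1 : S) := by
  refine exists_eq_smul_one ?_
  exact (lineBundle.act g hg (⟨1, one_mem_spinorLine⟩ : spinorLine x₀)).2

/-- Here `e_a e_b` is obtained from `1` by Clifford action of two vectors, which `g` moves. The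
scalar comes from contraction with the `U₀` component of `g e_a`; it disappears modulo degree zero.
-/
theorem spinRep_basisSpinor_mul {g : Spin} {χ : ℂ} (hχ : spinRep g (1 : S) = χ • (1 : S))
    (a b : Fin 5) : ∃ c : ℂ, spinRep g (basisSpinor a * basisSpinor b) =
      algebraMap ℂ S c + χ • (ExteriorAlgebra.ι ℂ (vecRep g (0, Pi.single a 1)).2 *
        ExteriorAlgebra.ι ℂ (vecRep g (0, Pi.single b 1)).2) := by
  have h : basisSpinor a * basisSpinor b =
      cliffordAction (0, Pi.single a 1) (cliffordAction (0, Pi.single b 1) 1) := by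
    simp [cliffordAction_apply, basisSpinor]
  refine ⟨χ * (vecRep g (0, Pi.single a 1)).1 (vecRep g (0, Pi.single b 1)).2, ?_⟩
  rw [h, ← cliffordAction_spinRep, ← cliffordAction_spinRep, hχ, map_smul, map_smul]
  have h1 : cliffordAction (vecRep g (0, Pi.single b 1)) 1 =
      ExteriorAlgebra.ι ℂ (vecRep g (0, Pi.single b 1)).2 := by
    rw [cliffordAction_apply]
    simp
  rw [h1, cliffordAction_apply, exterior_contractLeft_ι, smul_add, map_mul, Algebra.smul_def]

theorem skewPart_spinRep {g : Spin} {χ : ℂ} (hχ : spinRep g (1 : S) = χ • (1 : S)) (c : ℂ)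
    {T : Fin 5 → Fin 5 → ℂ} (hT : ∀ i j, T j i = -T i j) (i j : Fin 5) :
    skewPart (spinRep g (algebraMap ℂ S c + ofSkew T)) i j =
      χ * ∑ a, ∑ b, leviMatrix g i a * leviMatrix g j b * T a b := by
  have h1 : skewPart (spinRep g (algebraMap ℂ S c)) = 0 := by
    rw [Algebra.algebraMap_eq_smul_one, map_smul, hχ, smul_smul, ← Algebra.algebraMap_eq_smul_one,
      skewPart_algebraMap]
  have h2 : ∀ a b, skewPart (spinRep g (basisSpinor a * basisSpinor b)) i j =
      χ * (leviMatrix g i a * leviMatrix g j b - leviMatrix g j a * leviMatrix g i b) := by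
    intro a b
    obtain ⟨r, hr⟩ := spinRep_basisSpinor_mul hχ a b
    rw [hr, map_add, skewPart_algebraMap, zero_add, map_smul, Pi.smul_apply, Pi.smul_apply,
      skewPart_ι_mul_ι]
    rfl
  have h3 : ∑ a, ∑ b, leviMatrix g j a * leviMatrix g i b * T a b =
      -∑ a, ∑ b, leviMatrix g i a * leviMatrix g j b * T a b := by
    rw [Finset.sum_comm, ← Finset.sum_neg_distrib]
    refine Finset.sum_congr rfl fun a _ => ?_
    rw [← Finset.sum_neg_distrib]
    refine Finset.sum_congr rfl fun b _ => ?_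
    rw [hT a b]
    ring
  rw [map_add, map_add, h1, zero_add, ofSkew]
  simp only [map_smul, map_sum, Pi.smul_apply, Finset.sum_apply, h2, smul_eq_mul]
  have h4 : ∑ a, ∑ b, T a b * (χ * (leviMatrix g i a * leviMatrix g j b -
      leviMatrix g j a * leviMatrix g i b)) =
      χ * (∑ a, ∑ b, leviMatrix g i a * leviMatrix g j b * T a b -
        ∑ a, ∑ b, leviMatrix g j a * leviMatrix g i b * T a b) := by
    simp only [← Finset.sum_sub_distrib, Finset.mul_sum]
    exact Finset.sum_congr rfl fun a _ => Finset.sum_congr rfl fun b _ => by ring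
  rw [h4, h3]
  ring

theorem ofSkew_mem_halfSpin (T : Fin 5 → Fin 5 → ℂ) : ofSkew T ∈ halfSpin 0 :=
  Submodule.smul_mem _ _ (sum_mem fun _ _ => sum_mem fun _ _ => Submodule.smul_mem _ _
    (ι_mul_ι_mem_evenOdd_zero _ _ _))

theorem spinorLine_base_le : spinorLine x₀ ≤ halfSpin 0 := by
  intro s hs
  obtain ⟨c, rfl⟩ := exists_eq_smul_one hs
  exact Submodule.smul_mem _ _ (Submodule.one_le.1 (one_le_evenOdd_zero _))

/-! ### The tensor of an element of `U₀ᵛ ⊗ ℓ ⊗ S⁺` -/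

/-- The generator of the line `ℓ` of pure spinors of `U₀`. -/
def lineOne : spinorLine x₀ := ⟨1, one_mem_spinorLine⟩

/-- The identification of `U₀ᵛ ⊗ ℓ` with `W`. -/
def twistCoord : Dual ℂ x₀.space ⊗[ℂ] spinorLine x₀ →ₗ[ℂ] W :=
  ExteriorAlgebra.ιInv ∘ₗ (halfSpin 1).subtype ∘ₗ spinorMapBase

theorem twistCoord_tmul_one (θ : Dual ℂ x₀.space) : twistCoord (θ ⊗ₜ lineOne) = (ofDual θ).2 := by
  change ExteriorAlgebra.ιInv (spinorMapBase (θ ⊗ₜ lineOne) : S) = _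
  rw [spinorMapBase_tmul, lineOne, cliffordAction_ofDual_one]
  exact ExteriorAlgebra.ι_leftInverse _

theorem twistCoord_dualVec (k : Fin 5) : twistCoord (dualVec k ⊗ₜ lineOne) = Pi.single k 1 := by
  rw [twistCoord_tmul_one, dualVec, ofDual_toDual]

/-- The tensor in `W ⊗ ⋀² W` of an element of `U₀ᵛ ⊗ ℓ ⊗ S⁺`. -/
def tensorPart : (Dual ℂ x₀.space ⊗[ℂ] spinorLine x₀) ⊗[ℂ] halfSpin 0 →ₗ[ℂ]
    (Fin 5 → Fin 5 → Fin 5 → ℂ) :=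
  TensorProduct.lift (LinearMap.mk₂ ℂ (fun τ s k => twistCoord τ k • skewPart s.1)
    (fun τ τ' s => by funext k; simp [add_smul])
    (fun c τ s => by funext k; simp [mul_smul])
    (fun τ s s' => by funext k; simp)
    (fun c τ s => by funext k; simp [smul_comm c]))

theorem tensorPart_tmul (τ : Dual ℂ x₀.space ⊗[ℂ] spinorLine x₀) (s : halfSpin 0) (k : Fin 5) :
    tensorPart (τ ⊗ₜ s) k = twistCoord τ k • skewPart s.1 := rfl

/-- The element of `U₀ᵛ ⊗ ℓ ⊗ S⁺` with given coordinates. -/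
def spinorSum (s : Fin 5 → halfSpin 0) : (Dual ℂ x₀.space ⊗[ℂ] spinorLine x₀) ⊗[ℂ] halfSpin 0 :=
  ∑ k, (dualVec k ⊗ₜ lineOne) ⊗ₜ s k

theorem exists_eq_spinorSum (v : (Dual ℂ x₀.space ⊗[ℂ] spinorLine x₀) ⊗[ℂ] halfSpin 0) :
    ∃ s, v = spinorSum s := by
  induction v with
  | zero => exact ⟨0, by simp [spinorSum]⟩
  | tmul τ s =>
    obtain ⟨θ, rfl⟩ := exists_eq_tmul_one τ
    obtain ⟨v, rfl⟩ := toDual_base_surjective θ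
    refine ⟨fun k => v.2 k • s, ?_⟩
    rw [toDual_base, TensorProduct.sum_tmul, TensorProduct.sum_tmul]
    refine Finset.sum_congr rfl fun k _ => ?_
    rw [← TensorProduct.smul_tmul', TensorProduct.smul_tmul]
    rfl
  | add a b ha hb =>
    obtain ⟨s, rfl⟩ := ha
    obtain ⟨s', rfl⟩ := hb
    exact ⟨s + s', by simp [spinorSum, TensorProduct.tmul_add, Finset.sum_add_distrib]⟩

theorem tensorPart_spinorSum (s : Fin 5 → halfSpin 0) (k : Fin 5) :
    tensorPart (spinorSum s) k = skewPart (s k).1 := by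
  simp only [spinorSum, map_sum, Finset.sum_apply, tensorPart_tmul, twistCoord_dualVec,
    Pi.single_apply]
  simp

theorem toWedge_spinorSum (s : Fin 5 → halfSpin 0) :
    toWedge.app x₀ (spinorSum s) = ∑ k, cliffordMap (basisSpinor k) (s k).1 := by
  have h : ∀ k, toWedge.app x₀ ((dualVec k ⊗ₜ[ℂ] lineOne : Dual ℂ x₀.space ⊗[ℂ] spinorLine x₀) ⊗ₜ[ℂ]
      s k) = cliffordMap (basisSpinor k) (s k).1 := by
    intro k
    refine (toWedge_base_tmul_one (dualVec k) (s k)).trans ?_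
    rw [dualVec, ofDual_toDual]
    rfl
  exact (map_sum (toWedge.app x₀) _ _).trans (Finset.sum_congr rfl fun k _ => h k)

theorem spinorSum_mem_ker {s : Fin 5 → halfSpin 0} (h : toWedge.app x₀ (spinorSum s) = 0) :
    (fun k => skewPart (s k).1) ∈ schurTensor ∧
      ∀ k, ∃ c : ℂ, (s k).1 = algebraMap ℂ S c + ofSkew (skewPart (s k).1) :=
  sum_cliffordMap_eq_zero (fun k => (s k).2) ((toWedge_spinorSum s).symm.trans h)

/-! ### The kernel bundle -/

theorem EquivariantBundle.finiteDimensional_fiber (E : EquivariantBundle) (x : X) :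
    FiniteDimensional ℂ (E.Fiber x) := by
  obtain ⟨e, _, hx⟩ := E.cover x
  exact Module.Finite.of_basis (e.basis x hx)

/-- The fibre of the kernel of `ξ ∘ (i ⊗ id)` at the base point. -/
def kernelBase : Submodule ℂ (((taut.dual.negTwist 1).tensor (halfSpinBundle 0)).Fiber x₀) :=
  LinearMap.ker (toWedge.app x₀)

instance : FiniteDimensional ℂ kernelBase :=
  have := ((taut.dual.negTwist 1).tensor (halfSpinBundle 0)).finiteDimensional_fiber x₀
  FiniteDimensional.finiteDimensional_submodule _

theorem act_mem_kernelBase (g : Spin) (hg : g • x₀ = x₀)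
    {v : ((taut.dual.negTwist 1).tensor (halfSpinBundle 0)).Fiber x₀} (hv : v ∈ kernelBase) :
    ((taut.dual.negTwist 1).tensor (halfSpinBundle 0)).act g hg v ∈ kernelBase := by
  rw [kernelBase, LinearMap.mem_ker] at hv ⊢
  rw [toWedge.equivariant, hv, map_zero]

/-- The action of the stabilizer on the fibre of the kernel. -/
def kernelRep : EquivariantBundle.FiberRep kernelBase
    ((taut.dual.negTwist 1).tensor (halfSpinBundle 0)) where
  rep g hg := (((taut.dual.negTwist 1).tensor (halfSpinBundle 0)).act g hg).restrict
    fun _ hv => act_mem_kernelBase g hg hv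
  emb := kernelBase.subtype
  injective := Subtype.val_injective
  emb_rep _ _ _ := rfl

/-- The kernel `R₅` of `ξ ∘ (i ⊗ id)`. -/
def kernelBundle : EquivariantBundle := kernelRep.bundle

theorem kernelBundle_act (g : Spin) (hg : g • x₀ = x₀) (v : kernelBase) :
    (kernelBundle.act g hg v : kernelBase) =
      ⟨((taut.dual.negTwist 1).tensor (halfSpinBundle 0)).act g hg v.1,
        act_mem_kernelBase g hg v.2⟩ :=
  kernelRep.bundle_act_base g hg v

/-- The inclusion of the kernel. -/
def kernelIncl : kernelBundle.Hom ((taut.dual.negTwist 1).tensor (halfSpinBundle 0)) :=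
  EquivariantBundle.Hom.ofBase (E := kernelBundle) kernelBase.subtype
    fun g hg v => congrArg Subtype.val (kernelBundle_act g hg v)

theorem kernelIncl_app_base : kernelIncl.app x₀ = kernelBase.subtype :=
  EquivariantBundle.Hom.ofBase_app _ _

theorem kernelIncl_injective (x : X) : Function.Injective (kernelIncl.app x) :=
  kernelIncl.injective_of_base (by
    rw [kernelIncl_app_base]
    exact Subtype.val_injective) x

theorem kernelIncl_toWedge_exact (x : X) :
    Function.Exact (kernelIncl.app x) (toWedge.app x) := by
  refine EquivariantBundle.Hom.exact_of_base kernelIncl toWedge ?_ x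
  rw [kernelIncl_app_base]
  exact LinearMap.exact_subtype_ker_map _

/-! ### The subbundle `𝒰ᵛ(-2)` of the kernel -/

/-- The inclusion of `U₀ᵛ ⊗ ℓ ⊗ ℓ` in `U₀ᵛ ⊗ ℓ ⊗ S⁺`. -/
def twistIncl : (Dual ℂ x₀.space ⊗[ℂ] spinorLine x₀) ⊗[ℂ] spinorLine x₀ →ₗ[ℂ]
    (Dual ℂ x₀.space ⊗[ℂ] spinorLine x₀) ⊗[ℂ] halfSpin 0 :=
  (Submodule.inclusion spinorLine_base_le).lTensor _

theorem twistIncl_injective : Function.Injective twistIncl :=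
  Module.Flat.lTensor_preserves_injective_linearMap _ (Submodule.inclusion_injective _)

theorem exists_eq_tmul_lineOne {M : Type} [AddCommMonoid M] [Module ℂ M]
    (τ : M ⊗[ℂ] spinorLine x₀) : ∃ m : M, τ = m ⊗ₜ lineOne := by
  induction τ with
  | zero => exact ⟨0, by simp⟩
  | tmul m s =>
    obtain ⟨c, hc⟩ := exists_eq_smul_one s.2
    refine ⟨c • m, ?_⟩
    rw [TensorProduct.smul_tmul]
    congr 1
    exact Subtype.ext hc
  | add a b ha hb =>
    obtain ⟨m, rfl⟩ := ha
    obtain ⟨m', rfl⟩ := hb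
    exact ⟨m + m', by rw [TensorProduct.add_tmul]⟩

theorem tmul_lineOne_injective (M : Type) [AddCommMonoid M] [Module ℂ M] :
    Function.Injective fun m : M => m ⊗ₜ[ℂ] lineOne := by
  refine Function.LeftInverse.injective (g := TensorProduct.rid ℂ M ∘ₗ
    (scalarPart.toLinearMap ∘ₗ (spinorLine x₀).subtype).lTensor M) fun m => ?_
  simp [lineOne]

theorem twistIncl_mem (τ : (Dual ℂ x₀.space ⊗[ℂ] spinorLine x₀) ⊗[ℂ] spinorLine x₀) :
    twistIncl τ ∈ kernelBase := by
  obtain ⟨τ', rfl⟩ := exists_eq_tmul_lineOne τ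
  obtain ⟨θ, rfl⟩ := exists_eq_tmul_one τ'
  exact (toWedge_base_tmul_one θ _).trans (cliffordMap_ι_one _)

/-- The inclusion of `𝒰ᵛ(-2)` in the kernel, at the base point. -/
def subIncl : (taut.dual.negTwist 2).Fiber x₀ →ₗ[ℂ] kernelBase :=
  LinearMap.codRestrict kernelBase twistIncl twistIncl_mem

theorem subIncl_equivariant (g : Spin) (hg : g • x₀ = x₀) (τ : (taut.dual.negTwist 2).Fiber x₀) :
    subIncl ((taut.dual.negTwist 2).act g hg τ) =
      (kernelBundle.act g hg (subIncl τ) : kernelBase) := by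
  rw [kernelBundle_act]
  refine Subtype.ext ?_
  let f : ((taut.dual.negTwist 1).tensor lineBundle).Fiber x₀ →ₗ[ℂ]
    ((taut.dual.negTwist 1).tensor (halfSpinBundle 0)).Fiber x₀ := twistIncl
  exact EquivariantBundle.tensor_hom_ext
    (f := f ∘ₗ ((taut.dual.negTwist 1).tensor lineBundle).act g hg)
    (k := ((taut.dual.negTwist 1).tensor (halfSpinBundle 0)).act g hg ∘ₗ f) (fun a b => rfl) τ

/-- The morphism `𝒰ᵛ(-2) → R₅`. -/
def subHom : (taut.dual.negTwist 2).Hom kernelBundle :=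
  EquivariantBundle.Hom.ofBase (F := kernelBundle) subIncl subIncl_equivariant

theorem subHom_app_base : subHom.app x₀ = subIncl := EquivariantBundle.Hom.ofBase_app _ _

theorem subHom_injective (x : X) : Function.Injective (subHom.app x) :=
  subHom.injective_of_base (by
    rw [subHom_app_base]
    exact fun a b h => twistIncl_injective (congrArg Subtype.val h)) x

/-! ### The quotient bundle of the kernel -/

theorem tensorPart_mem (v : kernelBase) : tensorPart v.1 ∈ schurTensor := by
  obtain ⟨v, hv⟩ := v
  obtain ⟨s, rfl⟩ := exists_eq_spinorSum v
  have h := (spinorSum_mem_ker hv).1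
  have e : tensorPart (spinorSum s) = fun k => skewPart (s k).1 := funext (tensorPart_spinorSum s)
  rwa [← e] at h

/-- The projection of the kernel to the Schur module, at the base point. -/
def kernelTensor : kernelBase →ₗ[ℂ] schurTensor :=
  LinearMap.codRestrict schurTensor (tensorPart ∘ₗ kernelBase.subtype) tensorPart_mem

theorem kernelTensor_surjective : Function.Surjective kernelTensor := by
  intro T
  let s : Fin 5 → halfSpin 0 := fun k => ⟨ofSkew (T.1 k), ofSkew_mem_halfSpin _⟩
  refine ⟨⟨spinorSum s, (toWedge_spinorSum s).trans (sum_cliffordMap_ofSkew T.2)⟩,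
    Subtype.ext (funext fun k => (tensorPart_spinorSum s k).trans ?_)⟩
  exact skewPart_ofSkew _ fun i j => T.2.1 k i j

/-- Elements of the kernel have no part of degree four. If the part of degree two also vanishes, the
coefficients are scalars, that is, elements of `ℓ`. -/
theorem exists_twistIncl_eq {v : kernelBase} (hv : kernelTensor v = 0) : ∃ τ, subIncl τ = v := by
  obtain ⟨v, hv'⟩ := v
  obtain ⟨s, rfl⟩ := exists_eq_spinorSum v
  have h : ∀ k, ∃ c : ℂ, (s k).1 = c • (1 : S) := by
    intro k
    obtain ⟨c, hc⟩ := (spinorSum_mem_ker hv').2 k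
    have h0 : skewPart (s k).1 = 0 := by
      rw [← tensorPart_spinorSum]
      exact congrFun (congrArg Subtype.val hv) k
    refine ⟨c, ?_⟩
    rw [hc, h0, Algebra.algebraMap_eq_smul_one]
    simp [ofSkew]
  choose c hc using h
  refine ⟨∑ k, (dualVec k ⊗ₜ[ℂ] lineOne : Dual ℂ x₀.space ⊗[ℂ] spinorLine x₀) ⊗ₜ[ℂ]
    (c k • lineOne), Subtype.ext ?_⟩
  refine (map_sum twistIncl _ _).trans (Finset.sum_congr rfl fun k _ => ?_)
  exact congrArg (fun t => (dualVec k ⊗ₜ[ℂ] lineOne : Dual ℂ x₀.space ⊗[ℂ] spinorLine x₀) ⊗ₜ[ℂ] t)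
    (Subtype.ext (hc k).symm : Submodule.inclusion spinorLine_base_le (c k • lineOne) = s k)

theorem kernelTensor_subIncl (τ : (Dual ℂ x₀.space ⊗[ℂ] spinorLine x₀) ⊗[ℂ] spinorLine x₀) :
    kernelTensor (subIncl τ) = 0 := by
  obtain ⟨τ', rfl⟩ := exists_eq_tmul_lineOne τ
  refine Subtype.ext (funext fun k => ?_)
  have h : skewPart (1 : S) = 0 := by simpa using skewPart_algebraMap 1
  change twistCoord τ' k • skewPart (1 : S) = 0
  rw [h, smul_zero]

/-- One factor `χ` comes from the line in `U₀ᵛ ⊗ ℓ`, the other from the action on spinors of degree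
two, which are obtained from `1 ∈ ℓ`. -/
theorem kernelTensor_act (g : Spin) (hg : g • x₀ = x₀) {χ : ℂ}
    (hχ : spinRep g (1 : S) = χ • (1 : S)) (v : kernelBase) :
    (kernelTensor (kernelBundle.act g hg v : kernelBase)).1 =
      (χ * χ) • tensorAct (leviMatrix g) (kernelTensor v).1 := by
  rw [kernelBundle_act]
  obtain ⟨v, hv⟩ := v
  obtain ⟨s, rfl⟩ := exists_eq_spinorSum v
  have hs := spinorSum_mem_ker hv
  have h1 : ∀ k, tensorPart (((taut.dual.negTwist 1).tensor (halfSpinBundle 0)).act g hg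
      ((dualVec k ⊗ₜ[ℂ] lineOne : Dual ℂ x₀.space ⊗[ℂ] spinorLine x₀) ⊗ₜ[ℂ] s k)) =
      fun i => (χ * leviMatrix g i k) • skewPart (spinRep g (s k).1) := by
    intro k
    have e1 : taut.dual.act g hg (dualVec k) = ∑ i, leviMatrix g i k • dualVec i :=
      act_dualVec g hg k
    have e2 : lineBundle.act g hg lineOne = χ • lineOne := Subtype.ext hχ
    have e3 : twistCoord ((∑ i, leviMatrix g i k • dualVec i) ⊗ₜ (χ • lineOne)) =
        fun i => χ * leviMatrix g i k := by
      rw [TensorProduct.tmul_smul, map_smul, TensorProduct.sum_tmul, map_sum]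
      simp only [← TensorProduct.smul_tmul', map_smul, twistCoord_dualVec]
      ext i
      simp [Pi.single_apply]
    funext i
    change twistCoord (taut.dual.act g hg (dualVec k) ⊗ₜ lineBundle.act g hg lineOne) i •
      skewPart (spinRep g (s k).1) = _
    rw [e1, e2, e3]
  have h2 : tensorPart (((taut.dual.negTwist 1).tensor (halfSpinBundle 0)).act g hg (spinorSum s)) =
      ∑ k, fun i => (χ * leviMatrix g i k) • skewPart (spinRep g (s k).1) := by
    rw [← Finset.sum_congr rfl fun k _ => h1 k]
    let L : (Dual ℂ x₀.space ⊗[ℂ] spinorLine x₀) ⊗[ℂ] halfSpin 0 →ₗ[ℂ]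
      (Dual ℂ x₀.space ⊗[ℂ] spinorLine x₀) ⊗[ℂ] halfSpin 0 :=
      ((taut.dual.negTwist 1).tensor (halfSpinBundle 0)).act g hg
    exact map_sum (tensorPart ∘ₗ L) (fun k => (dualVec k ⊗ₜ lineOne) ⊗ₜ s k) Finset.univ
  refine h2.trans (funext fun i => funext fun a => funext fun b => ?_)
  have h3 : ∀ k, skewPart (spinRep g (s k).1) a b = χ * ∑ p, ∑ q,
      leviMatrix g a p * leviMatrix g b q * skewPart (s k).1 p q := by
    intro k
    obtain ⟨c, hc⟩ := hs.2 k
    conv_lhs => rw [hc]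
    exact skewPart_spinRep hχ c (fun p q => skewPart_swap _ _ _) a b
  have h4 : (kernelTensor ⟨spinorSum s, hv⟩).1 = fun k => skewPart (s k).1 :=
    funext (tensorPart_spinorSum s)
  rw [h4]
  simp only [Finset.sum_apply, Pi.smul_apply, smul_eq_mul, h3, tensorAct_apply, Finset.mul_sum]
  exact Finset.sum_congr rfl fun k _ => Finset.sum_congr rfl fun p _ =>
    Finset.sum_congr rfl fun q _ => by ring

/-- The projection `R₅ → 𝒰_{ω₁ + ω₂}(-2)`, at the base point. -/
def quotMap : kernelBase →ₗ[ℂ] (schurTensor ⊗[ℂ] spinorLine x₀) ⊗[ℂ] spinorLine x₀ :=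
  (TensorProduct.mk ℂ _ _).flip lineOne ∘ₗ (TensorProduct.mk ℂ _ _).flip lineOne ∘ₗ kernelTensor

theorem quotMap_apply (v : kernelBase) :
    quotMap v = (kernelTensor v ⊗ₜ lineOne) ⊗ₜ lineOne := rfl

theorem quotMap_surjective : Function.Surjective quotMap := by
  intro τ
  obtain ⟨τ, rfl⟩ := exists_eq_tmul_lineOne τ
  obtain ⟨T, rfl⟩ := exists_eq_tmul_lineOne τ
  obtain ⟨v, rfl⟩ := kernelTensor_surjective T
  exact ⟨v, rfl⟩

theorem quotMap_eq_zero_iff (v : kernelBase) : quotMap v = 0 ↔ kernelTensor v = 0 := by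
  rw [quotMap_apply]
  refine ⟨fun h => ?_, fun h => by rw [h, TensorProduct.zero_tmul, TensorProduct.zero_tmul]⟩
  exact tmul_lineOne_injective _ (tmul_lineOne_injective _ (h.trans (by simp)))

/-- The factor `χ²` in `kernelTensor_act` is exactly the action on the two copies of `ℓ` in the
twist. -/
theorem quotMap_equivariant (g : Spin) (hg : g • x₀ = x₀) (v : kernelBase) :
    quotMap (kernelBundle.act g hg v : kernelBase) =
      ((schurBundle.negTwist 2).act g hg (quotMap v : (schurBundle.negTwist 2).Fiber x₀) :
        (schurTensor ⊗[ℂ] spinorLine x₀) ⊗[ℂ] spinorLine x₀) := by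
  obtain ⟨χ, hχ⟩ := exists_spinRep_one hg
  let T : schurTensor := schurBundle.act g hg (kernelTensor v)
  let l : spinorLine x₀ := lineBundle.act g hg lineOne
  have hl : l = χ • lineOne := Subtype.ext hχ
  have hT : T = ⟨tensorAct (leviMatrix g) (kernelTensor v).1, tensorAct_mem _ (kernelTensor v).2⟩ :=
    schurBundle_act g hg (kernelTensor v)
  have h : kernelTensor (kernelBundle.act g hg v : kernelBase) = (χ * χ) • T := by
    rw [hT]
    exact Subtype.ext (kernelTensor_act g hg hχ v)
  calc quotMap (kernelBundle.act g hg v : kernelBase)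
      = (((χ * χ) • T) ⊗ₜ lineOne) ⊗ₜ lineOne := congrArg (fun T => (T ⊗ₜ lineOne) ⊗ₜ lineOne) h
    _ = (T ⊗ₜ l) ⊗ₜ l := by
      rw [hl]
      simp only [TensorProduct.tmul_smul, ← TensorProduct.smul_tmul', smul_smul]
    _ = _ := rfl

/-- The morphism `R₅ → 𝒰_{ω₁ + ω₂}(-2)`. -/
def quotHom : kernelBundle.Hom (schurBundle.negTwist 2) :=
  EquivariantBundle.Hom.ofBase (E := kernelBundle) (F := schurBundle.negTwist 2) quotMap
    quotMap_equivariant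

theorem quotHom_app_base : quotHom.app x₀ = quotMap := EquivariantBundle.Hom.ofBase_app _ _

theorem quotHom_surjective (x : X) : Function.Surjective (quotHom.app x) :=
  quotHom.surjective_of_base (by
    rw [quotHom_app_base]
    exact quotMap_surjective) x

theorem subHom_quotHom_exact (x : X) : Function.Exact (subHom.app x) (quotHom.app x) := by
  refine EquivariantBundle.Hom.exact_of_base subHom quotHom ?_ x
  rw [quotHom_app_base, subHom_app_base]
  intro v
  refine (quotMap_eq_zero_iff v).trans ⟨exists_twistIncl_eq, ?_⟩
  rintro ⟨τ, rfl⟩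
  exact kernelTensor_subIncl τ

end SpinorTenfold

end

theorem mainTheorem5 :
    ∃ E R₅ : EquivariantBundle, E.IsIrreducibleOfWeight (ω₁ + ω₂) ∧
      (∃ (α : (taut.dual.negTwist 2).Hom R₅) (β : R₅.Hom (E.negTwist 2)), ∀ x : X,
        Function.Injective (α.app x) ∧ Function.Exact (α.app x) (β.app x) ∧
          Function.Surjective (β.app x)) ∧
      ∃ (i : (taut.dual.negTwist 1).Hom (halfSpinBundle 1))
        (κ : R₅.Hom ((taut.dual.negTwist 1).tensor (halfSpinBundle 0)))
        (φ : ((taut.dual.negTwist 1).tensor (halfSpinBundle 0)).Hom (vecBundle.extPow 2))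
        (π : (vecBundle.extPow 2).Hom (taut.dual.extPow 2)),
        (∀ (x : X) (v : V) (s : spinorLine x),
          spinorVal (i.app x (EquivariantBundle.tmul (E := taut.dual) (F := lineBundle)
            (toDual x v) s)) = cliffordAction v s) ∧
        (∀ x, Function.Injective (i.app x)) ∧
        (∀ (x : X) (τ : (taut.dual.negTwist 1).Fiber x) (s : (halfSpinBundle 0).Fiber x),
          φ.app x (EquivariantBundle.tmul τ s) =
            cliffordMap (spinorVal (i.app x τ)) (spinorVal s)) ∧
        (∀ (x : X) (ω : ⋀[ℂ]^2 V), π.app x ω = exteriorPower.map 2 (toDual x) ω) ∧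
        ∀ x : X, Function.Injective (κ.app x) ∧ Function.Exact (κ.app x) (φ.app x) ∧
          Function.Exact (φ.app x) (π.app x) ∧ Function.Surjective (π.app x) := by
  exact ⟨schurBundle, kernelBundle, schurBundle_isIrreducible,
    ⟨subHom, quotHom, fun x => ⟨subHom_injective x, subHom_quotHom_exact x, quotHom_surjective x⟩⟩,
    spinorMap, kernelIncl, toWedge, wedgeProj, spinorMap_tmul, spinorMap_injective, toWedge_tmul,
    fun _ _ => rfl, fun x => ⟨kernelIncl_injective x, kernelIncl_toWedge_exact x,
      toWedge_wedgeProj_exact x, wedgeProj_surjective x⟩⟩
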